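/- Let $M$ be a compact isotropy irreducible Riemannian homogeneous space: its isometry group $G$ is a compact Lie group, the identity component $G_0$ of $G$ acts transitively on $M$, and, for a fixed $p\in M$, the isotropy group $K$ of $G_0$ at $p$ acts $\mathbb R$-irreducibly on $T_pM$. Let $\mathfrak g$ be the Lie algebra of $G$ with an $\mathrm{Ad}(G)$-invariant inner product such that $M=G_0/K$ carries the induced normal homogeneous metric (i.e. the differential at $e$ of $\pi:G_0\to M$, $\pi(a)=ap$, maps the orthogonal complement of the Lie algebra of $K$ isometrically onto $T_pM$), and give $G_0$ the corresponding bi-invariant metric. Let $V_{\mathfrak g}=L^2([0,1],\mathfrak g)$, on which the $H^1$-paths $g:[0,1]\to G$ act by $g*u=gug^{-1}-g'g^{-1}$; for a subgroup $H\subset G_0\times G_0$ let $P(G_0,H)$ be the group of $H^1$-paths $g$ in $G_0$ with $(g(0),g(1))\in H$, and let $H$ act on $G_0$ by $(b_1,b_2)\cdot a=b_1ab_2^{-1}$. Let $\Phi:V_{\mathfrak g}\to G_0$, $\Phi(u)=E_u(1)$, where $E_u^{-1}E_u'=u$, $E_u(0)=e$, be the parallel transport map, and $\Phi_K=\pi\circ\Phi:V_{\mathfrak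 g}\to M$. For a group $\Gamma$ acting isometrically on a Riemannian (Hilbert) manifold $X$, a submanifold $N\subset X$ is called $\Gamma$-weakly reflective if for each $q\in N$ and each normal vector $\xi$ of $N$ at $q$ there is an isometry $\nu$ of $X$ given by an element of $\Gamma$ with $\nu(q)=q$, $d\nu(\xi)=-\xi$ and $\nu(N)=N$. A submanifold of finite codimension of a Hilbert space is called proper Fredholm (PF) if the restriction of the end point map $(x,\xi)\mapsto x+\xi$ of its normal bundle to each disk bundle of finite radius is proper and Fredholm. Let $N$ be a closed submanifold of $M$ which is an orbit of a closed subgroup $U$ of $G_0$, and let $S$ be a closed subgroup of $G_0$ with $aSa^{-1}=S$ for all $a\in U$. Then $\Phi_K^{-1}(N)=P(G_0,U\times K)*u$ for every $u\in\Phi_K^{-1}(N)$, and the following are equivalent: (i) $N$ is an $S$-weakly reflective submanifold of $M$; (ii) $\pi^{-1}(N)$ is an $(S\times K)$-weakly reflective submanifold of $G_0$; (iii) $\Phi_K^{-1}(N)$ is a $P(G_0,S\times K)$-weakly reflective PF submanifold of $V_{\mathfrak g}$. -/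

import Mathlib

open Set Filter MeasureTheory
open scoped Manifold ContDiff Topology

noncomputable section

namespace ParallelTransport

/-! ### Submanifolds, tangent and normal vectors, isometries, weak reflectivity

`X` is a manifold modelled on a (finite or infinite dimensional) real normed space `E`; a
Riemannian metric enters as its family of inner products on the tangent spaces. -/

section General

variable {E : Type*} [NormedAddCommGroup E] [NormedSpace ℝ E]
  {X : Type*} [TopologicalSpace X] [ChartedSpace E X]

/-- `N` is an embedded smooth submanifold of `X` of codimension `k`: near each of its points it is
the zero set of a smooth `ℝᵏ`-valued map which is a submersion at that point. -/
def IsEmbeddedSubmanifold (E : Type*) [NormedAddCommGroup E] [NormedSpace ℝ E]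
    {X : Type*} [TopologicalSpace X] [ChartedSpace E X] (k : ℕ) (N : Set X) : Prop :=
  ∀ x ∈ N, ∃ W : Set X, IsOpen W ∧ x ∈ W ∧ ∃ f : X → EuclideanSpace ℝ (Fin k),
    ContMDiffOn 𝓘(ℝ, E) 𝓘(ℝ, EuclideanSpace ℝ (Fin k)) ∞ f W ∧
    (∀ y ∈ W, y ∈ N ↔ f y = 0) ∧
    Function.Surjective (mfderiv 𝓘(ℝ, E) 𝓘(ℝ, EuclideanSpace ℝ (Fin k)) f x)

/-- The tangent space `T_p N` of a submanifold `N` at `p`: spanned by the velocities `c'(0)` of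
smooth curves `c` in `N` with `c(0) = p`. -/
def tangentTo (N : Set X) (p : X) : Submodule ℝ (TangentSpace 𝓘(ℝ, E) p) :=
  Submodule.span ℝ {v : E | ∃ c : ℝ → X, ContMDiffAt 𝓘(ℝ, ℝ) 𝓘(ℝ, E) ∞ c 0 ∧ c 0 = p ∧
    (∀ᶠ t in 𝓝 (0 : ℝ), c t ∈ N) ∧ (mfderiv 𝓘(ℝ, ℝ) 𝓘(ℝ, E) c 0 (1 : ℝ) : E) = v}

/-- A family of bilinear forms on the tangent spaces (in use: a Riemannian metric). -/
abbrev MetricFamily (E : Type*) [NormedAddCommGroup E] [NormedSpace ℝ E]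
    (X : Type*) [TopologicalSpace X] [ChartedSpace E X] : Type _ :=
  ∀ x : X, TangentSpace 𝓘(ℝ, E) x → TangentSpace 𝓘(ℝ, E) x → ℝ

/-- `ξ` is a normal vector of `N` at `p`. -/
def IsNormalVector (m : MetricFamily E X) (N : Set X) (p : X) (ξ : TangentSpace 𝓘(ℝ, E) p) :
    Prop :=
  ∀ v ∈ tangentTo N p, m p ξ v = 0

/-- `ν` is an isometry of `X`: a diffeomorphism whose differential preserves the metric. -/
def IsRiemannianIsometry (m : MetricFamily E X) (ν : X → X) : Prop :=
  (∃ φ : X ≃ₘ^∞⟮𝓘(ℝ, E), 𝓘(ℝ, E)⟯ X, ⇑φ = ν) ∧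
  ∀ (x : X) (v w : TangentSpace 𝓘(ℝ, E) x),
    m (ν x) (mfderiv 𝓘(ℝ, E) 𝓘(ℝ, E) ν x v) (mfderiv 𝓘(ℝ, E) 𝓘(ℝ, E) ν x w) = m x v w

/-- `ν` is a reflection of `N` with respect to the vector `ξ` at `p`: an isometry of `X` with
`ν(p) = p`, `dν(ξ) = -ξ` and `ν(N) = N`. -/
structure IsReflection (m : MetricFamily E X) (N : Set X) (p : X) (ξ : TangentSpace 𝓘(ℝ, E) p)
    (ν : X → X) : Prop where
  isometry : IsRiemannianIsometry m ν
  fixes : ν p = p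
  reverses : (mfderiv 𝓘(ℝ, E) 𝓘(ℝ, E) ν p ξ : E) = -(ξ : E)
  preserves : ν '' N = N

/-- `N` is a `Γ`-weakly reflective submanifold of `X`, where `Γ` is a set of transformations
of `X`: every normal vector at every point of `N` admits a reflection which belongs to `Γ`. -/
def IsWeaklyReflectiveSubmanifold (m : MetricFamily E X) (Γ : Set (X → X)) (N : Set X) : Prop :=
  (∃ k : ℕ, IsEmbeddedSubmanifold E k N) ∧
  ∀ p ∈ N, ∀ ξ : TangentSpace 𝓘(ℝ, E) p, IsNormalVector m N p ξ →
    ∃ ν ∈ Γ, IsReflection m N p ξ ν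

end General

/-! ### Proper Fredholm submanifolds of a Hilbert space -/

section PF

variable {V : Type*} [NormedAddCommGroup V] [InnerProductSpace ℝ V]

/-- The flat Riemannian metric of a Hilbert space. -/
def flatMetric (V : Type*) [NormedAddCommGroup V] [InnerProductSpace ℝ V] : MetricFamily V V :=
  fun _ x y => @inner ℝ V _ x y

/-- The normal bundle of `P ⊆ V`, as a subset of `V × V`: pairs of a point of `P` and a normal
vector at it. -/
def normalBundle (P : Set V) : Set (V × V) :=
  {z | z.1 ∈ P ∧ IsNormalVector (flatMetric V) P z.1 z.2}

/-- The tangent space at `z` of the normal bundle of `P`, as a subspace of `V × V`. -/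
def normalBundleTangent (P : Set V) (z : V × V) : Submodule ℝ (V × V) :=
  tangentTo (E := V × V) (normalBundle P) z

/-- The differential at `z` of the end point map `(x, ξ) ↦ x + ξ` of the normal bundle of `P`. As
the end point map is the restriction of a continuous linear map of `V × V`, its
differential is the restriction of that linear map to the tangent space of the normal bundle. -/
def endPointDeriv (P : Set V) (z : V × V) : normalBundleTangent P z →L[ℝ] V :=
  (ContinuousLinearMap.fst ℝ V V + ContinuousLinearMap.snd ℝ V V).comp
    (normalBundleTangent P z).subtypeL

/-- `P` is a proper Fredholm (PF) submanifold of the Hilbert space `V`: a submanifold of finite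
codimension such that the restriction of the end point map to each disk normal
bundle of finite radius is a proper Fredholm map. -/
structure IsPFSubmanifold (P : Set V) : Prop where
  submanifold : ∃ k : ℕ, IsEmbeddedSubmanifold V k P
  proper : ∀ r : ℝ, IsProperMap
    (fun z : {z : V × V // z ∈ normalBundle P ∧ ‖z.2‖ ≤ r} => z.1.1 + z.1.2)
  fredholm : ∀ z ∈ normalBundle P, (endPointDeriv P z).IsFredholm

end PF

/-! ### Lie groups with an inner product on the Lie algebra -/

/-- The vector space `W` endowed with the norm of the inner product `c`. -/
def WithInner {W : Type*} [AddCommGroup W] [Module ℝ W] (_c : InnerProductSpace.Core ℝ W) :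
    Type _ := W

section WithInner

variable {W : Type*} [AddCommGroup W] [Module ℝ W] (c : InnerProductSpace.Core ℝ W)

instance : NormedAddCommGroup (WithInner c) :=
  @InnerProductSpace.Core.toNormedAddCommGroup ℝ W _ _ _ c

instance : InnerProductSpace ℝ (WithInner c) :=
  @InnerProductSpace.ofCore ℝ W _ _ _ c.toCore

/-- The identity map of `W`, from `W` with the norm of `c` to `W`. -/
def WithInner.equiv : WithInner c ≃ₗ[ℝ] W where
  toFun := fun x => x
  invFun := fun x => x
  map_add' := fun _ _ => rfl
  map_smul' := fun _ _ => rfl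
  left_inv := fun _ => rfl
  right_inv := fun _ => rfl

end WithInner

section Lie

variable {F : Type*} [NormedAddCommGroup F] [NormedSpace ℝ F]
  {G : Type*} [TopologicalSpace G] [ChartedSpace F G] [Group G]

/-- The identity component of a Lie group. -/
def identityComponent (F : Type*) [NormedAddCommGroup F] [NormedSpace ℝ F]
    (G : Type*) [TopologicalSpace G] [ChartedSpace F G] [Group G] [LieGroup 𝓘(ℝ, F) ∞ G] :
    Subgroup G :=
  haveI : IsTopologicalGroup G := topologicalGroup_of_lieGroup 𝓘(ℝ, F) ∞
  Subgroup.connectedComponentOfOne G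

/-- The adjoint representation: the differential at `1` of `x ↦ a x a⁻¹`. -/
def Ad (a : G) (v : GroupLieAlgebra 𝓘(ℝ, F) G) : GroupLieAlgebra 𝓘(ℝ, F) G :=
  (mfderiv 𝓘(ℝ, F) 𝓘(ℝ, F) (fun x : G => a * x * a⁻¹) 1 v : F)

/-- The inner product `c` on the Lie algebra is `Ad(G)`-invariant. -/
def IsAdInvariant (c : InnerProductSpace.Core ℝ (GroupLieAlgebra 𝓘(ℝ, F) G)) : Prop :=
  ∀ (a : G) (v w : GroupLieAlgebra 𝓘(ℝ, F) G), c.inner (Ad a v) (Ad a w) = c.inner v w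

/-- Left translation of a tangent vector at `a` to the identity. -/
def leftTranslate (a : G) (v : TangentSpace 𝓘(ℝ, F) a) : GroupLieAlgebra 𝓘(ℝ, F) G :=
  (mfderiv 𝓘(ℝ, F) 𝓘(ℝ, F) (fun x : G => a⁻¹ * x) a v : F)

/-- The left invariant Riemannian metric on `G` with value `c` at the identity; it is bi-invariant
when `c` is `Ad(G)`-invariant. -/
def groupMetric (c : InnerProductSpace.Core ℝ (GroupLieAlgebra 𝓘(ℝ, F) G)) : MetricFamily F G :=
  fun a v w => c.inner (leftTranslate a v) (leftTranslate a w)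

/-- The transformations `a ↦ b₁ a b₂⁻¹`, `(b₁, b₂) ∈ H`, of `G`. -/
def twoSidedTranslations (H : Subgroup (G × G)) : Set (G → G) :=
  {ν | ∃ b ∈ H, ν = fun a => b.1 * a * b.2⁻¹}

/-! #### Paths of class `H¹`, gauge transformations and the parallel transport map -/

variable (c : InnerProductSpace.Core ℝ (GroupLieAlgebra 𝓘(ℝ, F) G))

/-- The Hilbert space `V_𝔤 = L²([0,1], 𝔤)`, `𝔤` being endowed with the inner product `c`. -/
abbrev PathSpace : Type _ := Lp (WithInner c) 2 (volume.restrict (Icc (0 : ℝ) 1))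

variable {c}

/-- The value in `𝔤` of `u ∈ L²([0,1], 𝔤)` at the time `t`. -/
def PathSpace.val (u : PathSpace c) (t : ℝ) : GroupLieAlgebra 𝓘(ℝ, F) G :=
  WithInner.equiv c (u t)

/-- The path `g : [0,1] → G` is of class `H¹` and its weak derivative `g'` satisfies `g⁻¹ g' = w`,
where `w ∈ L²([0,1], 𝔤)`: the path is continuous, and along it every smooth function `f` on `G`
is the integral of `df(g w)`. (Values of `g` outside `[0,1]` play no role.) -/
def HasLogDeriv (g : ℝ → G) (w : PathSpace c) : Prop :=
  ContinuousOn g (Icc 0 1) ∧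
  ∀ f : G → ℝ, ContMDiff 𝓘(ℝ, F) 𝓘(ℝ, ℝ) ∞ f → ∀ t ∈ Icc (0 : ℝ) 1,
    f (g t) - f (g 0) = ∫ s in (0 : ℝ)..t,
      (mfderiv 𝓘(ℝ, F) 𝓘(ℝ, ℝ) f (g s) (mulInvariantVectorField (w.val s) (g s)) : ℝ)

variable (c) in
/-- `P(A, H)`: the `H¹`-paths `g : [0,1] → A` with `(g(0), g(1)) ∈ H`. -/
def pathGroup (A : Subgroup G) (H : Subgroup (G × G)) : Set (ℝ → G) :=
  {g | (∃ w : PathSpace c, HasLogDeriv g w) ∧ (∀ t ∈ Icc (0 : ℝ) 1, g t ∈ A) ∧ (g 0, g 1) ∈ H}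

/-- `v = g * u`, where `g * u = g u g⁻¹ - g' g⁻¹` is the gauge action. If `w = g⁻¹ g'`
then `g' g⁻¹ = Ad(g) w`. -/
def IsGaugeTransform (g : ℝ → G) (u v : PathSpace c) : Prop :=
  ∃ w : PathSpace c, HasLogDeriv g w ∧
    ∀ᵐ t ∂(volume.restrict (Icc (0 : ℝ) 1)), v.val t = Ad (g t) (u.val t) - Ad (g t) (w.val t)

/-- The transformations `u ↦ g * u`, `g ∈ Γ`, of `V_𝔤`. -/
def gaugeTransformations (Γ : Set (ℝ → G)) : Set (PathSpace c → PathSpace c) :=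
  {ν | ∃ g ∈ Γ, ∀ u, IsGaugeTransform g u (ν u)}

/-- The orbit `Γ * u`. -/
def gaugeOrbit (Γ : Set (ℝ → G)) (u : PathSpace c) : Set (PathSpace c) :=
  {v | ∃ g ∈ Γ, IsGaugeTransform g u v}

/-- `E_u`: the solution of `E⁻¹ E' = u`, `E(0) = 1`. -/
def transportPath (u : PathSpace c) : ℝ → G :=
  Classical.epsilon fun g : ℝ → G => HasLogDeriv g u ∧ g 0 = 1

/-- The parallel transport map `Φ(u) = E_u(1)`. -/
def parallelTransport (u : PathSpace c) : G := transportPath u 1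

end Lie

/-! ### Isotropy irreducible homogeneous spaces -/

section Homogeneous

variable {E : Type*} [NormedAddCommGroup E] [NormedSpace ℝ E]
  {M : Type*} [TopologicalSpace M] [ChartedSpace E M] [IsManifold 𝓘(ℝ, E) ∞ M]
  {F : Type*} [NormedAddCommGroup F] [NormedSpace ℝ F]
  {G : Type*} [TopologicalSpace G] [ChartedSpace F G] [Group G]

/-- The inner products of a smooth Riemannian metric. -/
def metricOf (h : Bundle.ContMDiffRiemannianMetric 𝓘(ℝ, E) ∞ E
    (fun x : M => TangentSpace 𝓘(ℝ, E) x)) : MetricFamily E M :=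
  fun x v w => h.inner x v w

/-- The Lie group `G`, acting smoothly and effectively on `M`, is the group of isometries of `M`:
its elements act as isometries, and every isometry arises in this way. -/
def IsIsometryGroup (G : Type*) [Group G] [MulAction G M] (m : MetricFamily E M) : Prop :=
  FaithfulSMul G M ∧ (∀ a : G, IsRiemannianIsometry m fun x : M => a • x) ∧
  ∀ ν : M → M, IsRiemannianIsometry m ν → ∃ a : G, ν = fun x : M => a • x

variable [MulAction G M]

/-- The isotropy subgroup at `p` of a subgroup `A` of `G`. -/
def isotropy (A : Subgroup G) (p : M) : Subgroup G := A ⊓ MulAction.stabilizer G p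

/-- The linear isotropy representation on `T_p M` of the subgroup `K` of the stabilizer
of `p` is irreducible over `ℝ`: there are no invariant subspaces but `0` and `T_p M`. (`T_p M` is, as a
vector space, the model space `E`.) -/
def IsIsotropyIrreducible (E : Type*) [NormedAddCommGroup E] [NormedSpace ℝ E]
    {M : Type*} [TopologicalSpace M] [ChartedSpace E M] [MulAction G M]
    (K : Subgroup G) (p : M) : Prop :=
  ∀ W : Submodule ℝ E,
    (∀ a ∈ K, ∀ v ∈ W, (mfderiv 𝓘(ℝ, E) 𝓘(ℝ, E) (fun x : M => a • x) p v : E) ∈ W) →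
      W = ⊥ ∨ W = ⊤

/-- The metric `m` on `M` is the normal homogeneous metric induced by the inner product `c`:
for the differential `A : 𝔤 → T_p M` at `1` of `a ↦ a • p`, whose kernel is the Lie algebra `𝔨` of
the isotropy group at `p`, the restriction of `A` to the orthogonal complement `𝔪` of `𝔨` is an
isometry onto `T_p M`. -/
def IsNormalHomogeneousMetric (m : MetricFamily E M)
    (c : InnerProductSpace.Core ℝ (GroupLieAlgebra 𝓘(ℝ, F) G)) (p : M) : Prop :=
  let A := mfderiv 𝓘(ℝ, F) 𝓘(ℝ, E) (fun a : G => a • p) 1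
  Function.Surjective A ∧
  ∀ v w : GroupLieAlgebra 𝓘(ℝ, F) G, (∀ z, A z = 0 → c.inner v z = 0) →
    (∀ z, A z = 0 → c.inner w z = 0) → m ((1 : G) • p) (A v) (A w) = c.inner v w

/-- The inverse image of `N ⊆ M` under `π : A → M`, `π(a) = a • p`. (For the open subgroup `A = G₀`
it is regarded as a subset of `G`.) -/
def projPreimage (A : Subgroup G) (p : M) (N : Set M) : Set G := {a | a ∈ A ∧ a • p ∈ N}

/-- The parallel transport map `Φ_K = π ∘ Φ : V_𝔤 → M`, `π(a) = a • p`. -/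
def parallelTransportTo {c : InnerProductSpace.Core ℝ (GroupLieAlgebra 𝓘(ℝ, F) G)} (p : M)
    (u : PathSpace c) : M := parallelTransport u • p

/-- The transformations of `M` by the elements of `S`. -/
def actionOf (M : Type*) [MulAction G M] (S : Subgroup G) : Set (M → M) :=
  {ν | ∃ s ∈ S, ν = fun x => s • x}

end Homogeneous

end ParallelTransport

end

open ParallelTransport

/-! Both `π : a ↦ a • p` and the parallel transport map `Φ` are Riemannian submersions, and the
three symmetry groups correspond along them. For a Riemannian submersion `ψ`, the normal vectors of
`ψ⁻¹(N)` are the horizontal lifts of those of `N`. If an isometry `ν` upstairs covers `s` downstairs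
and fixes the base point, then `dν` preserves horizontality, so `dν` reverses a horizontal vector
exactly when `ds` reverses its image. This is `isWeaklyReflectiveSubmanifold_preimage_iff`. It
reduces the equivalences to two points: every transformation in the upper group that fixes the base
point covers an element of the lower group, and every `s` fixing `ψ x` and preserving `N` lifts to
an upper transformation fixing `x` and preserving the preimage.

Descent follows from `π(b₁ a b₂⁻¹) = b₁ π(a)` for `b₂ ∈ K` and from the equivariance `Φ(g * u) =
g(0) Φ(u) g(1)⁻¹`. For lifting, if `s` fixes `a • p` then `a⁻¹ s a ∈ K`, and `y ↦ s y (a⁻¹ s a)⁻¹`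
fixes `a`. In the path space the conjugate path `g = E_x⁻¹ s E_x` gives a gauge transformation that
fixes `x` and covers `s`. More generally `E_v⁻¹ a E_u` carries `u` to `v`, which identifies the
preimage of an orbit with a gauge orbit (`exists_gauge`).

The analysis rests on the shift formula `E_v = E_{T(v - u)} E_u`, where `T` is pointwise
`Ad(E_u(t))` (`transportPath_mul`). By `Ad`-invariance `T` is an isometry of `L²`, so existence and
smoothness near the zero control, where the implicit function theorem applies in a chart, spread to
the whole path space. At `0` the differential of `Φ` is the mean value. At `u` it is the mean of `T
v`, translated from the right by `Φ(u)`. Hence the horizontal space at `u` consists of `T⁻¹` of the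
constant paths, and `Φ` is a Riemannian submersion. Its range is an open subgroup, hence the
identity component.

The PF property holds for the preimage of any closed submanifold `P` of the group. A normal vector
`ξ` at `x` is `T_x⁻¹ κ`, with `κ` the constant path of value `η`, and its end point `y = x + ξ`
satisfies `E_y = E_κ E_x`. So `(x, ξ)` can be recovered smoothly from `(y, η)`, and the condition on
`(y, η)` is the closed one that `(Φ(κ)⁻¹ Φ(y), η)` lies in the right-trivialized normal bundle of
`P`. In these coordinates the end point map is the projection `(y, η) ↦ y`. Properness follows
because `η` lives in a finite-dimensional space and `‖ξ‖ = ‖η‖`. The Fredholm property follows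
because the tangent spaces of the normal bundle agree with the path space up to finite dimensions.
-/

open ParallelTransport

universe u

/-! ### A constancy criterion replacing pointwise differentiation -/

section Increments

variable {E : Type*} [NormedAddCommGroup E]

/-- A function on `[0,1]` whose increments over short intervals are arbitrarily small multiples of
an integrable weight is constant. -/
theorem eq_of_norm_increment_le {R : ℝ → E} {φ : ℝ → ℝ}
    (hφ : IntervalIntegrable φ volume 0 1)
    (h : ∀ ε > 0, ∃ δ > 0, ∀ s t, 0 ≤ s → s ≤ t → t ≤ 1 → t - s < δ →
      ‖R t - R s‖ ≤ ε * ∫ r in s..t, φ r) :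
    ∀ t ∈ Icc (0 : ℝ) 1, R t = R 0 := by
  rintro t ⟨ht0, ht1⟩
  have key : ∀ ε > 0, ‖R t - R 0‖ ≤ ε * ∫ r in (0 : ℝ)..t, φ r := by
    intro ε hε
    obtain ⟨δ, hδ, H⟩ := h ε hε
    obtain ⟨n, hn⟩ := exists_nat_gt (1 / δ)
    have hn0 : (0 : ℝ) < n := lt_trans (by positivity) hn
    have hn1 : 1 / (n : ℝ) < δ := by
      rw [div_lt_iff₀ hδ] at hn
      rw [div_lt_iff₀ hn0]; linarith
    let a : ℕ → ℝ := fun i => i * t / n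
    have ha : Monotone a := fun i j hij => by
      have : (i : ℝ) ≤ j := by exact_mod_cast hij
      simp only [a]; gcongr
    have ha0 : a 0 = 0 := by simp [a]
    have han : a n = t := by simp only [a]; field_simp
    have hsum : ‖R (a n) - R (a 0)‖ ≤
        ∑ i ∈ Finset.range n, ‖R (a (i + 1)) - R (a i)‖ := by
      rw [← Finset.sum_range_sub (fun i => R (a i)) n]
      exact norm_sum_le _ _
    have hle : ∀ i ∈ Finset.range n, ‖R (a (i + 1)) - R (a i)‖ ≤
        ε * ∫ r in a i..a (i + 1), φ r := by
      intro i hi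
      have hi' : i + 1 ≤ n := Finset.mem_range.mp hi
      refine H _ _ (ha0 ▸ ha (Nat.zero_le i)) (ha i.le_succ) ((han ▸ ha hi').trans ht1) ?_
      have : a (i + 1) - a i = t / n := by simp only [a]; push_cast; ring
      rw [this]
      refine lt_of_le_of_lt ?_ hn1
      gcongr
    have hint : ∑ i ∈ Finset.range n, ∫ r in a i..a (i + 1), φ r = ∫ r in a 0..a n, φ r := by
      refine intervalIntegral.sum_integral_adjacent_intervals fun i hi => hφ.mono_set ?_
      rw [uIcc_of_le (ha i.le_succ), uIcc_of_le zero_le_one]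
      exact Icc_subset_Icc (ha0 ▸ ha (Nat.zero_le i))
        ((han ▸ ha (Nat.succ_le_of_lt hi)).trans ht1)
    have := hsum.trans (Finset.sum_le_sum hle)
    rwa [← Finset.mul_sum, hint, ha0, han] at this
  have h0 : ‖R t - R 0‖ ≤ 0 := by
    refine le_of_forall_pos_lt_add fun η hη => ?_
    rw [zero_add]
    set J := ∫ r in (0 : ℝ)..t, φ r
    -- The denominator `|J| + 1` avoids any assumption on the sign or vanishing of `J`.
    have h1 := key (η / (2 * (|J| + 1))) (by positivity)
    refine h1.trans_lt ?_
    have h2 : η / (2 * (|J| + 1)) * J ≤ η / (2 * (|J| + 1)) * (|J| + 1) := by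
      gcongr
      linarith [le_abs_self J]
    have h3 : η / (2 * (|J| + 1)) * (|J| + 1) = η / 2 := by
      field_simp
    linarith
  exact sub_eq_zero.mp (norm_le_zero_iff.mp h0)

end Increments


/-! ### Smoothness of composition operators on continuous functions -/

section Superposition

variable {K : Type*} [TopologicalSpace K] [CompactSpace K]
  {E : Type*} [NormedAddCommGroup E] [NormedSpace ℝ E]
  {E' : Type*} [NormedAddCommGroup E'] [NormedSpace ℝ E']

/-- Pointwise application of a continuous family of linear maps to a continuous function. -/
noncomputable def pointwiseApply (K : Type*) [TopologicalSpace K] [CompactSpace K]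
    (E : Type*) [NormedAddCommGroup E] [NormedSpace ℝ E]
    (E' : Type*) [NormedAddCommGroup E'] [NormedSpace ℝ E'] :
    C(K, E →L[ℝ] E') →L[ℝ] C(K, E) →L[ℝ] C(K, E') :=
  LinearMap.mkContinuous₂
    (LinearMap.mk₂ ℝ (fun (A : C(K, E →L[ℝ] E')) (γ : C(K, E)) => (⟨fun k => A k (γ k), by fun_prop⟩ : C(K, E')))
      (fun _ _ _ => by ext; simp) (fun _ _ _ => by ext; simp)
      (fun _ _ _ => by ext; simp) (fun _ _ _ => by ext; simp)) 1 fun A γ => by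
    rw [one_mul, ContinuousMap.norm_le _ (by positivity)]
    intro k
    exact (A k).le_of_opNorm_le_of_le (A.norm_coe_le_norm k) (γ.norm_coe_le_norm k)

@[simp]
theorem pointwiseApply_apply (A : C(K, E →L[ℝ] E')) (γ : C(K, E)) (k : K) :
    pointwiseApply K E E' A γ k = A k (γ k) := rfl

/-- The mean value inequality is applied at each `k`, and the bound is uniform in `k` because `γ ↦
fderiv ℝ f ∘ γ` is continuous for the supremum norm. -/
theorem hasFDerivAt_continuousMap_comp {f : E → E'} (hf : Differentiable ℝ f)
    (hf' : Continuous (fderiv ℝ f)) (γ : C(K, E)) :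
    HasFDerivAt (fun γ : C(K, E) => (⟨f, hf.continuous⟩ : C(E, E')).comp γ)
      (pointwiseApply K E E' ((⟨fderiv ℝ f, hf'⟩ : C(E, E →L[ℝ] E')).comp γ)) γ := by
  rw [hasFDerivAt_iff_isLittleO_nhds_zero, Asymptotics.isLittleO_iff]
  intro ε hε
  have hc : Continuous fun γ : C(K, E) => (⟨fderiv ℝ f, hf'⟩ : C(E, E →L[ℝ] E')).comp γ :=
    ContinuousMap.continuous_postcomp _
  obtain ⟨δ, hδ, H⟩ := Metric.continuous_iff (α := C(K, E)) (β := C(K, E →L[ℝ] E')) |>.mp hc γ ε hε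
  filter_upwards [Metric.ball_mem_nhds (0 : C(K, E)) hδ] with h hh
  rw [mem_ball_zero_iff] at hh
  rw [ContinuousMap.norm_le _ (by positivity)]
  intro k
  have hseg : ∀ x ∈ segment ℝ (γ k) (γ k + h k), ‖fderiv ℝ f x - fderiv ℝ f (γ k)‖ ≤ ε := by
    intro x hx
    rw [segment_eq_image'] at hx
    obtain ⟨θ, ⟨hθ0, hθ1⟩, rfl⟩ := hx
    -- A point of the segment at `k` is the value at `k` of the whole function `γ + θ • h`, which is
    -- still `δ`-close to `γ`.
    have h1 : dist (γ + θ • h) γ < δ := by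
      rw [dist_eq_norm, add_sub_cancel_left, norm_smul, Real.norm_of_nonneg hθ0]
      exact lt_of_le_of_lt (mul_le_of_le_one_left (norm_nonneg _) hθ1) hh
    have h2 := (ContinuousMap.dist_lt_iff hε).mp (H _ h1) k
    rw [dist_eq_norm] at h2
    simpa using h2.le
  have := (convex_segment (γ k) (γ k + h k)).norm_image_sub_le_of_norm_hasFDerivWithin_le'
    (f := f) (f' := fderiv ℝ f) (φ := fderiv ℝ f (γ k)) (C := ε)
    (fun x _ => (hf x).hasFDerivAt.hasFDerivWithinAt) hseg (left_mem_segment ℝ _ _)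
    (right_mem_segment ℝ _ _)
  rw [add_sub_cancel_left] at this
  refine le_trans ?_ (this.trans ?_)
  · simp
  · gcongr
    exact h.norm_coe_le_norm k

/-- The derivative is again a composition operator, with `fderiv ℝ f`, followed by the continuous
linear map `pointwiseApply`. The target is quantified inside the induction because each step
replaces it by a space of linear maps; this is also why both spaces share a universe. -/
theorem contDiff_continuousMap_comp_nat {E : Type u} [NormedAddCommGroup E] [NormedSpace ℝ E]
    (n : ℕ) : ∀ {E' : Type u} [NormedAddCommGroup E'] [NormedSpace ℝ E'] {f : E → E'}
    (hf : ContDiff ℝ n f),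
    ContDiff ℝ n (fun γ : C(K, E) => (⟨f, hf.continuous⟩ : C(E, E')).comp γ) := by
  induction n with
  | zero =>
    intro E' _ _ f hf
    exact contDiff_zero.mpr (ContinuousMap.continuous_postcomp _)
  | succ n ih =>
    intro E' _ _ f hf
    obtain ⟨hd, -, hf'⟩ := (contDiff_succ_iff_fderiv (n := n)).mp (by exact_mod_cast hf)
    have hD := hasFDerivAt_continuousMap_comp (K := K) hd hf'.continuous
    push_cast
    rw [contDiff_succ_iff_hasFDerivAt]
    refine ⟨_, ?_, hD⟩
    exact (pointwiseApply K E E').contDiff.comp (ih hf')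

/-- Composition with a smooth map is a smooth map between spaces of continuous functions. -/
theorem contDiff_continuousMap_comp {E E' : Type u} [NormedAddCommGroup E] [NormedSpace ℝ E]
    [NormedAddCommGroup E'] [NormedSpace ℝ E'] {f : E → E'} (hf : ContDiff ℝ ∞ f) :
    ContDiff ℝ ∞ (fun γ : C(K, E) => (⟨f, hf.continuous⟩ : C(E, E')).comp γ) :=
  contDiff_infty.mpr fun n => contDiff_continuousMap_comp_nat n (contDiff_infty.mp hf n)

end Superposition

/-! ### Square integrable paths: multiplication operators, primitives, means, constants -/

section SquareIntegrablePaths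

/-- Square integrable paths in `W`, parametrised by `[0,1]`. -/
abbrev L2Path (W : Type*) [NormedAddCommGroup W] : Type _ :=
  Lp W 2 (volume.restrict (Icc (0 : ℝ) 1))

instance isProbabilityMeasure_restrict_Icc_zero_one :
    IsProbabilityMeasure (volume.restrict (Icc (0 : ℝ) 1)) :=
  ⟨by simp⟩

variable {W : Type*} [NormedAddCommGroup W]

theorem L2Path.integrableOn (u : L2Path W) : IntegrableOn u (Icc (0 : ℝ) 1) :=
  (Lp.memLp u).integrable one_le_two

theorem L2Path.intervalIntegrable (u : L2Path W) {s t : ℝ} (hs : s ∈ Icc (0 : ℝ) 1)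
    (ht : t ∈ Icc (0 : ℝ) 1) : IntervalIntegrable u volume s t :=
  (u.integrableOn.mono_set (by
    rw [uIcc_of_le zero_le_one])).intervalIntegrable.mono_set
      (by rw [uIcc_of_le (zero_le_one (α := ℝ))]; exact uIcc_subset_Icc hs ht)

theorem L2Path.integral_norm_le (u : L2Path W) : ∫ t in Icc (0 : ℝ) 1, ‖u t‖ ≤ ‖u‖ := by
  have h1 := eLpNorm_le_eLpNorm_of_exponent_le (μ := volume.restrict (Icc (0 : ℝ) 1)) (f := u)
    (p := 1) (q := 2) one_le_two (Lp.aestronglyMeasurable u)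
  rw [integral_norm_eq_lintegral_enorm (Lp.aestronglyMeasurable u), ← eLpNorm_one_eq_lintegral_enorm,
    Lp.norm_def]
  exact ENNReal.toReal_mono (Lp.eLpNorm_ne_top u) h1

theorem L2Path.ext_ae {u v : L2Path W} (h : ∀ᵐ t ∂(volume.restrict (Icc (0 : ℝ) 1)), u t = v t) :
    u = v := Lp.ext h

variable {W' W'' : Type*} [NormedSpace ℝ W]
  [NormedAddCommGroup W'] [NormedSpace ℝ W'] [NormedAddCommGroup W''] [NormedSpace ℝ W'']

theorem memLp_clm_apply {A : ℝ → W →L[ℝ] W'} (hA : Continuous A) {C : ℝ} (hC : ∀ t, ‖A t‖ ≤ C)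
    (u : L2Path W) : MemLp (fun t => A t (u t)) 2 (volume.restrict (Icc (0 : ℝ) 1)) := by
  refine (Lp.memLp u).of_le_mul (c := C) ?_ (ae_of_all _ fun t => (A t).le_of_opNorm_le (hC t) _)
  exact isBoundedBilinearMap_apply.continuous.comp_aestronglyMeasurable
    (hA.aestronglyMeasurable.prodMk (Lp.aestronglyMeasurable u))

/-- The extension of a continuous function on `[0,1]` to the line. -/
noncomputable abbrev extendUnit {X : Type*} [TopologicalSpace X] (A : C(Icc (0 : ℝ) 1, X)) (t : ℝ) : X :=
  A (projIcc 0 1 zero_le_one t)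

theorem continuous_extendUnit {X : Type*} [TopologicalSpace X] (A : C(Icc (0 : ℝ) 1, X)) :
    Continuous (extendUnit A) := A.continuous.comp continuous_projIcc

theorem memLp_extendUnit_apply (A : C(Icc (0 : ℝ) 1, W →L[ℝ] W')) (u : L2Path W) :
    MemLp (fun t => extendUnit A t (u t)) 2 (volume.restrict (Icc (0 : ℝ) 1)) :=
  memLp_clm_apply (continuous_extendUnit A) (fun _ => A.norm_coe_le_norm _) u

/-- Pointwise application of a continuous family of linear maps to a square integrable path. -/
noncomputable def mulOp (W W' : Type*) [NormedAddCommGroup W] [NormedSpace ℝ W]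
    [NormedAddCommGroup W'] [NormedSpace ℝ W'] :
    C(Icc (0 : ℝ) 1, W →L[ℝ] W') →L[ℝ] L2Path W →L[ℝ] L2Path W' :=
  LinearMap.mkContinuous₂
    (LinearMap.mk₂ ℝ (fun (A : C(Icc (0 : ℝ) 1, W →L[ℝ] W')) (u : L2Path W) =>
        (memLp_extendUnit_apply A u).toLp)
      (fun A B u => by
        rw [← MemLp.toLp_add]; rfl)
      (fun r A u => by
        rw [← MemLp.toLp_const_smul]; rfl)
      (fun A u v => by
        rw [← MemLp.toLp_add]
        refine MemLp.toLp_congr _ _ ?_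
        filter_upwards [Lp.coeFn_add u v] with t ht
        rw [ht, Pi.add_apply, map_add]
        rfl)
      (fun r A u => by
        rw [← MemLp.toLp_const_smul]
        refine MemLp.toLp_congr _ _ ?_
        filter_upwards [Lp.coeFn_smul r u] with t ht
        rw [ht, Pi.smul_apply, map_smul]
        rfl)) 1 fun A u => by
    rw [one_mul]
    refine Lp.norm_le_mul_norm_of_ae_le_mul ?_
    filter_upwards [(memLp_extendUnit_apply A u).coeFn_toLp] with t ht
    rw [LinearMap.mk₂_apply, ht]
    exact (extendUnit A t).le_of_opNorm_le (A.norm_coe_le_norm _) _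

theorem coeFn_mulOp (A : C(Icc (0 : ℝ) 1, W →L[ℝ] W')) (u : L2Path W) :
    mulOp W W' A u =ᵐ[volume.restrict (Icc (0 : ℝ) 1)] fun t => extendUnit A t (u t) :=
  (memLp_extendUnit_apply A u).coeFn_toLp

theorem continuous_integral_zero (u : L2Path W) :
    Continuous fun t : Icc (0 : ℝ) 1 => ∫ s in (0 : ℝ)..t, u s := by
  have h := intervalIntegral.continuousOn_primitive_interval (μ := volume) (f := u) (a := 0) (b := 1)
    (by rw [uIcc_of_le zero_le_one]; exact u.integrableOn)
  rw [uIcc_of_le zero_le_one] at h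
  exact continuousOn_iff_continuous_domRestrict.mp h

/-- The primitive vanishing at `0` of a square integrable path. -/
noncomputable def primitiveOp (W : Type*) [NormedAddCommGroup W] [NormedSpace ℝ W] :
    L2Path W →L[ℝ] C(Icc (0 : ℝ) 1, W) :=
  LinearMap.mkContinuous
    { toFun := fun u => ⟨fun t : Icc (0 : ℝ) 1 => ∫ s in (0 : ℝ)..t, u s, continuous_integral_zero u⟩
      map_add' := fun u v => by
        ext t
        have h0 : (0 : ℝ) ∈ Icc (0 : ℝ) 1 := ⟨le_rfl, zero_le_one⟩
        simp only [ContinuousMap.coe_mk, ContinuousMap.add_apply]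
        rw [← intervalIntegral.integral_add (u.intervalIntegrable h0 t.2)
          (v.intervalIntegrable h0 t.2)]
        refine intervalIntegral.integral_congr_ae ?_
        have := (ae_restrict_iff' measurableSet_Icc).mp (Lp.coeFn_add u v)
        filter_upwards [this] with s hs hst
        rw [uIoc_of_le t.2.1] at hst
        exact hs ⟨hst.1.le, hst.2.trans t.2.2⟩
      map_smul' := fun r u => by
        ext t
        simp only [ContinuousMap.coe_mk, RingHom.id_apply, ContinuousMap.smul_apply]
        rw [← intervalIntegral.integral_smul]
        refine intervalIntegral.integral_congr_ae ?_
        have := (ae_restrict_iff' measurableSet_Icc).mp (Lp.coeFn_smul r u)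
        filter_upwards [this] with s hs hst
        rw [uIoc_of_le t.2.1] at hst
        exact hs ⟨hst.1.le, hst.2.trans t.2.2⟩ } 1 fun u => by
    rw [one_mul, ContinuousMap.norm_le _ (norm_nonneg _)]
    intro t
    refine le_trans ?_ u.integral_norm_le
    simp only [LinearMap.coe_mk, AddHom.coe_mk, ContinuousMap.coe_mk]
    rw [intervalIntegral.integral_of_le t.2.1]
    refine (norm_integral_le_integral_norm _).trans
      (setIntegral_mono_set u.integrableOn.norm (ae_of_all _ fun _ => norm_nonneg _) ?_)
    exact (Ioc_subset_Icc_self.trans (Icc_subset_Icc_right t.2.2)).eventuallyLE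

theorem integral_congr_unit {f g : ℝ → W}
    (h : f =ᵐ[volume.restrict (Icc (0 : ℝ) 1)] g) {s t : ℝ} (hs : s ∈ Icc (0 : ℝ) 1)
    (ht : t ∈ Icc (0 : ℝ) 1) : ∫ r in s..t, f r = ∫ r in s..t, g r := by
  refine intervalIntegral.integral_congr_ae ?_
  filter_upwards [(ae_restrict_iff' measurableSet_Icc).mp h] with r hr hrt
  exact hr (uIcc_subset_Icc hs ht (uIoc_subset_uIcc hrt))

theorem intervalIntegrable_clm_apply {A : ℝ → W →L[ℝ] W'} (hA : ContinuousOn A (Icc 0 1))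
    (u : L2Path W) {s t : ℝ} (hs : s ∈ Icc (0 : ℝ) 1) (ht : t ∈ Icc (0 : ℝ) 1) :
    IntervalIntegrable (fun r => A r (u r)) volume s t := by
  let A' : C(Icc (0 : ℝ) 1, W →L[ℝ] W') := ⟨_, hA.domRestrict⟩
  refine ((mulOp W W' A' u).intervalIntegrable hs ht).congr_ae ?_
  have := (ae_restrict_iff' measurableSet_Icc).mp (coeFn_mulOp A' u)
  refine (ae_restrict_iff' measurableSet_uIoc).mpr ?_
  filter_upwards [this] with r hr hrt
  have hr' : r ∈ Icc (0 : ℝ) 1 := uIcc_subset_Icc hs ht (uIoc_subset_uIcc hrt)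
  rw [hr hr', extendUnit, projIcc_of_mem _ hr']
  rfl

/-- The mean of a square integrable path. -/
noncomputable def meanOp (W : Type*) [NormedAddCommGroup W] [NormedSpace ℝ W] :
    L2Path W →L[ℝ] W :=
  (ContinuousMap.evalCLM ℝ (⟨1, zero_le_one, le_rfl⟩ : Icc (0 : ℝ) 1)).comp (primitiveOp W)

theorem meanOp_apply (u : L2Path W) : meanOp W u = ∫ s in (0 : ℝ)..1, u s := rfl

/-- The constant paths. -/
noncomputable def constOp (W : Type*) [NormedAddCommGroup W] [NormedSpace ℝ W] :
    W →L[ℝ] L2Path W := Lp.constL 2 _ ℝ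

theorem coeFn_constOp (w : W) :
    constOp W w =ᵐ[volume.restrict (Icc (0 : ℝ) 1)] fun _ => w :=
  Lp.coeFn_const _ _ _

theorem meanOp_constOp [CompleteSpace W] (w : W) : meanOp W (constOp W w) = w := by
  rw [meanOp_apply, integral_congr_unit (coeFn_constOp w) ⟨le_rfl, zero_le_one⟩
    ⟨zero_le_one, le_rfl⟩]
  simp

end SquareIntegrablePaths

/-! ### The orthogonal complement of the paths of mean zero -/

section MeanAdjoint

variable {W : Type*} [NormedAddCommGroup W] [InnerProductSpace ℝ W]

variable [CompleteSpace W]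

/-- Together with `meanOp_constOp` this makes `constOp ∘ meanOp` the orthogonal projection onto the
constant paths. -/
theorem inner_constOp (w : W) (v : L2Path W) :
    inner ℝ (constOp W w) v = inner ℝ w (meanOp W v) := by
  rw [L2.inner_def, meanOp_apply, intervalIntegral.integral_of_le zero_le_one,
    ← integral_Icc_eq_integral_Ioc, ← integral_inner v.integrableOn]
  refine integral_congr_ae ?_
  filter_upwards [coeFn_constOp w] with t ht
  rw [ht]

/-- A path orthogonal to all paths of mean zero is constant. -/
theorem eq_constOp_of_orthogonal {ζ : L2Path W}
    (h : ∀ v, meanOp W v = 0 → inner ℝ ζ v = 0) : ζ = constOp W (meanOp W ζ) := by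
  rw [← sub_eq_zero]
  have h0 : meanOp W (ζ - constOp W (meanOp W ζ)) = 0 := by
    rw [map_sub, meanOp_constOp, sub_self]
  rw [← inner_self_eq_zero (𝕜 := ℝ)]
  conv_lhs => rw [inner_sub_left, h _ h0, inner_constOp, h0, inner_zero_right, sub_zero]

end MeanAdjoint

/-! ### Controlled equations with small square integrable controls -/

section ControlledODE

variable {W F : Type u} [NormedAddCommGroup W] [NormedSpace ℝ W] [CompleteSpace W]
  [NormedAddCommGroup F] [NormedSpace ℝ F] [CompleteSpace F]

/-- Solutions of the controlled equation `γ' = X(γ) u`, `γ(0) = x₀`, for small square integrable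
controls `u`: they exist and depend smoothly on `u`. -/
theorem exists_contDiffAt_solution {X : F → W →L[ℝ] F} (hX : ContDiff ℝ ∞ X) (x₀ : F) :
    ∃ γ : L2Path W → C(Icc (0 : ℝ) 1, F), ContDiffAt ℝ ∞ γ 0 ∧ γ 0 = ContinuousMap.const _ x₀ ∧
      (∀ᶠ u in 𝓝 0, ∀ t, γ u t = x₀ + ∫ s in (0 : ℝ)..t, X (extendUnit (γ u) s) (u s)) ∧
      ∀ u t, fderiv ℝ γ 0 u t = ∫ s in (0 : ℝ)..t, X x₀ (u s) := by
  let N : C(Icc (0 : ℝ) 1, F) → C(Icc (0 : ℝ) 1, W →L[ℝ] F) :=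
    fun γ => (⟨X, hX.continuous⟩ : C(F, W →L[ℝ] F)).comp γ
  have hN : ContDiff ℝ ∞ N := contDiff_continuousMap_comp hX
  let x : C(Icc (0 : ℝ) 1, F) := ContinuousMap.const _ x₀
  -- The zeros of `Ψ` are the solutions of the integral equation. The integral term is linear in the
  -- control, so at control `0` the partial derivative in the path is the identity and the implicit
  -- function theorem applies.
  let Ψ : L2Path W × C(Icc (0 : ℝ) 1, F) → C(Icc (0 : ℝ) 1, F) :=
    fun z => z.2 - x - primitiveOp F (mulOp W F (N z.2) z.1)
  have hM : ContDiff ℝ ∞ fun z : L2Path W × C(Icc (0 : ℝ) 1, F) => mulOp W F (N z.2) :=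
    (mulOp W F).contDiff.comp (hN.comp contDiff_snd)
  have hΨ : ContDiff ℝ ∞ Ψ :=
    (contDiff_snd.sub contDiff_const).sub
      ((primitiveOp F).contDiff.comp (hM.clm_apply contDiff_fst))
  have hd : fderiv ℝ Ψ (0, x) = ContinuousLinearMap.snd ℝ _ _ -
      (primitiveOp F).comp ((mulOp W F (N x)).comp (ContinuousLinearMap.fst ℝ _ _)) := by
    refine HasFDerivAt.fderiv ?_
    have h1 := ((hM.differentiable (by simp)) (0, x)).hasFDerivAt.clm_apply
      (hasFDerivAt_fst (𝕜 := ℝ) (p := ((0 : L2Path W), x)))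
    have h2 := ((hasFDerivAt_snd (𝕜 := ℝ) (p := ((0 : L2Path W), x))).sub_const x).sub
      ((primitiveOp F).hasFDerivAt.comp _ h1)
    refine h2.congr_fderiv ?_
    ext z <;> simp
  have hr : fderiv ℝ Ψ (0, x) ∘L .inr ℝ (L2Path W) C(Icc (0 : ℝ) 1, F) = .id ℝ _ := by
    rw [hd]; ext z; simp
  have hl : fderiv ℝ Ψ (0, x) ∘L .inl ℝ (L2Path W) C(Icc (0 : ℝ) 1, F) =
      -(primitiveOp F).comp (mulOp W F (N x)) := by
    rw [hd]; ext z; simp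
  have hinv : (fderiv ℝ Ψ (0, x) ∘L .inr ℝ (L2Path W) C(Icc (0 : ℝ) 1, F)).IsInvertible := by
    rw [hr]; exact ⟨.refl ℝ _, rfl⟩
  have hΨ' : ContDiffAt ℝ ∞ Ψ (0, x) := hΨ.contDiffAt
  have hcongr : ∀ (γ : C(Icc (0 : ℝ) 1, F)) (u : L2Path W) (t : Icc (0 : ℝ) 1),
      primitiveOp F (mulOp W F (N γ) u) t =
        ∫ s in (0 : ℝ)..t, X (extendUnit γ s) (u s) := fun γ u t =>
    integral_congr_unit (coeFn_mulOp (N γ) u) ⟨le_rfl, zero_le_one⟩ t.2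
  refine ⟨hΨ'.implicitFunction (by simp) hinv, hΨ'.contDiffAt_implicitFunction (by simp) hinv,
    hΨ'.implicitFunction_apply_self (by simp) hinv, ?_, ?_⟩
  · filter_upwards [hΨ'.eventually_apply_implicitFunction (by simp) hinv] with u hu t
    set γ := hΨ'.implicitFunction (by simp) hinv u
    have h0 : Ψ (0, x) = 0 := by simp [Ψ]
    rw [h0] at hu
    have h1 : γ = x + primitiveOp F (mulOp W F (N γ) u) := by
      rw [← sub_eq_zero, ← hu]
      simp only [Ψ]
      abel
    calc γ t = (x + primitiveOp F (mulOp W F (N γ) u)) t := DFunLike.congr_fun h1 t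
      _ = _ := by rw [ContinuousMap.add_apply, hcongr]; rfl
  · intro u t
    rw [(hΨ'.hasStrictFDerivAt_implicitFunction (by simp) hinv).hasFDerivAt.fderiv, hr, hl,
      ContinuousLinearMap.inverse_id]
    simp only [ContinuousLinearMap.comp_neg, neg_neg]
    exact hcongr x u t

end ControlledODE

/-! ### An abstract Fredholm criterion -/

section Fredholm

variable {V W : Type*} [NormedAddCommGroup V] [NormedSpace ℝ V]
  [NormedAddCommGroup W] [NormedSpace ℝ W] [FiniteDimensional ℝ W]

/-- A Fredholm criterion for the restriction of the sum map `V × V → V` to a subspace which is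
parametrised, up to finite dimensions, by the sum. -/
theorem isFredholm_add_of_parametrization (T : Submodule ℝ (V × V))
    (D : V × W →L[ℝ] V × V) (Q : V →L[ℝ] V) (hQ : FiniteDimensional ℝ Q.range)
    (hT : ∀ z ∈ T, ∃ η, z = D (z.1 + z.2, η))
    (hD : ∀ y, D (y - Q y, 0) ∈ T) (hadd : ∀ y, (D (y, 0)).1 + (D (y, 0)).2 = y) :
    ((ContinuousLinearMap.fst ℝ V V + ContinuousLinearMap.snd ℝ V V).comp T.subtypeL).IsFredholm := by
  set u := (ContinuousLinearMap.fst ℝ V V + ContinuousLinearMap.snd ℝ V V).comp T.subtypeL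
  -- `v` is an inverse of `u` up to finite rank: `u v - 1 = -Q`, and the values of `v u - 1` come
  -- from the parameter in `W` and from the range of `Q`.
  let v : V →L[ℝ] T := (D.comp ((ContinuousLinearMap.inl ℝ V W).comp
    (ContinuousLinearMap.id ℝ V - Q))).codRestrict T hD
  have hu : ∀ z : T, u z = (z : V × V).1 + (z : V × V).2 := fun _ => rfl
  have hv : ∀ y, (v y : V × V) = D (y - Q y, 0) := fun _ => rfl
  let R : Submodule ℝ (V × V) := (D.comp (ContinuousLinearMap.inr ℝ V W)).range ⊔
    Q.range.map (D.comp (ContinuousLinearMap.inl ℝ V W)).toLinearMap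
  have : FiniteDimensional ℝ R := inferInstance
  refine ContinuousLinearMap.IsFredholm.of_isQuasiInverse (v := v) ⟨?_, ?_⟩
  · refine LinearMap.FiniteRangeSetoid.equiv_iff_hasNoetherianRange.mpr ?_
    set f : T →ₗ[ℝ] T := v.toLinearMap ∘ₗ u.toLinearMap - LinearMap.id
    have hf : f.range.map T.subtype ≤ R := by
      rintro _ ⟨_, ⟨z, rfl⟩, rfl⟩
      obtain ⟨η, hη⟩ := hT z z.2
      have h1 : (f z : V × V) = -D (0, η) - D (Q (u z), 0) := by
        have h2 : (f z : V × V) = D (u z - Q (u z), 0) - z := rfl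
        rw [h2]
        conv_lhs => rw [hη, ← hu]
        rw [← map_sub, ← map_neg, ← map_sub]
        congr 1
        ext <;> simp
      rw [Submodule.subtype_apply, h1]
      exact sub_mem (neg_mem (Submodule.mem_sup_left ⟨η, rfl⟩))
        (Submodule.mem_sup_right ⟨Q (u z), ⟨_, rfl⟩, rfl⟩)
    have : FiniteDimensional ℝ (f.range.map T.subtype) := Submodule.finiteDimensional_of_le hf
    exact isNoetherian_of_linearEquiv
      (Submodule.equivMapOfInjective T.subtype T.injective_subtype f.range).symm
  · refine LinearMap.FiniteRangeSetoid.equiv_iff_hasNoetherianRange.mpr ?_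
    set f : V →ₗ[ℝ] V := u.toLinearMap ∘ₗ v.toLinearMap - LinearMap.id
    have hf : f.range ≤ Q.range := by
      rintro _ ⟨y, rfl⟩
      have h1 : f y = -Q y := by
        have h2 : f y = u (v y) - y := rfl
        rw [h2, hu, hv, hadd]
        abel
      rw [h1]
      exact neg_mem ⟨y, rfl⟩
    have : FiniteDimensional ℝ f.range := Submodule.finiteDimensional_of_le hf
    exact inferInstanceAs (IsNoetherian ℝ f.range)

end Fredholm

/-! ### Differentials read in the preferred chart -/

section Charts

variable {E : Type*} [NormedAddCommGroup E] [NormedSpace ℝ E]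
  {X : Type*} [TopologicalSpace X] [ChartedSpace E X]
  {E' : Type*} [NormedAddCommGroup E'] [NormedSpace ℝ E']

theorem mfderiv_eq_fderiv_chart {f : X → E'} {x : X}
    (hf : MDifferentiableAt 𝓘(ℝ, E) 𝓘(ℝ, E') f x) :
    (mfderiv 𝓘(ℝ, E) 𝓘(ℝ, E') f x : E →L[ℝ] E') =
      fderiv ℝ (f ∘ (extChartAt 𝓘(ℝ, E) x).symm) (extChartAt 𝓘(ℝ, E) x x) := by
  rw [hf.mfderiv, writtenInExtChartAt, ← fderivWithin_univ]
  simp only [mfld_simps, chartAt_self_eq]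
  rfl

theorem contDiffAt_comp_chart_symm {f : X → E'} {x : X}
    (hf : ContMDiffAt 𝓘(ℝ, E) 𝓘(ℝ, E') ∞ f x) :
    ContDiffAt ℝ ∞ (f ∘ (extChartAt 𝓘(ℝ, E) x).symm) (extChartAt 𝓘(ℝ, E) x x) := by
  have := (contMDiffAt_iff.mp hf).2
  simpa [contDiffWithinAt_univ, chartAt_self_eq] using this

variable [IsManifold 𝓘(ℝ, E) ∞ X]

theorem contMDiffAt_chart_symm_comp {x : X} {c : E' → E} {z : E'}
    (hc : ContDiffAt ℝ ∞ c z) (hx : c z = extChartAt 𝓘(ℝ, E) x x) :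
    ContMDiffAt 𝓘(ℝ, E') 𝓘(ℝ, E) ∞ (fun t => (extChartAt 𝓘(ℝ, E) x).symm (c t)) z := by
  have h1 : ContMDiffAt 𝓘(ℝ, E) 𝓘(ℝ, E) ∞ (extChartAt 𝓘(ℝ, E) x).symm (c z) :=
    (contMDiffOn_extChartAt_symm x).contMDiffAt
      (by rw [hx]; exact extChartAt_target_mem_nhds x)
  exact h1.comp z hc.contMDiffAt

theorem mfderiv_chart_symm_comp {x : X} {c : E' → E} {z : E'}
    (hc : ContDiffAt ℝ ∞ c z) (hx : c z = extChartAt 𝓘(ℝ, E) x x) :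
    (mfderiv 𝓘(ℝ, E') 𝓘(ℝ, E) (fun t => (extChartAt 𝓘(ℝ, E) x).symm (c t)) z : E' →L[ℝ] E) =
      fderiv ℝ c z := by
  have hd := (contMDiffAt_chart_symm_comp hc hx).mdifferentiableAt (by simp)
  have h0 : (extChartAt 𝓘(ℝ, E) x).symm (c z) = x := by rw [hx]; simp
  rw [hd.mfderiv, writtenInExtChartAt, h0, ← fderivWithin_univ (𝕜 := ℝ)]
  simp only [mfld_simps, chartAt_self_eq]
  rw [fderivWithin_univ, fderivWithin_univ]
  apply Filter.EventuallyEq.fderiv_eq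
  have hm : ∀ᶠ t in 𝓝 z, c t ∈ (extChartAt 𝓘(ℝ, E) x).target :=
    hc.continuousAt.eventually_mem
      (by rw [hx]; exact extChartAt_target_mem_nhds (I := 𝓘(ℝ, E)) x)
  filter_upwards [hm] with t ht
  simpa using (extChartAt 𝓘(ℝ, E) x).right_inv ht

end Charts

/-! ### Tangent spaces of zero sets -/

section Tangent

variable {E : Type*} [NormedAddCommGroup E] [NormedSpace ℝ E]
  {X : Type*} [TopologicalSpace X] [ChartedSpace E X]

theorem velocity_mem_tangentTo {N : Set X} {p : X} {c : ℝ → X}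
    (hc : ContMDiffAt 𝓘(ℝ, ℝ) 𝓘(ℝ, E) ∞ c 0) (h0 : c 0 = p) (hN : ∀ᶠ t in 𝓝 (0 : ℝ), c t ∈ N) :
    (mfderiv 𝓘(ℝ, ℝ) 𝓘(ℝ, E) c 0 (1 : ℝ) : E) ∈ tangentTo (E := E) N p :=
  Submodule.subset_span ⟨c, hc, h0, hN, rfl⟩

variable [IsManifold 𝓘(ℝ, E) ∞ X]

/-- The tangent space of the zero set of a submersion is the kernel of its differential. -/
theorem mem_tangentTo_iff_mfderiv_eq_zero {B : Type*} [NormedAddCommGroup B] [NormedSpace ℝ B]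
    [FiniteDimensional ℝ B] {N W : Set X} (hW : IsOpen W) {f : X → B}
    (hf : ContMDiffOn 𝓘(ℝ, E) 𝓘(ℝ, B) ∞ f W)
    (hN : ∀ y ∈ W, y ∈ N ↔ f y = 0) {x : X} (hxW : x ∈ W) (hxN : x ∈ N)
    (hsurj : Function.Surjective (mfderiv 𝓘(ℝ, E) 𝓘(ℝ, B) f x))
    (v : TangentSpace 𝓘(ℝ, E) x) :
    v ∈ tangentTo N x ↔ (mfderiv 𝓘(ℝ, E) 𝓘(ℝ, B) f x v : B) = 0 := by
  have hfx : ContMDiffAt 𝓘(ℝ, E) 𝓘(ℝ, B) ∞ f x := hf.contMDiffAt (hW.mem_nhds hxW)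
  have hdx := hfx.mdifferentiableAt (by simp)
  constructor
  · intro hv
    let L : E →L[ℝ] B := mfderiv 𝓘(ℝ, E) 𝓘(ℝ, B) f x
    suffices h : tangentTo (E := E) N x ≤ L.ker from h hv
    refine Submodule.span_le.mpr ?_
    rintro _ ⟨c, hc, hc0, hcN, rfl⟩
    have hcd := hc.mdifferentiableAt (by simp)
    have h1 : mfderiv 𝓘(ℝ, ℝ) 𝓘(ℝ, B) (f ∘ c) 0 = 0 := by
      have h2 : f ∘ c =ᶠ[𝓝 0] fun _ => (0 : B) := by
        have hcW : ∀ᶠ t in 𝓝 (0 : ℝ), c t ∈ W :=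
          hc.continuousAt.eventually_mem (by rw [hc0]; exact hW.mem_nhds hxW)
        filter_upwards [hcN, hcW] with t h1 h2
        exact (hN _ h2).mp h1
      rw [h2.mfderiv_eq]
      exact mfderiv_const
    subst hc0
    rw [mfderiv_comp (0 : ℝ) hdx hcd] at h1
    exact DFunLike.congr_fun h1 (1 : ℝ)
  · intro hv
    set φ := extChartAt 𝓘(ℝ, E) x
    let g : E → B := f ∘ φ.symm
    have hg : ContDiffAt ℝ ∞ g (φ x) := contDiffAt_comp_chart_symm hfx
    let L : E →L[ℝ] B := mfderiv 𝓘(ℝ, E) 𝓘(ℝ, B) f x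
    have hL : fderiv ℝ g (φ x) = L := (mfderiv_eq_fderiv_chart hdx).symm
    let v' : E := v
    have hLv : L v' = 0 := hv
    obtain ⟨R₀, hR₀⟩ := L.toLinearMap.exists_rightInverse_of_surjective
      (LinearMap.range_eq_top.mpr hsurj)
    let R : B →L[ℝ] E := R₀.toContinuousLinearMap
    have hR : ∀ s, L (R s) = s := fun s => LinearMap.congr_fun hR₀ s
    -- The line in direction `v` is corrected along the range of a right inverse `R` of `L` so as to
    -- stay in the zero set. As `L v = 0`, the correction `s` given by the implicit function theorem
    -- has zero derivative, so the velocity remains `v`.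
    let ℓ : ℝ × B → E := fun z => φ x + z.1 • v' + R z.2
    have hℓ : ContDiff ℝ ∞ ℓ := by fun_prop
    have hℓ0 : ℓ (0, 0) = φ x := by simp [ℓ]
    let ℓ' : ℝ × B →L[ℝ] E := (ContinuousLinearMap.fst ℝ ℝ B).smulRight v' +
      R.comp (ContinuousLinearMap.snd ℝ ℝ B)
    have hℓd : HasFDerivAt ℓ ℓ' (0, 0) := by
      have h1 : HasFDerivAt ℓ' ℓ' ((0 : ℝ), (0 : B)) := ℓ'.hasFDerivAt
      refine (h1.const_add (φ x)).congr_of_eventuallyEq (Eventually.of_forall fun z => ?_)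
      simp [ℓ, ℓ', add_assoc]
    have hH : ContDiffAt ℝ ∞ (g ∘ ℓ) ((0 : ℝ), (0 : B)) :=
      ContDiffAt.comp _ (by rw [hℓ0]; exact hg) hℓ.contDiffAt
    have hHd : fderiv ℝ (g ∘ ℓ) ((0 : ℝ), (0 : B)) = L.comp ℓ' := by
      have h1 : HasFDerivAt g L (ℓ (0, 0)) := by
        rw [hℓ0, ← hL]; exact (hg.differentiableAt (by simp)).hasFDerivAt
      exact (h1.comp _ hℓd).fderiv
    have hr : fderiv ℝ (g ∘ ℓ) ((0 : ℝ), (0 : B)) ∘L .inr ℝ ℝ B = .id ℝ B := by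
      rw [hHd]; ext s; simp [ℓ', hR]
    have hl : fderiv ℝ (g ∘ ℓ) ((0 : ℝ), (0 : B)) ∘L .inl ℝ ℝ B = 0 := by
      rw [hHd]; ext; simp [ℓ', hLv]
    have hinv : (fderiv ℝ (g ∘ ℓ) ((0 : ℝ), (0 : B)) ∘L .inr ℝ ℝ B).IsInvertible := by
      rw [hr]; exact ⟨ContinuousLinearEquiv.refl ℝ B, rfl⟩
    have : CompleteSpace B := FiniteDimensional.complete ℝ B
    set s := hH.implicitFunction (by simp) hinv
    have hs : ContDiffAt ℝ ∞ s 0 := hH.contDiffAt_implicitFunction (by simp) hinv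
    have hs0 : s 0 = 0 := hH.implicitFunction_apply_self (by simp) hinv
    have hsd : HasFDerivAt s (0 : ℝ →L[ℝ] B) 0 := by
      have := (hH.hasStrictFDerivAt_implicitFunction (by simp) hinv).hasFDerivAt
      rw [hl, ContinuousLinearMap.comp_zero] at this
      exact this.congr_fderiv (by ext; simp)
    let c : ℝ → E := fun t => ℓ (t, s t)
    have hc : ContDiffAt ℝ ∞ c 0 := hℓ.contDiffAt.comp _ (contDiffAt_id.prodMk hs)
    have hc0 : c 0 = φ x := by simp only [c, hs0, hℓ0]
    have hcd : fderiv ℝ c 0 1 = v' := by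
      have h1 : HasFDerivAt ℓ ℓ' ((0 : ℝ), s 0) := by rw [hs0]; exact hℓd
      have h2 : HasFDerivAt c
          (ℓ'.comp ((ContinuousLinearMap.id ℝ ℝ).prod (0 : ℝ →L[ℝ] B))) 0 :=
        HasFDerivAt.comp (g := ℓ) (f := fun t => (t, s t)) (0 : ℝ) h1
          ((hasFDerivAt_id (0 : ℝ)).prodMk hsd)
      rw [h2.fderiv]
      simp [ℓ']
    refine Submodule.subset_span ⟨fun t => φ.symm (c t), contMDiffAt_chart_symm_comp hc hc0,
      by simp only [hc0]; exact extChartAt_to_inv x, ?_, ?_⟩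
    · have hH0 := hH.eventually_apply_implicitFunction (by simp) hinv
      have hW' : ∀ᶠ t in 𝓝 (0 : ℝ), φ.symm (c t) ∈ W := by
        refine (contMDiffAt_chart_symm_comp hc hc0).continuousAt.eventually_mem ?_
        simp only [hc0, φ, extChartAt_to_inv]
        exact hW.mem_nhds hxW
      filter_upwards [hH0, hW'] with t h1 h2
      refine (hN _ h2).mpr ?_
      have h3 : (g ∘ ℓ) ((0 : ℝ), (0 : B)) = 0 := by
        simp only [Function.comp_apply, hℓ0, g, φ, extChartAt_to_inv]
        exact (hN x hxW).mp hxN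
      rw [h3] at h1
      exact h1
    · exact (DFunLike.congr_fun (mfderiv_chart_symm_comp hc hc0) (1 : ℝ)).trans hcd

end Tangent

/-! ### Differentials as linear maps of the model spaces -/

section Differential

variable {E : Type*} [NormedAddCommGroup E] [NormedSpace ℝ E]
  {X : Type*} [TopologicalSpace X] [ChartedSpace E X]
  {E' : Type*} [NormedAddCommGroup E'] [NormedSpace ℝ E']
  {Y : Type*} [TopologicalSpace Y] [ChartedSpace E' Y]
  {E'' : Type*} [NormedAddCommGroup E''] [NormedSpace ℝ E'']
  {Z : Type*} [TopologicalSpace Z] [ChartedSpace E'' Z]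

/-- The differential of `ψ` at `x` as a map between the model spaces. -/
noncomputable def tder (E E' : Type*) [NormedAddCommGroup E] [NormedSpace ℝ E]
    {X : Type*} [TopologicalSpace X] [ChartedSpace E X]
    [NormedAddCommGroup E'] [NormedSpace ℝ E']
    {Y : Type*} [TopologicalSpace Y] [ChartedSpace E' Y] (ψ : X → Y) (x : X) : E →L[ℝ] E' :=
  mfderiv 𝓘(ℝ, E) 𝓘(ℝ, E') ψ x

theorem tder_comp {g : Y → Z} {f : X → Y} {x : X} {y : Y} (hy : f x = y)
    (hg : MDifferentiableAt 𝓘(ℝ, E') 𝓘(ℝ, E'') g y)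
    (hf : MDifferentiableAt 𝓘(ℝ, E) 𝓘(ℝ, E') f x) :
    tder E E'' (fun z => g (f z)) x = (tder E' E'' g y).comp (tder E E' f x) := by
  subst hy
  exact mfderiv_comp x hg hf

theorem tder_id (x : X) : tder E E (fun y : X => y) x = ContinuousLinearMap.id ℝ E :=
  mfderiv_id

theorem tder_const (x : X) (y : Y) : tder E E' (fun _ : X => y) x = 0 :=
  mfderiv_const

theorem tder_congr {f g : X → Y} {x : X} (h : f =ᶠ[𝓝 x] g) : tder E E' f x = tder E E' g x :=
  h.mfderiv_eq

theorem tder_eq_fderiv {f : E → E'} (x : E) : tder E E' f x = fderiv ℝ f x :=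
  mfderiv_eq_fderiv

end Differential

/-! ### Differentials of isometries -/

section Isometries

variable {E : Type*} [NormedAddCommGroup E] [NormedSpace ℝ E]
  {X : Type*} [TopologicalSpace X] [ChartedSpace E X]
  {m : MetricFamily E X} {ν : X → X}

theorem ParallelTransport.IsRiemannianIsometry.mdifferentiable (h : IsRiemannianIsometry m ν) :
    MDifferentiable 𝓘(ℝ, E) 𝓘(ℝ, E) ν := by
  obtain ⟨⟨φ, rfl⟩, -⟩ := h
  exact φ.mdifferentiable (by simp)

theorem ParallelTransport.IsRiemannianIsometry.bijective_tder (h : IsRiemannianIsometry m ν) (x : X) :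
    Function.Bijective (tder E E ν x) := by
  obtain ⟨⟨φ, rfl⟩, -⟩ := h
  have h1 : (tder E E φ.symm (φ x)).comp (tder E E φ x) = .id ℝ E := by
    rw [← tder_comp (g := φ.symm) (f := φ) rfl (φ.symm.mdifferentiable (by simp) _)
      (φ.mdifferentiable (by simp) _)]
    simpa using tder_id x
  have h2 : (tder E E φ x).comp (tder E E φ.symm (φ x)) = .id ℝ E := by
    rw [← tder_comp (g := φ) (f := φ.symm) (by simp) (φ.mdifferentiable (by simp) _)
      (φ.symm.mdifferentiable (by simp) _)]
    simpa using tder_id (φ x)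
  exact Function.bijective_iff_has_inverse.mpr ⟨tder E E φ.symm (φ x),
    fun v => DFunLike.congr_fun h1 v, fun v => DFunLike.congr_fun h2 v⟩

end Isometries

/-! ### Riemannian submersions and the transfer of weak reflectivity -/

section Submersions

variable {E : Type*} [NormedAddCommGroup E] [NormedSpace ℝ E]
  {X : Type*} [TopologicalSpace X] [ChartedSpace E X]
  {E' : Type*} [NormedAddCommGroup E'] [NormedSpace ℝ E']
  {Y : Type*} [TopologicalSpace Y] [ChartedSpace E' Y]
  {E'' : Type*} [NormedAddCommGroup E''] [NormedSpace ℝ E'']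
  {Z : Type*} [TopologicalSpace Z] [ChartedSpace E'' Z]

/-- The family `m` consists of definite bilinear forms. -/
def IsDefiniteFamily (m : MetricFamily E X) : Prop :=
  ∀ x, ∃ B : E →ₗ[ℝ] E →ₗ[ℝ] ℝ, (∀ v w : E, m x v w = B v w) ∧ ∀ v, B v v = 0 → v = 0

/-- The vector `v` at `x` is orthogonal to the fibre of `ψ`. -/
def IsHorizontal (m : MetricFamily E X) (E' : Type*) [NormedAddCommGroup E'] [NormedSpace ℝ E']
    {Y : Type*} [TopologicalSpace Y] [ChartedSpace E' Y] (ψ : X → Y) (x : X) (v : E) : Prop :=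
  ∀ z : E, tder E E' ψ x z = 0 → m x v z = 0

/-- The differential of `ψ` at `x` maps the orthogonal complement of its kernel isometrically
onto the tangent space of the target. -/
structure IsRiemannianSubmersionAt (m : MetricFamily E X) (m' : MetricFamily E' Y) (ψ : X → Y)
    (x : X) : Prop where
  exists_lift : ∀ η : E', ∃ v : E, tder E E' ψ x v = η ∧ IsHorizontal m E' ψ x v
  metric_eq : ∀ v w : E, IsHorizontal m E' ψ x v → IsHorizontal m E' ψ x w →
    m' (ψ x) (tder E E' ψ x v) (tder E E' ψ x w) = m x v w

theorem IsRiemannianSubmersionAt.surjective {m : MetricFamily E X} {m' : MetricFamily E' Y}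
    {ψ : X → Y} {x : X} (h : IsRiemannianSubmersionAt m m' ψ x) :
    Function.Surjective (tder E E' ψ x) := fun η =>
  (h.exists_lift η).imp fun _ hv => hv.1

/-- The composition of Riemannian submersions is a Riemannian submersion. -/
theorem IsRiemannianSubmersionAt.comp {m : MetricFamily E X} {m' : MetricFamily E' Y}
    {m'' : MetricFamily E'' Z} (hm : IsDefiniteFamily m) {ψ : X → Y} {χ : Y → Z} {x : X}
    (hχ : IsRiemannianSubmersionAt m' m'' χ (ψ x)) (hψ : IsRiemannianSubmersionAt m m' ψ x)
    (hχd : MDifferentiableAt 𝓘(ℝ, E') 𝓘(ℝ, E'') χ (ψ x))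
    (hψd : MDifferentiableAt 𝓘(ℝ, E) 𝓘(ℝ, E') ψ x) :
    IsRiemannianSubmersionAt m m'' (fun z => χ (ψ z)) x := by
  obtain ⟨B, hB, -⟩ := hm x
  have hd : ∀ v, tder E E'' (fun z => χ (ψ z)) x v = tder E' E'' χ (ψ x) (tder E E' ψ x v) :=
    fun v => DFunLike.congr_fun (tder_comp rfl hχd hψd) v
  have h1 : ∀ v, IsHorizontal m E'' (fun z => χ (ψ z)) x v → IsHorizontal m E' ψ x v :=
    fun v hv z hz => hv z (by rw [hd, hz, map_zero])
  have h2 : ∀ v, IsHorizontal m E'' (fun z => χ (ψ z)) x v →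
      IsHorizontal m' E'' χ (ψ x) (tder E E' ψ x v) := by
    intro v hv z hz
    obtain ⟨w, hw, hwh⟩ := hψ.exists_lift z
    rw [← hw, hψ.metric_eq v w (h1 v hv) hwh]
    exact hv w (by rw [hd, hw, hz])
  constructor
  · intro η
    obtain ⟨w, hw, hwh⟩ := hχ.exists_lift η
    obtain ⟨v, hv, hvh⟩ := hψ.exists_lift w
    refine ⟨v, by rw [hd, hv, hw], fun z hz => ?_⟩
    -- `z` is compared with the horizontal vector `z'` having the same image: the metric identity
    -- handles `z'`, and `z - z'` is vertical.
    obtain ⟨z', hz', hz'h⟩ := hψ.exists_lift (tder E E' ψ x z)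
    have h3 : m x v z' = 0 := by
      rw [← hψ.metric_eq v z' hvh hz'h, hv, hz']
      exact hwh _ (by rw [← hd, hz])
    have h4 : m x v (z - z') = 0 := hvh _ (by rw [map_sub, hz', sub_self])
    rw [hB] at h3 h4 ⊢
    rw [map_sub, h3, sub_zero] at h4
    exact h4
  · intro v w hv hw
    rw [hd, hd, ← hψ.metric_eq v w (h1 v hv) (h1 w hw)]
    exact hχ.metric_eq _ _ (h2 v hv) (h2 w hw)

variable [IsManifold 𝓘(ℝ, E) ∞ X] [IsManifold 𝓘(ℝ, E') ∞ Y]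

/-- If `f` is a local defining submersion of `N`, then `f ∘ ψ` is one of the preimage. Both tangent
spaces are kernels, so the chain rule compares them. -/
theorem mem_tangentTo_preimage_iff {O : Set X} (hO : IsOpen O) {ψ : X → Y}
    (hψ : ContMDiffOn 𝓘(ℝ, E) 𝓘(ℝ, E') ∞ ψ O) {k : ℕ} {N : Set Y}
    (hN : IsEmbeddedSubmanifold E' k N) {x : X} (hx : x ∈ O) (hxN : ψ x ∈ N)
    (hs : Function.Surjective (tder E E' ψ x)) (v : E) :
    v ∈ tangentTo (E := E) (O ∩ ψ ⁻¹' N) x ↔ tder E E' ψ x v ∈ tangentTo (E := E') N (ψ x) := by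
  obtain ⟨W, hW, hxW, f, hf, hfN, hsurj⟩ := hN _ hxN
  have hfx : MDifferentiableAt 𝓘(ℝ, E') 𝓘(ℝ, EuclideanSpace ℝ (Fin k)) f (ψ x) :=
    (hf.contMDiffAt (hW.mem_nhds hxW)).mdifferentiableAt (by simp)
  have hψx := (hψ.contMDiffAt (hO.mem_nhds hx)).mdifferentiableAt (by simp)
  have hd : ∀ v, tder E (EuclideanSpace ℝ (Fin k)) (fun z => f (ψ z)) x v =
      tder E' (EuclideanSpace ℝ (Fin k)) f (ψ x) (tder E E' ψ x v) :=
    fun v => DFunLike.congr_fun (tder_comp rfl hfx hψx) v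
  have h1 := mem_tangentTo_iff_mfderiv_eq_zero hW hf hfN hxW hxN hsurj (tder E E' ψ x v)
  have h2 := mem_tangentTo_iff_mfderiv_eq_zero (N := O ∩ ψ ⁻¹' N) (W := O ∩ ψ ⁻¹' W)
    (f := fun z => f (ψ z)) (hψ.continuousOn.isOpen_inter_preimage hO hW)
    (hf.comp (hψ.mono inter_subset_left) fun z hz => hz.2)
    (fun y hy => by
      rw [← hfN _ hy.2]
      exact ⟨fun h => h.2, fun h => ⟨hy.1, h⟩⟩) (x := x) ⟨hx, hxW⟩ ⟨hx, hxN⟩ (by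
    intro w
    obtain ⟨w', hw'⟩ := hsurj w
    obtain ⟨v, rfl⟩ := hs w'
    exact ⟨v, (hd v).trans hw'⟩) v
  exact h2.trans (Iff.trans (Eq.congr_left (hd v)) h1.symm)

omit [IsManifold 𝓘(ℝ, E) ∞ X] [IsManifold 𝓘(ℝ, E') ∞ Y] in
theorem ParallelTransport.IsEmbeddedSubmanifold.preimage {O : Set X} (hO : IsOpen O) {ψ : X → Y}
    (hψ : ContMDiffOn 𝓘(ℝ, E) 𝓘(ℝ, E') ∞ ψ O) {k : ℕ} {N : Set Y}
    (hN : IsEmbeddedSubmanifold E' k N)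
    (hs : ∀ x ∈ O, Function.Surjective (tder E E' ψ x)) :
    IsEmbeddedSubmanifold E k (O ∩ ψ ⁻¹' N) := by
  rintro x ⟨hx, hxN⟩
  obtain ⟨W, hW, hxW, f, hf, hfN, hsurj⟩ := hN _ hxN
  have hfx : MDifferentiableAt 𝓘(ℝ, E') 𝓘(ℝ, EuclideanSpace ℝ (Fin k)) f (ψ x) :=
    (hf.contMDiffAt (hW.mem_nhds hxW)).mdifferentiableAt (by simp)
  have hψx := (hψ.contMDiffAt (hO.mem_nhds hx)).mdifferentiableAt (by simp)
  refine ⟨O ∩ ψ ⁻¹' W, hψ.continuousOn.isOpen_inter_preimage hO hW, ⟨hx, hxW⟩,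
    fun z => f (ψ z), hf.comp (hψ.mono inter_subset_left) fun z hz => hz.2, fun y hy => ?_, ?_⟩
  · rw [← hfN _ hy.2]
    exact ⟨fun h => h.2, fun h => ⟨hy.1, h⟩⟩
  · intro w
    obtain ⟨w', hw'⟩ := hsurj w
    obtain ⟨v, rfl⟩ := hs x hx w'
    exact ⟨v, (DFunLike.congr_fun (tder_comp rfl hfx hψx) v).trans hw'⟩

/-- Weak reflectivity can be transferred along Riemannian submersions along which the symmetries
correspond. -/
theorem isWeaklyReflectiveSubmanifold_preimage_iff {m : MetricFamily E X} {m' : MetricFamily E' Y}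
    (hm : IsDefiniteFamily m) {O : Set X} (hO : IsOpen O) {ψ : X → Y}
    (hψ : ContMDiffOn 𝓘(ℝ, E) 𝓘(ℝ, E') ∞ ψ O)
    (hR : ∀ x ∈ O, IsRiemannianSubmersionAt m m' ψ x) {N : Set Y}
    (hN : ∃ k, IsEmbeddedSubmanifold E' k N) {Γ : Set (X → X)} {Γ' : Set (Y → Y)}
    (hlift : ∀ x ∈ O, ∀ s ∈ Γ', IsRiemannianIsometry m' s → s (ψ x) = ψ x → s '' N = N →
      ∃ ν ∈ Γ, IsRiemannianIsometry m ν ∧ ν x = x ∧ (∀ y, ψ (ν y) = s (ψ y)) ∧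
        ν '' (O ∩ ψ ⁻¹' N) = O ∩ ψ ⁻¹' N)
    (hdesc : ∀ x ∈ O, ∀ ν ∈ Γ, ν x = x →
      ∃ s ∈ Γ', IsRiemannianIsometry m' s ∧ ∀ y, ψ (ν y) = s (ψ y))
    (hsurj : ∀ q ∈ N, ∃ x ∈ O, ψ x = q) :
    IsWeaklyReflectiveSubmanifold m Γ (O ∩ ψ ⁻¹' N) ↔ IsWeaklyReflectiveSubmanifold m' Γ' N := by
  obtain ⟨k, hk⟩ := hN
  have hψd : ∀ x ∈ O, MDifferentiableAt 𝓘(ℝ, E) 𝓘(ℝ, E') ψ x := fun x hx =>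
    (hψ.contMDiffAt (hO.mem_nhds hx)).mdifferentiableAt (by simp)
  have hT : ∀ x ∈ O, ψ x ∈ N → ∀ v : E, v ∈ tangentTo (E := E) (O ∩ ψ ⁻¹' N) x ↔
      tder E E' ψ x v ∈ tangentTo (E := E') N (ψ x) := fun x hx hxN =>
    mem_tangentTo_preimage_iff hO hψ hk hx hxN (hR x hx).surjective
  have hcomm : ∀ x ∈ O, ∀ (ν : X → X) (s : Y → Y), IsRiemannianIsometry m ν →
      IsRiemannianIsometry m' s → ν x = x → (∀ y, ψ (ν y) = s (ψ y)) →
      ∀ v, tder E E' ψ x (tder E E ν x v) = tder E' E' s (ψ x) (tder E E' ψ x v) := by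
    intro x hx ν s hν hs hνx hνs v
    have h1 := tder_comp (g := ψ) (f := ν) hνx (hψd x hx) (hν.mdifferentiable x)
    have h2 := tder_comp (g := s) (f := ψ) rfl (hs.mdifferentiable (ψ x)) (hψd x hx)
    have h3 : (fun z => ψ (ν z)) = fun z => s (ψ z) := funext hνs
    rw [h3, h2] at h1
    exact (DFunLike.congr_fun h1 v).symm
  constructor
  · rintro ⟨-, H⟩
    refine ⟨⟨k, hk⟩, fun q hq ξ hξ => ?_⟩
    obtain ⟨x, hx, rfl⟩ := hsurj q hq
    obtain ⟨B, hB, -⟩ := hm x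
    obtain ⟨v, hv, hvh⟩ := (hR x hx).exists_lift ξ
    have hvn : IsNormalVector m (O ∩ ψ ⁻¹' N) x v := by
      intro (w : E) hw
      have hw' := (hT x hx hq w).mp hw
      obtain ⟨w', hw1, hw2⟩ := (hR x hx).exists_lift (tder E E' ψ x w)
      have h3 : m x v w' = 0 := by
        rw [← (hR x hx).metric_eq v w' hvh hw2, hv, hw1]
        exact hξ _ hw'
      have h4 : m x v (w - w' : E) = 0 := hvh _ (by rw [map_sub, hw1]; exact sub_self _)
      rw [hB] at h3 h4
      rw [map_sub, h3, sub_zero] at h4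
      exact (hB v w).trans h4
    obtain ⟨ν, hν, hrefl⟩ := H x ⟨hx, hq⟩ v hvn
    obtain ⟨s, hs, hsi, hνs⟩ := hdesc x hx ν hν hrefl.fixes
    have hsx : s (ψ x) = ψ x := by rw [← hνs, hrefl.fixes]
    refine ⟨s, hs, hsi, hsx, ?_, ?_⟩
    · have h1 := hcomm x hx ν s hrefl.isometry hsi hrefl.fixes hνs v
      have h2 : tder E E ν x v = -v := hrefl.reverses
      rw [h2, map_neg, hv] at h1
      exact h1.symm
    · have himg : ψ '' (O ∩ ψ ⁻¹' N) = N := by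
        refine Subset.antisymm (by rintro _ ⟨y, hy, rfl⟩; exact hy.2) fun q hq => ?_
        obtain ⟨y, hy, rfl⟩ := hsurj q hq
        exact ⟨y, ⟨hy, hq⟩, rfl⟩
      calc s '' N = s '' (ψ '' (O ∩ ψ ⁻¹' N)) := by rw [himg]
        _ = ψ '' (ν '' (O ∩ ψ ⁻¹' N)) := by
          rw [image_image, image_image]
          exact image_congr fun y _ => (hνs y).symm
        _ = N := by rw [hrefl.preserves, himg]
  · rintro ⟨-, H⟩
    refine ⟨⟨k, hk.preimage hO hψ fun x hx => (hR x hx).surjective⟩, ?_⟩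
    rintro x ⟨hx, hxN⟩ ξ hξ
    obtain ⟨B, hB, hdef⟩ := hm x
    let v : E := ξ
    have hvh : IsHorizontal m E' ψ x v := by
      intro z hz
      refine hξ z ((hT x hx hxN z).mpr ?_)
      rw [hz]
      exact zero_mem _
    have hn : IsNormalVector m' N (ψ x) (tder E E' ψ x v) := by
      intro w hw
      obtain ⟨w', hw1, hw2⟩ := (hR x hx).exists_lift w
      rw [← hw1, (hR x hx).metric_eq v w' hvh hw2]
      refine hξ w' ((hT x hx hxN w').mpr ?_)
      rw [hw1]
      exact hw
    obtain ⟨s, hs, hrefl⟩ := H (ψ x) hxN _ hn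
    obtain ⟨ν, hν, hνi, hνx, hνs, hνN⟩ :=
      hlift x hx s hs hrefl.isometry hrefl.fixes hrefl.preserves
    refine ⟨ν, hν, hνi, hνx, ?_, hνN⟩
    have hc := hcomm x hx ν s hνi hrefl.isometry hνx hνs
    have h1 : IsHorizontal m E' ψ x (tder E E ν x v) := by
      intro z hz
      obtain ⟨z', rfl⟩ := (hνi.bijective_tder x).2 z
      have h2 : m (ν x) (tder E E ν x v) (tder E E ν x z') = m x v z' := hνi.2 x v z'
      rw [hνx] at h2
      rw [h2]
      refine hvh z' ((hrefl.isometry.bijective_tder (ψ x)).1 ?_)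
      rw [← hc, hz, map_zero]
    -- The vector `dν(v) + v` is vertical because `s` reverses the image of `v`, and it is
    -- orthogonal to vertical vectors because both summands are. Definiteness makes it zero.
    have h3 : tder E E' ψ x (tder E E ν x v + v) = 0 := by
      have h4 : tder E' E' s (ψ x) (tder E E' ψ x v) = -(tder E E' ψ x v) := hrefl.reverses
      rw [map_add, hc, h4, neg_add_cancel]
    have h5 : B (tder E E ν x v + v) (tder E E ν x v + v) = 0 := by
      rw [map_add B, LinearMap.add_apply, ← hB, ← hB, h1 _ h3, hvh _ h3, add_zero]
    exact eq_neg_of_add_eq_zero_left (hdef _ h5)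

end Submersions

/-! ### Smooth dependence of a differential on parameters -/

section ParametricDerivative

variable {E : Type*} [NormedAddCommGroup E] [NormedSpace ℝ E]
  {X : Type*} [TopologicalSpace X] [ChartedSpace E X] [IsManifold 𝓘(ℝ, E) ∞ X]
  {P : Type*} [NormedAddCommGroup P] [NormedSpace ℝ P]
  {N : Type*} [TopologicalSpace N] [ChartedSpace P N] [IsManifold 𝓘(ℝ, P) ∞ N]
  {E' : Type*} [NormedAddCommGroup E'] [NormedSpace ℝ E']

/-- The tangent space at `x` is identified with `E` by this very chart. Composing with it therefore
turns a manifold-valued map into a vector-valued one without changing the differential at points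
sent to `x`. -/
theorem tder_extChartAt (x : X) : tder E E (extChartAt 𝓘(ℝ, E) x) x = .id ℝ E := by
  have h : MDifferentiableAt 𝓘(ℝ, E) 𝓘(ℝ, E) (extChartAt 𝓘(ℝ, E) x) x :=
    mdifferentiableAt_extChartAt (mem_chart_source E x)
  rw [tder, mfderiv_eq_fderiv_chart h]
  have : (extChartAt 𝓘(ℝ, E) x ∘ (extChartAt 𝓘(ℝ, E) x).symm) =ᶠ[𝓝 (extChartAt 𝓘(ℝ, E) x x)] id := by
    filter_upwards [extChartAt_target_mem_nhds (I := 𝓘(ℝ, E)) x] with z hz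
    exact (extChartAt 𝓘(ℝ, E) x).right_inv hz
  rw [this.fderiv_eq, fderiv_id]

/-- The partial differential of a smooth map depends smoothly on the parameter. -/
theorem contMDiffAt_tder_param {h : N → X → E'} {x₀ : N} {y₀ : X}
    (hh : ContMDiffAt (𝓘(ℝ, P).prod 𝓘(ℝ, E)) 𝓘(ℝ, E') ∞ (Function.uncurry h) (x₀, y₀)) :
    ContMDiffAt 𝓘(ℝ, P) 𝓘(ℝ, E →L[ℝ] E') ∞ (fun x => tder E E' (h x) y₀) x₀ := by
  have := ContMDiffAt.mfderiv (I := 𝓘(ℝ, E)) (I' := 𝓘(ℝ, E')) (J := 𝓘(ℝ, P)) (m := ∞) (n := ∞)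
    h (fun _ => y₀) hh contMDiffAt_const (by simp)
  refine this.congr_of_eventuallyEq (Eventually.of_forall fun x => ?_)
  refine Eq.symm ((inTangentCoordinates_eq (I := 𝓘(ℝ, E)) (I' := 𝓘(ℝ, E')) (fun _ : N => y₀)
    (fun x => h x y₀) (fun x => tder E E' (h x) y₀) (x₀ := x₀) (x := x)
    (mem_chart_source _ _) (by simp [chartAt_self_eq])).trans ?_)
  ext v
  rw [tangentBundleCore_coordChange_model_space]
  simp only [ContinuousLinearMap.comp_apply]
  rw [VectorBundleCore.coordChange_self _ _ _ (mem_chart_source _ _)]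
  rfl

end ParametricDerivative

/-! ### Calculus on a Lie group in terms of left invariant derivatives -/

section LieGroup

variable {F : Type*} [NormedAddCommGroup F] [NormedSpace ℝ F]
  {G : Type*} [TopologicalSpace G] [ChartedSpace F G] [Group G]
  {E' : Type*} [NormedAddCommGroup E'] [NormedSpace ℝ E']
  {E : Type*} [NormedAddCommGroup E] [NormedSpace ℝ E]
  {X : Type*} [TopologicalSpace X] [ChartedSpace E X]

/-- The derivative of `f` at `x` in the direction of the left invariant vector fields. -/
noncomputable def lderiv (F E : Type*) [NormedAddCommGroup F] [NormedSpace ℝ F]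
    {G : Type*} [TopologicalSpace G] [ChartedSpace F G] [Group G]
    [NormedAddCommGroup E] [NormedSpace ℝ E]
    {X : Type*} [TopologicalSpace X] [ChartedSpace E X] (f : G → X) (x : G) : F →L[ℝ] E :=
  tder F E (fun y => f (x * y)) 1

/-- The adjoint representation on the model space. -/
noncomputable def adModel (F : Type*) [NormedAddCommGroup F] [NormedSpace ℝ F]
    {G : Type*} [TopologicalSpace G] [ChartedSpace F G] [Group G] (a : G) : F →L[ℝ] F :=
  tder F F (fun x : G => a * x * a⁻¹) 1

theorem adModel_one : adModel F (1 : G) = .id ℝ F := by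
  simpa [adModel] using tder_id (E := F) (1 : G)

theorem lderiv_comp_left_mul (f : G → X) (a x : G) :
    lderiv F E (fun y => f (a * y)) x = lderiv F E f (a * x) := by
  simp only [lderiv, mul_assoc]

variable [LieGroup 𝓘(ℝ, F) ∞ G]

theorem contMDiff_left_mul (a : G) : ContMDiff 𝓘(ℝ, F) 𝓘(ℝ, F) ∞ fun x : G => a * x :=
  contMDiff_mul_left

theorem contMDiff_right_mul (a : G) : ContMDiff 𝓘(ℝ, F) 𝓘(ℝ, F) ∞ fun x : G => x * a :=
  contMDiff_mul_right

theorem contMDiff_conj (a : G) : ContMDiff 𝓘(ℝ, F) 𝓘(ℝ, F) ∞ fun x : G => a * x * a⁻¹ :=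
  (contMDiff_right_mul a⁻¹).comp (contMDiff_left_mul a)

theorem tder_mulInvariantVectorField {f : G → X} {x : G}
    (hf : MDifferentiableAt 𝓘(ℝ, F) 𝓘(ℝ, E) f x) (v : GroupLieAlgebra 𝓘(ℝ, F) G) :
    tder F E f x (mulInvariantVectorField v x) = lderiv F E f x v :=
  (DFunLike.congr_fun (tder_comp (g := f) (f := fun y => x * y) (mul_one x) hf
    ((contMDiff_left_mul x).mdifferentiable (by simp) 1)) v).symm

theorem adModel_mul (a b : G) : adModel F (a * b) = (adModel F a).comp (adModel F b) := by
  rw [adModel, adModel, adModel, ← tder_comp (g := fun x : G => a * x * a⁻¹)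
    (f := fun x : G => b * x * b⁻¹) (by simp) ((contMDiff_conj a).mdifferentiable (by simp) _)
    ((contMDiff_conj b).mdifferentiable (by simp) _)]
  simp only [mul_inv_rev, mul_assoc]

/-- Since `x y a = (x a)(a⁻¹ y a)`, right translation costs a conjugation of the increment. -/
theorem lderiv_comp_right_mul {f : G → X} (hf : MDifferentiable 𝓘(ℝ, F) 𝓘(ℝ, E) f) (a x : G) :
    lderiv F E (fun y => f (y * a)) x = (lderiv F E f (x * a)).comp (adModel F a⁻¹) := by
  rw [lderiv, lderiv, adModel, ← tder_comp (g := fun y => f (x * a * y))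
    (f := fun y : G => a⁻¹ * y * a⁻¹⁻¹) (by simp)
    (hf.comp ((contMDiff_left_mul (x * a)).mdifferentiable (by simp)) _)
    ((contMDiff_conj a⁻¹).mdifferentiable (by simp) _)]
  simp [mul_assoc]

/-- The product rule at points where both factors are the identity. -/
theorem tder_mul_of_eq_one {g₁ g₂ : X → G} {x : X} (h₁ : g₁ x = 1) (h₂ : g₂ x = 1)
    (hg₁ : MDifferentiableAt 𝓘(ℝ, E) 𝓘(ℝ, F) g₁ x)
    (hg₂ : MDifferentiableAt 𝓘(ℝ, E) 𝓘(ℝ, F) g₂ x) :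
    tder E F (fun y => g₁ y * g₂ y) x = tder E F g₁ x + tder E F g₂ x := by
  have hm : MDifferentiableAt (𝓘(ℝ, F).prod 𝓘(ℝ, F)) 𝓘(ℝ, F) (fun z : G × G => z.1 * z.2) (1, 1) :=
    (contMDiff_mul 𝓘(ℝ, F) ∞).mdifferentiable (by simp) _
  have hp : (g₁ x, g₂ x) = ((1 : G), (1 : G)) := by rw [h₁, h₂]
  have h3 : MDifferentiableAt 𝓘(ℝ, E) (𝓘(ℝ, F).prod 𝓘(ℝ, F)) (fun y => (g₁ y, g₂ y)) x :=
    hg₁.prodMk hg₂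
  have h4 := mfderiv_comp_of_eq (x := x) (f := fun y => (g₁ y, g₂ y)) hm h3 hp
  ext v
  have h5 := DFunLike.congr_fun h4 v
  refine Eq.trans h5 ?_
  rw [mfderiv_prodMk hg₁ hg₂]
  have h6 : tder F F (fun z : G => z * 1) 1 = .id ℝ F := by simpa using tder_id (E := F) (1 : G)
  have h7 : tder F F (fun z : G => 1 * z) 1 = .id ℝ F := by simpa using tder_id (E := F) (1 : G)
  have h8 : ∀ q : G × G, q = (1, 1) → ∀ v w : F,
      (mfderiv (𝓘(ℝ, F).prod 𝓘(ℝ, F)) 𝓘(ℝ, F) (fun z : G × G => z.1 * z.2) q (v, w) : F) = v + w := by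
    rintro _ rfl v w
    refine Eq.trans (mfderiv_prod_eq_add_apply (v := (v, w)) hm) ?_
    exact congrArg₂ (· + ·) (DFunLike.congr_fun h6 _) (DFunLike.congr_fun h7 _)
  exact h8 _ hp _ _

theorem contMDiff_inv_group : ContMDiff 𝓘(ℝ, F) 𝓘(ℝ, F) ∞ fun x : G => x⁻¹ :=
  contMDiff_inv _ _

theorem tder_inv_one : tder F F (fun x : G => x⁻¹) 1 = -.id ℝ F := by
  have h := tder_mul_of_eq_one (F := F) (g₁ := fun x : G => x) (g₂ := fun x : G => x⁻¹) (x := 1)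
    rfl inv_one mdifferentiableAt_id (contMDiff_inv_group.mdifferentiable (by simp) _)
  simp only [mul_inv_cancel] at h
  rw [tder_const, tder_id] at h
  exact (neg_eq_of_add_eq_zero_right h.symm).symm

/-- Since `(x y)⁻¹ = x⁻¹ (x y⁻¹ x⁻¹)`, and inversion has differential `-1` at the identity. -/
theorem lderiv_comp_inv {f : G → X} (hf : MDifferentiable 𝓘(ℝ, F) 𝓘(ℝ, E) f) (x : G) :
    lderiv F E (fun y => f y⁻¹) x = -(lderiv F E f x⁻¹).comp (adModel F x) := by
  have h1 : (fun y => f (x * y)⁻¹) = fun y => f (x⁻¹ * (x * y⁻¹ * x⁻¹)) := by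
    funext y; congr 1; group
  have h2 := tder_comp (g := fun y => f (x⁻¹ * y)) (f := fun y : G => x * y⁻¹ * x⁻¹) (x := 1) (y := 1)
    (E := F) (by simp) (hf.comp ((contMDiff_left_mul x⁻¹).mdifferentiable (by simp)) _)
    (((contMDiff_conj x).comp contMDiff_inv_group).mdifferentiable (by simp) _)
  have h3 := tder_comp (g := fun y => x * y * x⁻¹) (f := fun y : G => y⁻¹) (x := 1) (y := 1)
    (E := F) (by simp) ((contMDiff_conj x).mdifferentiable (by simp) _)
    (contMDiff_inv_group.mdifferentiable (by simp) _)
  rw [lderiv, h1, h2, h3, tder_inv_one]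
  ext v
  simp [lderiv, adModel]

theorem contMDiff_lderiv {f : G → E'} (hf : ContMDiff 𝓘(ℝ, F) 𝓘(ℝ, E') ∞ f) :
    ContMDiff 𝓘(ℝ, F) 𝓘(ℝ, F →L[ℝ] E') ∞ (lderiv F E' f) := fun _ =>
  contMDiffAt_tder_param (h := fun x y => f (x * y))
    (hf.comp (contMDiff_mul 𝓘(ℝ, F) ∞) _)

/-- With vector-valued conjugation maps, `contMDiffAt_tder_param` yields smoothness of the adjoint
representation. -/
theorem adModel_eq_tder_chart (a : G) :
    adModel F a = tder F F (fun x => extChartAt 𝓘(ℝ, F) (1 : G) (a * x * a⁻¹)) 1 := by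
  rw [tder_comp (g := extChartAt 𝓘(ℝ, F) (1 : G)) (f := fun x => a * x * a⁻¹) (y := 1) (by simp)
    (mdifferentiableAt_extChartAt (mem_chart_source F (1 : G)))
    ((contMDiff_conj a).mdifferentiable (by simp) _), tder_extChartAt]
  rfl

theorem contMDiff_adModel : ContMDiff 𝓘(ℝ, F) 𝓘(ℝ, F →L[ℝ] F) ∞ (adModel F : G → F →L[ℝ] F) := by
  intro a
  have h := contMDiffAt_tder_param (x₀ := a) (y₀ := (1 : G)) (E := F) (P := F) (E' := F)
    (h := fun a x => extChartAt 𝓘(ℝ, F) (1 : G) (a * x * a⁻¹)) (by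
      have h1 : ContMDiff (𝓘(ℝ, F).prod 𝓘(ℝ, F)) 𝓘(ℝ, F) ∞ fun z : G × G => z.1 * z.2 * z.1⁻¹ :=
        (contMDiff_fst.mul contMDiff_snd).mul contMDiff_fst.inv
      exact ContMDiffAt.comp_of_eq (y := (1 : G)) (contMDiffAt_extChartAt (n := ∞))
        (h1 (a, 1)) (by simp))
  simpa only [← adModel_eq_tder_chart] using h

end LieGroup

/-! ### The adjoint representation on the Lie algebra with its invariant inner product -/

section LieAlgebraMetric

variable {F : Type*} [NormedAddCommGroup F] [NormedSpace ℝ F] [FiniteDimensional ℝ F]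
  {G : Type*} [TopologicalSpace G] [ChartedSpace F G] [Group G]
  (c : InnerProductSpace.Core ℝ (GroupLieAlgebra 𝓘(ℝ, F) G))

instance finiteDimensional_withInner : FiniteDimensional ℝ (WithInner c) :=
  inferInstanceAs (FiniteDimensional ℝ F)

instance completeSpace_withInner : CompleteSpace (WithInner c) := FiniteDimensional.complete ℝ _

/-- The Lie algebra with the norm of `c` is isomorphic to the model space. -/
noncomputable def innerEquiv : WithInner c ≃L[ℝ] F :=
  LinearEquiv.toContinuousLinearEquiv (WithInner.equiv c : WithInner c ≃ₗ[ℝ] F)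

/-- The adjoint representation on the Lie algebra with the norm of `c`. -/
noncomputable def adInner (a : G) : WithInner c →L[ℝ] WithInner c :=
  ((innerEquiv c).symm : F →L[ℝ] WithInner c).comp
    ((adModel F a).comp (innerEquiv c : WithInner c →L[ℝ] F))

variable {c}

theorem inner_adInner (hc : IsAdInvariant c) (a : G) (v w : WithInner c) :
    inner ℝ (adInner c a v) (adInner c a w) = inner ℝ v w :=
  hc a (WithInner.equiv c v) (WithInner.equiv c w)

theorem norm_adInner (hc : IsAdInvariant c) (a : G) (v : WithInner c) :
    ‖adInner c a v‖ = ‖v‖ := by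
  rw [norm_eq_sqrt_real_inner, norm_eq_sqrt_real_inner, inner_adInner hc]

theorem adInner_one : adInner c (1 : G) = 1 := by
  ext v
  simp [adInner, adModel_one]

variable [LieGroup 𝓘(ℝ, F) ∞ G]

theorem adInner_mul (a b : G) : adInner c (a * b) = (adInner c a).comp (adInner c b) := by
  ext v
  simp [adInner, adModel_mul]

theorem adInner_inv_apply (a : G) (v : WithInner c) : adInner c a⁻¹ (adInner c a v) = v := by
  have := DFunLike.congr_fun (adInner_mul (c := c) a⁻¹ a) v
  rw [inv_mul_cancel, adInner_one] at this
  exact this.symm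

theorem adInner_apply_inv (a : G) (v : WithInner c) : adInner c a (adInner c a⁻¹ v) = v := by
  simpa using adInner_inv_apply (c := c) a⁻¹ v

variable (c) in
theorem contMDiff_adInner :
    ContMDiff 𝓘(ℝ, F) 𝓘(ℝ, WithInner c →L[ℝ] WithInner c) ∞ (adInner c : G → _) := by
  let L : (F →L[ℝ] F) →L[ℝ] (WithInner c →L[ℝ] WithInner c) :=
    (ContinuousLinearMap.compL ℝ (WithInner c) F (WithInner c)
      ((innerEquiv c).symm : F →L[ℝ] WithInner c)).comp
    ((ContinuousLinearMap.compL ℝ (WithInner c) F F).flip (innerEquiv c : WithInner c →L[ℝ] F))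
  exact L.contMDiff.comp contMDiff_adModel

variable (c) in
theorem continuous_adInner : Continuous (adInner c : G → _) := (contMDiff_adInner c).continuous

end LieAlgebraMetric

/-! ### Weak logarithmic derivatives: inverses, products, uniqueness -/

section LogarithmicDerivative

variable {F : Type*} [NormedAddCommGroup F] [NormedSpace ℝ F] [FiniteDimensional ℝ F]
  {G : Type*} [TopologicalSpace G] [ChartedSpace F G] [Group G] [LieGroup 𝓘(ℝ, F) ∞ G]
  {c : InnerProductSpace.Core ℝ (GroupLieAlgebra 𝓘(ℝ, F) G)}

variable (c) in
/-- The left invariant derivative of a function on `G`, on the Lie algebra with the norm of `c`. -/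
noncomputable def innerDeriv (f : G → ℝ) (x : G) : WithInner c →L[ℝ] ℝ :=
  (lderiv F ℝ f x).comp (innerEquiv c : WithInner c →L[ℝ] F)

variable (c) in
theorem continuous_innerDeriv {f : G → ℝ} (hf : ContMDiff 𝓘(ℝ, F) 𝓘(ℝ, ℝ) ∞ f) :
    Continuous (innerDeriv c f) :=
  ((ContinuousLinearMap.compL ℝ (WithInner c) F ℝ).flip
    (innerEquiv c : WithInner c →L[ℝ] F)).continuous.comp (contMDiff_lderiv hf).continuous

theorem mfderiv_mulInvariantVectorField_val {f : G → ℝ} (hf : ContMDiff 𝓘(ℝ, F) 𝓘(ℝ, ℝ) ∞ f)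
    (w : PathSpace c) (t : ℝ) (x : G) :
    (mfderiv 𝓘(ℝ, F) 𝓘(ℝ, ℝ) f x (mulInvariantVectorField (w.val t) x) : ℝ) =
      innerDeriv c f x (w t) :=
  tder_mulInvariantVectorField ((hf.mdifferentiable (by simp)) x) (w.val t)

theorem hasLogDeriv_iff {g : ℝ → G} {w : PathSpace c} :
    HasLogDeriv g w ↔ ContinuousOn g (Icc 0 1) ∧
      ∀ f : G → ℝ, ContMDiff 𝓘(ℝ, F) 𝓘(ℝ, ℝ) ∞ f → ∀ t ∈ Icc (0 : ℝ) 1,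
        f (g t) - f (g 0) = ∫ s in (0 : ℝ)..t, innerDeriv c f (g s) (w s) := by
  refine and_congr_right fun _ => forall_congr' fun f => forall_congr' fun hf =>
    forall_congr' fun t => forall_congr' fun _ => ?_
  simp only [mfderiv_mulInvariantVectorField_val hf]

theorem intervalIntegrable_innerDeriv {f : G → ℝ} (hf : ContMDiff 𝓘(ℝ, F) 𝓘(ℝ, ℝ) ∞ f)
    {g : ℝ → G} (hg : ContinuousOn g (Icc 0 1)) (w : PathSpace c) {s t : ℝ}
    (hs : s ∈ Icc (0 : ℝ) 1) (ht : t ∈ Icc (0 : ℝ) 1) :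
    IntervalIntegrable (fun r => innerDeriv c f (g r) (w r)) volume s t :=
  intervalIntegrable_clm_apply ((continuous_innerDeriv c hf).comp_continuousOn hg) w hs ht

theorem ParallelTransport.HasLogDeriv.sub_eq_integral {g : ℝ → G} {w : PathSpace c}
    (h : HasLogDeriv g w) {f : G → ℝ} (hf : ContMDiff 𝓘(ℝ, F) 𝓘(ℝ, ℝ) ∞ f) {s t : ℝ}
    (hs : s ∈ Icc (0 : ℝ) 1) (ht : t ∈ Icc (0 : ℝ) 1) :
    f (g t) - f (g s) = ∫ r in s..t, innerDeriv c f (g r) (w r) := by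
  obtain ⟨hg, H⟩ := hasLogDeriv_iff.mp h
  have h0 : (0 : ℝ) ∈ Icc (0 : ℝ) 1 := ⟨le_rfl, zero_le_one⟩
  rw [← intervalIntegral.integral_interval_sub_left
    (intervalIntegrable_innerDeriv hf hg w h0 ht) (intervalIntegrable_innerDeriv hf hg w h0 hs),
    ← H f hf t ht, ← H f hf s hs]
  ring

theorem hasLogDeriv_const (a : G) : HasLogDeriv (fun _ : ℝ => a) (0 : PathSpace c) := by
  refine hasLogDeriv_iff.mpr ⟨continuousOn_const, fun f hf t ht => ?_⟩
  rw [sub_self, integral_congr_unit (g := fun _ => 0) ?_ ⟨le_rfl, zero_le_one⟩ ht]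
  · simp
  · filter_upwards [Lp.coeFn_zero (WithInner c) 2 (volume.restrict (Icc (0 : ℝ) 1))] with s hs
    rw [hs]
    simp

theorem ParallelTransport.HasLogDeriv.congr_ae {g g' : ℝ → G} {w : PathSpace c}
    (h : HasLogDeriv g w) (hg : EqOn g g' (Icc 0 1)) : HasLogDeriv g' w := by
  obtain ⟨hc, H⟩ := hasLogDeriv_iff.mp h
  refine hasLogDeriv_iff.mpr ⟨hc.congr fun t ht => (hg ht).symm, fun f hf t ht => ?_⟩
  have h0 : (0 : ℝ) ∈ Icc (0 : ℝ) 1 := ⟨le_rfl, zero_le_one⟩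
  rw [← hg ht, ← hg h0, H f hf t ht]
  refine intervalIntegral.integral_congr fun s hs => ?_
  simp only [hg (uIcc_subset_Icc h0 ht hs)]

theorem ParallelTransport.HasLogDeriv.inv {g : ℝ → G} {w w' : PathSpace c} (h : HasLogDeriv g w)
    (hw : ∀ᵐ t ∂(volume.restrict (Icc (0 : ℝ) 1)), w' t = -adInner c (g t) (w t)) :
    HasLogDeriv (fun t => (g t)⁻¹) w' := by
  obtain ⟨hc, H⟩ := hasLogDeriv_iff.mp h
  have hci : Continuous fun x : G => x⁻¹ := (contMDiff_inv_group (F := F)).continuous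
  refine hasLogDeriv_iff.mpr ⟨hci.comp_continuousOn hc, fun f hf t ht => ?_⟩
  rw [H (fun x => f x⁻¹) (hf.comp contMDiff_inv_group) t ht]
  refine integral_congr_unit ?_ ⟨le_rfl, zero_le_one⟩ ht
  filter_upwards [hw] with s hs
  rw [hs, innerDeriv, innerDeriv, lderiv_comp_inv (hf.mdifferentiable (by simp))]
  simp [adInner]

theorem ParallelTransport.HasLogDeriv.left_mul {g : ℝ → G} {w : PathSpace c} (h : HasLogDeriv g w)
    (a : G) : HasLogDeriv (fun t => a * g t) w := by
  obtain ⟨hc, H⟩ := hasLogDeriv_iff.mp h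
  refine hasLogDeriv_iff.mpr ⟨(contMDiff_left_mul (F := F) a).continuous.comp_continuousOn hc,
    fun f hf t ht => ?_⟩
  rw [H (fun x => f (a * x)) (hf.comp (contMDiff_left_mul a)) t ht]
  simp only [innerDeriv, lderiv_comp_left_mul]

theorem innerDeriv_comp_right_mul {f : G → ℝ} (hf : ContMDiff 𝓘(ℝ, F) 𝓘(ℝ, ℝ) ∞ f) (a x : G)
    (v : WithInner c) :
    innerDeriv c (fun y => f (y * a)) x v = innerDeriv c f (x * a) (adInner c a⁻¹ v) := by
  rw [innerDeriv, innerDeriv, lderiv_comp_right_mul (hf.mdifferentiable (by simp))]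
  simp [adInner]

/-- The product rule for logarithmic derivatives. -/
theorem ParallelTransport.HasLogDeriv.mul {g₁ g₂ : ℝ → G} {w₁ w₂ w : PathSpace c}
    (h₁ : HasLogDeriv g₁ w₁) (h₂ : HasLogDeriv g₂ w₂)
    (hw : ∀ᵐ t ∂(volume.restrict (Icc (0 : ℝ) 1)), w t = adInner c (g₂ t)⁻¹ (w₁ t) + w₂ t) :
    HasLogDeriv (fun t => g₁ t * g₂ t) w := by
  have hG : IsTopologicalGroup G := topologicalGroup_of_lieGroup 𝓘(ℝ, F) ∞
  have hc₁ := h₁.1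
  have hc₂ := h₂.1
  have hcm : ContinuousOn (fun t => g₁ t * g₂ t) (Icc 0 1) := hc₁.mul hc₂
  refine hasLogDeriv_iff.mpr ⟨hcm, fun f hf t ht => ?_⟩
  -- The increment of `f(g₁ g₂)` over `[s, t]` is split by moving one factor at a time. This
  -- produces the integrands `P (r, t)` and `Q (s, r)`, which uniform continuity compares with their
  -- diagonal values at `(r, r)`.
  let P : ℝ × ℝ → WithInner c →L[ℝ] ℝ := fun z =>
    (innerDeriv c f (g₁ z.1 * g₂ z.2)).comp (adInner c (g₂ z.2)⁻¹)
  let Q : ℝ × ℝ → WithInner c →L[ℝ] ℝ := fun z => innerDeriv c f (g₁ z.1 * g₂ z.2)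
  have hI : IsCompact (Icc (0 : ℝ) 1 ×ˢ Icc (0 : ℝ) 1) := isCompact_Icc.prod isCompact_Icc
  have hm : ContinuousOn (fun z : ℝ × ℝ => g₁ z.1 * g₂ z.2) (Icc (0 : ℝ) 1 ×ˢ Icc (0 : ℝ) 1) :=
    (hc₁.comp continuousOn_fst fun z hz => hz.1).mul (hc₂.comp continuousOn_snd fun z hz => hz.2)
  have hQ : ContinuousOn Q (Icc (0 : ℝ) 1 ×ˢ Icc (0 : ℝ) 1) :=
    (continuous_innerDeriv c hf).comp_continuousOn hm
  have hA : ContinuousOn (fun z : ℝ × ℝ => adInner c (g₂ z.2)⁻¹) (Icc (0 : ℝ) 1 ×ˢ Icc (0 : ℝ) 1) :=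
    (continuous_adInner c).comp_continuousOn
      (hc₂.comp continuousOn_snd fun z hz => hz.2).inv
  have hP : ContinuousOn P (Icc (0 : ℝ) 1 ×ˢ Icc (0 : ℝ) 1) := hQ.clm_comp hA
  have hPu := hI.uniformContinuousOn_of_continuous hP
  have hQu := hI.uniformContinuousOn_of_continuous hQ
  rw [Metric.uniformContinuousOn_iff] at hPu hQu
  have h0 : (0 : ℝ) ∈ Icc (0 : ℝ) 1 := ⟨le_rfl, zero_le_one⟩
  have h1 : (1 : ℝ) ∈ Icc (0 : ℝ) 1 := ⟨zero_le_one, le_rfl⟩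
  have hint : ∀ s ∈ Icc (0 : ℝ) 1, ∀ t ∈ Icc (0 : ℝ) 1,
      IntervalIntegrable (fun r => innerDeriv c f (g₁ r * g₂ r) (w r)) volume s t :=
    fun s hs t ht => intervalIntegrable_innerDeriv hf hcm w hs ht
  let R : ℝ → ℝ := fun t => f (g₁ t * g₂ t) -
    ∫ r in (0 : ℝ)..t, innerDeriv c f (g₁ r * g₂ r) (w r)
  have key : ∀ t ∈ Icc (0 : ℝ) 1, R t = R 0 := by
    refine eq_of_norm_increment_le (φ := fun r => ‖w₁ r‖ + ‖w₂ r‖)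
      ((L2Path.intervalIntegrable w₁ h0 h1).norm.add (L2Path.intervalIntegrable w₂ h0 h1).norm) ?_
    intro ε hε
    obtain ⟨δ₁, hδ₁, H₁⟩ := hPu ε hε
    obtain ⟨δ₂, hδ₂, H₂⟩ := hQu ε hε
    refine ⟨min δ₁ δ₂, lt_min hδ₁ hδ₂, fun s t hs0 hst ht1 hδ => ?_⟩
    have hs : s ∈ Icc (0 : ℝ) 1 := ⟨hs0, hst.trans ht1⟩
    have ht : t ∈ Icc (0 : ℝ) 1 := ⟨hs0.trans hst, ht1⟩
    have e1 : f (g₁ t * g₂ t) - f (g₁ s * g₂ t) = ∫ r in s..t, P (r, t) (w₁ r) := by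
      rw [h₁.sub_eq_integral (f := fun x => f (x * g₂ t)) (hf.comp (contMDiff_right_mul _)) hs ht]
      refine intervalIntegral.integral_congr fun r _ => ?_
      exact innerDeriv_comp_right_mul hf _ _ _
    have e2 : f (g₁ s * g₂ t) - f (g₁ s * g₂ s) = ∫ r in s..t, Q (s, r) (w₂ r) := by
      rw [h₂.sub_eq_integral (f := fun x => f (g₁ s * x)) (hf.comp (contMDiff_left_mul _)) hs ht]
      refine intervalIntegral.integral_congr fun r _ => ?_
      simp only [innerDeriv, Q, lderiv_comp_left_mul]
    have e3 : (∫ r in (0 : ℝ)..t, innerDeriv c f (g₁ r * g₂ r) (w r)) -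
        ∫ r in (0 : ℝ)..s, innerDeriv c f (g₁ r * g₂ r) (w r) =
        ∫ r in s..t, (P (r, r) (w₁ r) + Q (r, r) (w₂ r)) := by
      rw [intervalIntegral.integral_interval_sub_left (hint 0 h0 t ht) (hint 0 h0 s hs)]
      refine integral_congr_unit ?_ hs ht
      filter_upwards [hw] with r hr
      rw [hr, map_add]
      rfl
    have i1 : IntervalIntegrable (fun r => P (r, t) (w₁ r)) volume s t :=
      intervalIntegrable_clm_apply (hP.comp (by fun_prop) fun r hr => ⟨hr, ht⟩) w₁ hs ht
    have i2 : IntervalIntegrable (fun r => Q (s, r) (w₂ r)) volume s t :=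
      intervalIntegrable_clm_apply (hQ.comp (by fun_prop) fun r hr => ⟨hs, hr⟩) w₂ hs ht
    have i3 : IntervalIntegrable (fun r => P (r, r) (w₁ r)) volume s t :=
      intervalIntegrable_clm_apply (hP.comp (by fun_prop) fun r hr => ⟨hr, hr⟩) w₁ hs ht
    have i4 : IntervalIntegrable (fun r => Q (r, r) (w₂ r)) volume s t :=
      intervalIntegrable_clm_apply (hQ.comp (by fun_prop) fun r hr => ⟨hr, hr⟩) w₂ hs ht
    have e4 : R t - R s = ∫ r in s..t,
        ((P (r, t) (w₁ r) + Q (s, r) (w₂ r)) - (P (r, r) (w₁ r) + Q (r, r) (w₂ r))) := by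
      rw [intervalIntegral.integral_sub (i1.add i2) (i3.add i4),
        intervalIntegral.integral_add i1 i2, ← e1, ← e2, ← e3]
      simp only [R]
      ring
    rw [e4, ← intervalIntegral.integral_const_mul]
    refine intervalIntegral.norm_integral_le_of_norm_le hst (ae_of_all _ fun r hr => ?_)
      (((L2Path.intervalIntegrable w₁ hs ht).norm.add
        (L2Path.intervalIntegrable w₂ hs ht).norm).const_mul ε)
    have hr' : r ∈ Icc s t := ⟨hr.1.le, hr.2⟩
    have hr1 : r ∈ Icc (0 : ℝ) 1 := ⟨hs0.trans hr'.1, hr'.2.trans ht1⟩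
    have d1 : ‖P (r, t) - P (r, r)‖ ≤ ε := by
      rw [← dist_eq_norm]
      refine (H₁ _ ⟨hr1, ht⟩ _ ⟨hr1, hr1⟩ ?_).le
      rw [Prod.dist_eq, dist_self, Real.dist_eq, abs_of_nonneg (sub_nonneg.mpr hr'.2)]
      exact max_lt hδ₁ (by linarith [hr'.1, min_le_left δ₁ δ₂])
    have d2 : ‖Q (s, r) - Q (r, r)‖ ≤ ε := by
      rw [← dist_eq_norm]
      refine (H₂ _ ⟨hs, hr1⟩ _ ⟨hr1, hr1⟩ ?_).le
      rw [Prod.dist_eq, dist_self, dist_comm, Real.dist_eq, abs_of_nonneg (sub_nonneg.mpr hr'.1)]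
      exact max_lt (by linarith [hr'.2, min_le_right δ₁ δ₂]) hδ₂
    have e5 : (P (r, t) (w₁ r) + Q (s, r) (w₂ r)) - (P (r, r) (w₁ r) + Q (r, r) (w₂ r)) =
        (P (r, t) - P (r, r)) (w₁ r) + (Q (s, r) - Q (r, r)) (w₂ r) := by
      simp only [sub_apply]
      ring
    rw [e5, mul_add]
    exact (norm_add_le _ _).trans (add_le_add (ContinuousLinearMap.le_of_opNorm_le _ d1 _)
      (ContinuousLinearMap.le_of_opNorm_le _ d2 _))
  have := key t ht
  simp only [R, intervalIntegral.integral_same, sub_zero] at this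
  linarith

variable (c) in
/-- The path of operators `Ad(g(t))`. -/
noncomputable def adPath {g : ℝ → G} (hg : ContinuousOn g (Icc 0 1)) :
    C(Icc (0 : ℝ) 1, WithInner c →L[ℝ] WithInner c) :=
  ⟨fun t => adInner c (g t), ((continuous_adInner c).comp_continuousOn hg).domRestrict⟩

theorem coeFn_mulOp_adPath {g : ℝ → G} (hg : ContinuousOn g (Icc 0 1)) (u : PathSpace c) :
    ∀ᵐ t ∂(volume.restrict (Icc (0 : ℝ) 1)),
      mulOp _ _ (adPath c hg) u t = adInner c (g t) (u t) := by
  filter_upwards [coeFn_mulOp (adPath c hg) u, ae_restrict_mem measurableSet_Icc] with t h1 h2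
  rw [h1, extendUnit, projIcc_of_mem _ h2]
  rfl

variable [T2Space G] [CompactSpace G]

/-- Every smooth function is constant along `g`, and smooth functions separate the points of `G`. -/
theorem eq_of_hasLogDeriv_zero {g : ℝ → G} (h : HasLogDeriv g (0 : PathSpace c)) :
    ∀ t ∈ Icc (0 : ℝ) 1, g t = g 0 := by
  intro t ht
  by_contra hne
  obtain ⟨f, hf, -, hf0, hf1⟩ := exists_contMDiff_zero_iff_one_iff_of_isClosed 𝓘(ℝ, F)
    (n := ⊤) (isClosed_singleton (x := g t)) (isClosed_singleton (x := g 0))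
    (disjoint_singleton.mpr hne)
  have h1 := (hasLogDeriv_iff.mp h).2 f hf t ht
  rw [(hf0 _).mp rfl, (hf1 _).mp rfl, integral_congr_unit (g := fun _ => 0) ?_
    ⟨le_rfl, zero_le_one⟩ ht] at h1
  · simp at h1
  · filter_upwards [Lp.coeFn_zero (WithInner c) 2 (volume.restrict (Icc (0 : ℝ) 1))] with s hs
    rw [hs]
    simp

/-- A path is determined by its logarithmic derivative and its initial value. -/
theorem ParallelTransport.HasLogDeriv.eqOn {g g' : ℝ → G} {w : PathSpace c} (h : HasLogDeriv g w)
    (h' : HasLogDeriv g' w) (h0 : g 0 = g' 0) : EqOn g g' (Icc 0 1) := by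
  let w' : PathSpace c := -mulOp _ _ (adPath c h'.1) w
  have hw' : ∀ᵐ t ∂(volume.restrict (Icc (0 : ℝ) 1)), w' t = -adInner c (g' t) (w t) := by
    filter_upwards [Lp.coeFn_neg (mulOp _ _ (adPath c h'.1) w), coeFn_mulOp_adPath h'.1 w]
      with t h1 h2
    rw [h1, Pi.neg_apply, h2]
  -- The quotient of two solutions has logarithmic derivative `Ad(g') w - Ad(g') w = 0`.
  have hprod : HasLogDeriv (fun t => g t * (g' t)⁻¹) (0 : PathSpace c) := by
    refine h.mul (h'.inv hw') ?_
    filter_upwards [hw', Lp.coeFn_zero (WithInner c) 2 (volume.restrict (Icc (0 : ℝ) 1))]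
      with t h1 h2
    rw [h1, h2, inv_inv]
    simp
  intro t ht
  have := eq_of_hasLogDeriv_zero hprod t ht
  simp only [h0, mul_inv_cancel] at this
  exact mul_inv_eq_one.mp this

end LogarithmicDerivative

/-! ### Cutoffs and the chain rule along absolutely continuous paths -/

section Cutoff

variable {F : Type*} [NormedAddCommGroup F] [NormedSpace ℝ F] [FiniteDimensional ℝ F]
  {B : Type*} [NormedAddCommGroup B] [NormedSpace ℝ B]

/-- A map which is smooth near a point agrees near the point with a globally smooth map. -/
theorem exists_contDiff_eqOn_ball {U : Set F} (hU : IsOpen U) {x : F} (hx : x ∈ U) :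
    ∃ r > 0, Metric.ball x r ⊆ U ∧ ∀ g : F → B, ContDiffOn ℝ ∞ g U →
      ∃ g' : F → B, ContDiff ℝ ∞ g' ∧ EqOn g' g (Metric.ball x r) := by
  obtain ⟨R, hR, hRU⟩ := Metric.isOpen_iff.mp hU x hx
  let ρ : ContDiffBump x := ⟨R / 4, R / 2, by positivity, by linarith⟩
  refine ⟨R / 4, by positivity, (Metric.ball_subset_ball (by linarith)).trans hRU,
    fun g hg => ⟨fun y => ρ y • g y, ?_, fun y hy => ?_⟩⟩
  · refine contDiff_iff_contDiffAt.mpr fun y => ?_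
    by_cases hy : y ∈ tsupport ρ
    · rw [ρ.tsupport_eq] at hy
      have hyU : y ∈ U := hRU (Metric.closedBall_subset_ball (by simp only [ρ]; linarith) hy)
      exact ρ.contDiff.contDiffAt.smul (hg.contDiffAt (hU.mem_nhds hyU))
    · have h0 : (fun z => ρ z • g z) =ᶠ[𝓝 y] fun _ => 0 := by
        filter_upwards [notMem_tsupport_iff_eventuallyEq.mp hy] with z hz
        rw [hz, Pi.zero_apply, zero_smul]
      exact contDiffAt_const.congr_of_eventuallyEq h0
  · have : ρ y = 1 := ρ.one_of_mem_closedBall (Metric.ball_subset_closedBall hy)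
    simp only [this, one_smul]

/-- The chain rule along the primitive of a square integrable path. -/
theorem sub_eq_integral_fderiv {f : F → ℝ} (hf : ContDiff ℝ ∞ f) {γ : C(Icc (0 : ℝ) 1, F)}
    {x₀ : F} {v : L2Path F} (hγ : ∀ t : Icc (0 : ℝ) 1, γ t = x₀ + ∫ s in (0 : ℝ)..t, v s) :
    ∀ t ∈ Icc (0 : ℝ) 1, f (extendUnit γ t) - f (extendUnit γ 0) =
      ∫ s in (0 : ℝ)..t, fderiv ℝ f (extendUnit γ s) (v s) := by
  have h0 : (0 : ℝ) ∈ Icc (0 : ℝ) 1 := ⟨le_rfl, zero_le_one⟩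
  have h1 : (1 : ℝ) ∈ Icc (0 : ℝ) 1 := ⟨zero_le_one, le_rfl⟩
  have hfd : Continuous (fderiv ℝ f) := hf.continuous_fderiv (by simp)
  set g : ℝ → F := extendUnit γ
  have hg : Continuous g := continuous_extendUnit γ
  have hgt : ∀ t ∈ Icc (0 : ℝ) 1, g t = x₀ + ∫ s in (0 : ℝ)..t, v s := fun t ht => by
    simp only [g, projIcc_of_mem zero_le_one ht, hγ]
  have hcl : ContinuousOn (fun r => fderiv ℝ f (g r)) (Icc 0 1) := (hfd.comp hg).continuousOn
  have hint : ∀ s ∈ Icc (0 : ℝ) 1, ∀ t ∈ Icc (0 : ℝ) 1,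
      IntervalIntegrable (fun r => fderiv ℝ f (g r) (v r)) volume s t :=
    fun s hs t ht => intervalIntegrable_clm_apply hcl v hs ht
  let R : ℝ → ℝ := fun t => f (g t) - ∫ r in (0 : ℝ)..t, fderiv ℝ f (g r) (v r)
  suffices key : ∀ t ∈ Icc (0 : ℝ) 1, R t = R 0 by
    intro t ht
    have := key t ht
    simp only [R, intervalIntegral.integral_same, sub_zero] at this
    linarith
  refine eq_of_norm_increment_le (L2Path.intervalIntegrable v h0 h1).norm ?_
  intro ε hε
  -- A ball is needed rather than the image of the path: the mean value inequality runs along the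
  -- segment from `g s` to `g t`, which may leave the image.
  obtain ⟨ρ, hρ⟩ := (isCompact_Icc.image hg).isBounded.subset_closedBall (0 : F)
  have hu := (isCompact_closedBall (0 : F) ρ).uniformContinuousOn_of_continuous hfd.continuousOn
  obtain ⟨δ', hδ', H'⟩ := Metric.uniformContinuousOn_iff.mp hu (ε / 2) (by positivity)
  have hgu := isCompact_Icc.uniformContinuousOn_of_continuous (hg.continuousOn (s := Icc (0 : ℝ) 1))
  obtain ⟨δ, hδ, H⟩ := Metric.uniformContinuousOn_iff.mp hgu δ' hδ'
  refine ⟨δ, hδ, fun s t hs0 hst ht1 hd => ?_⟩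
  have hs : s ∈ Icc (0 : ℝ) 1 := ⟨hs0, hst.trans ht1⟩
  have ht : t ∈ Icc (0 : ℝ) 1 := ⟨hs0.trans hst, ht1⟩
  have hmem : ∀ r ∈ Icc (0 : ℝ) 1, g r ∈ Metric.closedBall 0 ρ := fun r hr =>
    hρ ⟨r, hr, rfl⟩
  have hclose : ∀ r ∈ Icc s t, dist (g r) (g s) < δ' := fun r hr =>
    H r ⟨hs0.trans hr.1, hr.2.trans ht1⟩ s hs (by
      rw [Real.dist_eq, abs_of_nonneg (sub_nonneg.mpr hr.1)]; linarith [hr.2])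
  have hgst : g t - g s = ∫ r in s..t, v r := by
    rw [hgt t ht, hgt s hs, add_sub_add_left_eq_sub,
      intervalIntegral.integral_interval_sub_left (L2Path.intervalIntegrable v h0 ht)
        (L2Path.intervalIntegrable v h0 hs)]
  have hiv : IntervalIntegrable (fun r => ‖v r‖) volume s t :=
    (L2Path.intervalIntegrable v hs ht).norm
  have hgn : ‖g t - g s‖ ≤ ∫ r in s..t, ‖v r‖ := by
    rw [hgst]; exact intervalIntegral.norm_integral_le_integral_norm hst
  have e1 : ‖f (g t) - f (g s) - fderiv ℝ f (g s) (g t - g s)‖ ≤ ε / 2 * ‖g t - g s‖ := by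
    refine (convex_segment (g s) (g t)).norm_image_sub_le_of_norm_hasFDerivWithin_le'
      (f' := fderiv ℝ f) (fun x _ => ((hf.differentiable (by simp)) x).hasFDerivAt.hasFDerivWithinAt)
      ?_ (left_mem_segment ℝ _ _) (right_mem_segment ℝ _ _)
    intro z hz
    rw [← dist_eq_norm]
    refine (H' z ?_ (g s) (hmem s hs) ?_).le
    · exact (convex_closedBall (0 : F) ρ).segment_subset (hmem s hs) (hmem t ht) hz
    · have h3 := hclose t ⟨hst, le_rfl⟩
      rw [segment_eq_image'] at hz
      obtain ⟨θ, ⟨hθ0, hθ1⟩, rfl⟩ := hz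
      rw [dist_eq_norm, add_sub_cancel_left, norm_smul, Real.norm_of_nonneg hθ0]
      rw [dist_eq_norm] at h3
      exact lt_of_le_of_lt (mul_le_of_le_one_left (norm_nonneg _) hθ1) h3
  have e2 : fderiv ℝ f (g s) (g t - g s) = ∫ r in s..t, fderiv ℝ f (g s) (v r) := by
    rw [hgst, ContinuousLinearMap.intervalIntegral_comp_comm _ (L2Path.intervalIntegrable v hs ht)]
  have i1 : IntervalIntegrable (fun r => fderiv ℝ f (g s) (v r)) volume s t :=
    intervalIntegrable_clm_apply continuousOn_const v hs ht
  have e3 : ‖∫ r in s..t, (fderiv ℝ f (g s) (v r) - fderiv ℝ f (g r) (v r))‖ ≤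
      ∫ r in s..t, ε / 2 * ‖v r‖ := by
    refine intervalIntegral.norm_integral_le_of_norm_le hst (ae_of_all _ fun r hr => ?_)
      (hiv.const_mul _)
    have hr' : r ∈ Icc s t := ⟨hr.1.le, hr.2⟩
    have hr1 : r ∈ Icc (0 : ℝ) 1 := ⟨hs0.trans hr'.1, hr'.2.trans ht1⟩
    have h4 := (H' (g r) (hmem r hr1) (g s) (hmem s hs) (hclose r hr')).le
    rw [dist_comm, dist_eq_norm] at h4
    exact ContinuousLinearMap.le_of_opNorm_le _ h4 _
  have e4 : R t - R s = (f (g t) - f (g s) - fderiv ℝ f (g s) (g t - g s)) +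
      ∫ r in s..t, (fderiv ℝ f (g s) (v r) - fderiv ℝ f (g r) (v r)) := by
    rw [intervalIntegral.integral_sub i1 (hint s hs t ht), ← e2]
    simp only [R]
    rw [← intervalIntegral.integral_interval_sub_left (hint 0 h0 t ht) (hint 0 h0 s hs)]
    ring
  rw [intervalIntegral.integral_const_mul] at e3
  rw [e4]
  refine (norm_add_le _ _).trans ?_
  have := mul_le_mul_of_nonneg_left hgn (by positivity : (0 : ℝ) ≤ ε / 2)
  linarith

end Cutoff

/-! ### Parallel transport for small controls, in the chart at the identity -/

section LocalTransport

variable {F : Type*} [NormedAddCommGroup F] [NormedSpace ℝ F]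
  {G : Type*} [TopologicalSpace G] [ChartedSpace F G] [Group G] [LieGroup 𝓘(ℝ, F) ∞ G]

variable (F G) in
/-- The left invariant vector fields in the chart at the identity. -/
noncomputable def chartField (x : F) : F →L[ℝ] F :=
  tder F F (fun y : G => extChartAt 𝓘(ℝ, F) (1 : G) ((extChartAt 𝓘(ℝ, F) (1 : G)).symm x * y)) 1

variable (F G) in
theorem contDiffOn_chartField :
    ContDiffOn ℝ ∞ (chartField F G) (extChartAt 𝓘(ℝ, F) (1 : G)).target := by
  intro x hx
  set φ := extChartAt 𝓘(ℝ, F) (1 : G)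
  have hsymm : ContMDiffAt 𝓘(ℝ, F) 𝓘(ℝ, F) ∞ φ.symm x :=
    (contMDiffOn_extChartAt_symm (1 : G)).contMDiffAt ((isOpen_extChartAt_target _).mem_nhds hx)
  have hφ : ContMDiffAt 𝓘(ℝ, F) 𝓘(ℝ, F) ∞ φ (φ.symm x) :=
    contMDiffAt_extChartAt' (by
      have := φ.map_target hx
      rwa [extChartAt_source] at this)
  have h := contMDiffAt_tder_param (x₀ := x) (y₀ := (1 : G)) (E := F) (P := F) (E' := F)
    (h := fun x y => φ (φ.symm x * y)) (by
      refine ContMDiffAt.comp_of_eq (y := φ.symm x) hφ ?_ (by simp)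
      exact (hsymm.comp (x, (1 : G)) contMDiffAt_fst).mul contMDiffAt_snd)
  exact (contMDiffAt_iff_contDiffAt.mp h).contDiffWithinAt

theorem chartField_one : chartField F G (extChartAt 𝓘(ℝ, F) (1 : G) 1) = .id ℝ F := by
  simp only [chartField, extChartAt_to_inv, one_mul]
  exact tder_extChartAt (1 : G)

/-- Only the germ of `f'` at `x` matters, so a globally smooth cutoff of `f` in the chart may be
used. -/
theorem fderiv_comp_chartField {f : G → ℝ} {x : F}
    (hx : x ∈ (extChartAt 𝓘(ℝ, F) (1 : G)).target) {f' : F → ℝ}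
    (hf' : DifferentiableAt ℝ f' x)
    (he : f' =ᶠ[𝓝 x] fun z => f ((extChartAt 𝓘(ℝ, F) (1 : G)).symm z)) :
    (fderiv ℝ f' x).comp (chartField F G x) =
      lderiv F ℝ f ((extChartAt 𝓘(ℝ, F) (1 : G)).symm x) := by
  set φ := extChartAt 𝓘(ℝ, F) (1 : G)
  have hsrc : φ.symm x ∈ φ.source := φ.map_target hx
  have hφ : MDifferentiableAt 𝓘(ℝ, F) 𝓘(ℝ, F) φ (φ.symm x * 1) := by
    rw [mul_one]
    exact mdifferentiableAt_extChartAt (by rwa [← extChartAt_source (I := 𝓘(ℝ, F))])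
  have hmul : MDifferentiableAt 𝓘(ℝ, F) 𝓘(ℝ, F) (fun y => φ.symm x * y) (1 : G) :=
    (contMDiff_left_mul (F := F) (φ.symm x)).mdifferentiable (by simp) 1
  have h1 : φ (φ.symm x * 1) = x := by rw [mul_one, φ.right_inv hx]
  rw [← tder_eq_fderiv, chartField, ← tder_comp (g := f') (f := fun y => φ (φ.symm x * y)) h1
    hf'.mdifferentiableAt (hφ.comp _ hmul)]
  refine tder_congr ?_
  have hc : ContinuousAt (fun y => φ (φ.symm x * y)) (1 : G) := (hφ.comp _ hmul).continuousAt
  have hev : ∀ᶠ y in 𝓝 (1 : G), φ.symm x * y ∈ φ.source :=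
    hmul.continuousAt.eventually_mem (by
      rw [mul_one]; exact (isOpen_extChartAt_source _).mem_nhds hsrc)
  have hc' : Tendsto (fun y => φ (φ.symm x * y)) (𝓝 (1 : G)) (𝓝 x) := by
    have := hc.tendsto; rwa [h1] at this
  filter_upwards [hev, hc'.eventually he] with y h2 h3
  rw [h3, φ.left_inv h2]

variable [FiniteDimensional ℝ F] (c : InnerProductSpace.Core ℝ (GroupLieAlgebra 𝓘(ℝ, F) G))

/-- Local existence of the transport path and its smooth dependence on the control. -/
theorem exists_local_transport :
    ∃ (e : PathSpace c → ℝ → G) (A B : PathSpace c → C(Icc (0 : ℝ) 1, WithInner c →L[ℝ] WithInner c)),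
      (∀ᶠ u in 𝓝 0, HasLogDeriv (e u) u ∧ e u 0 = 1) ∧
      ContMDiffAt 𝓘(ℝ, PathSpace c) 𝓘(ℝ, F) ∞ (fun u => e u 1) 0 ∧
      (∀ u, tder (PathSpace c) F (fun u => e u 1) 0 u = innerEquiv c (meanOp _ u)) ∧
      ContDiffAt ℝ ∞ A 0 ∧ ContDiffAt ℝ ∞ B 0 ∧
      ∀ᶠ u in 𝓝 0, ∀ t : Icc (0 : ℝ) 1, A u t = adInner c (e u t) ∧ B u t = adInner c (e u t)⁻¹ := by
  set φ := extChartAt 𝓘(ℝ, F) (1 : G) with hφdef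
  set x₀ := φ 1
  have hx₀ : x₀ ∈ φ.target := mem_extChartAt_target (1 : G)
  have hopen : IsOpen φ.target := isOpen_extChartAt_target (1 : G)
  have hsymm : ContMDiffOn 𝓘(ℝ, F) 𝓘(ℝ, F) ∞ φ.symm φ.target := contMDiffOn_extChartAt_symm (1 : G)
  obtain ⟨r₁, hr₁, hb₁, hext₁⟩ := exists_contDiff_eqOn_ball (B := WithInner c →L[ℝ] F) hopen hx₀
  obtain ⟨r₂, hr₂, hb₂, hext₂⟩ :=
    exists_contDiff_eqOn_ball (B := WithInner c →L[ℝ] WithInner c) hopen hx₀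
  -- The radius is fixed before the function to be extended, so a single neighbourhood of controls
  -- serves all test functions `f` below.
  obtain ⟨r₃, hr₃, hb₃, hext₃⟩ := exists_contDiff_eqOn_ball (B := ℝ) hopen hx₀
  let toW : (F →L[ℝ] F) →L[ℝ] (WithInner c →L[ℝ] F) :=
    (ContinuousLinearMap.compL ℝ (WithInner c) F F).flip (innerEquiv c : WithInner c →L[ℝ] F)
  obtain ⟨X, hX, hXeq⟩ := hext₁ (fun x => toW (chartField F G x))
    (toW.contDiff.comp_contDiffOn (contDiffOn_chartField F G))
  obtain ⟨a, ha, haeq⟩ := hext₂ (fun x => adInner c (φ.symm x))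
    (contMDiffOn_iff_contDiffOn.mp ((contMDiff_adInner c).comp_contMDiffOn hsymm))
  obtain ⟨b, hb, hbeq⟩ := hext₂ (fun x => adInner c (φ.symm x)⁻¹)
    (contMDiffOn_iff_contDiffOn.mp (((contMDiff_adInner c).comp contMDiff_inv_group).comp_contMDiffOn hsymm))
  obtain ⟨γ, hγ, hγ0, hγs, hγd⟩ := exists_contDiffAt_solution hX x₀
  set r := min r₁ (min r₂ r₃)
  have hr : 0 < r := lt_min hr₁ (lt_min hr₂ hr₃)
  have hnear : ∀ᶠ u in 𝓝 (0 : PathSpace c), ∀ t, γ u t ∈ Metric.ball x₀ r := by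
    have h1 := Metric.tendsto_nhds.mp hγ.continuousAt.tendsto r hr
    filter_upwards [h1] with u hu t
    rw [hγ0] at hu
    exact lt_of_le_of_lt (ContinuousMap.dist_apply_le_dist t) hu
  have h01 : (⟨1, zero_le_one, le_rfl⟩ : Icc (0 : ℝ) 1) = projIcc 0 1 zero_le_one 1 := by
    rw [projIcc_of_mem zero_le_one ⟨zero_le_one, le_rfl⟩]
  have hev : ContDiffAt ℝ ∞ (fun u => extendUnit (γ u) 1) 0 :=
    (ContinuousMap.evalCLM ℝ (projIcc (0 : ℝ) 1 zero_le_one 1) :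
      C(Icc (0 : ℝ) 1, F) →L[ℝ] F).contDiff.contDiffAt.comp 0 hγ
  have hev0 : extendUnit (γ 0) 1 = x₀ := by rw [hγ0]; rfl
  refine ⟨fun u t => φ.symm (extendUnit (γ u) t),
    fun u => (⟨a, ha.continuous⟩ : C(F, _)).comp (γ u),
    fun u => (⟨b, hb.continuous⟩ : C(F, _)).comp (γ u), ?_, ?_, ?_, ?_, ?_, ?_⟩
  · filter_upwards [hγs, hnear] with u hu hun
    have hball : ∀ t : ℝ, extendUnit (γ u) t ∈ Metric.ball x₀ r := fun t => hun _
    have htgt : ∀ t : ℝ, extendUnit (γ u) t ∈ φ.target := fun t =>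
      hb₁ (Metric.ball_subset_ball (min_le_left _ _) (hball t))
    refine ⟨hasLogDeriv_iff.mpr ⟨?_, fun f hf t ht => ?_⟩, ?_⟩
    · exact (hsymm.continuousOn.comp_continuous (continuous_extendUnit (γ u)) htgt).continuousOn
    · obtain ⟨f', hf', hfeq⟩ := hext₃ (fun x => f (φ.symm x))
        (contMDiffOn_iff_contDiffOn.mp (hf.comp_contMDiffOn hsymm))
      have hin₃ : ∀ t : ℝ, extendUnit (γ u) t ∈ Metric.ball x₀ r₃ := fun t =>
        Metric.ball_subset_ball ((min_le_right _ _).trans (min_le_right _ _)) (hball t)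
      let Xγ : C(Icc (0 : ℝ) 1, WithInner c →L[ℝ] F) := (⟨X, hX.continuous⟩ : C(F, _)).comp (γ u)
      have hsol : ∀ t : Icc (0 : ℝ) 1, γ u t = x₀ + ∫ s in (0 : ℝ)..t, mulOp _ _ Xγ u s := by
        intro t
        rw [hu t, integral_congr_unit (coeFn_mulOp Xγ u) ⟨le_rfl, zero_le_one⟩ t.2]
        rfl
      have := sub_eq_integral_fderiv hf' hsol t ht
      rw [hfeq (hin₃ t), hfeq (hin₃ 0)] at this
      rw [this]
      refine integral_congr_unit ?_ ⟨le_rfl, zero_le_one⟩ ht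
      filter_upwards [coeFn_mulOp Xγ u] with s hs
      rw [hs]
      have h5 : extendUnit Xγ s = toW (chartField F G (extendUnit (γ u) s)) :=
        hXeq (Metric.ball_subset_ball (min_le_left _ _) (hball s))
      have h6 := fderiv_comp_chartField (htgt s) ((hf'.differentiable (by simp)) _)
        (Filter.eventuallyEq_of_mem (Metric.isOpen_ball.mem_nhds (hin₃ s)) hfeq)
      rw [h5, innerDeriv, ← h6]
      rfl
    · have h7 : extendUnit (γ u) 0 = x₀ := by
        rw [extendUnit, projIcc_of_mem zero_le_one ⟨le_rfl, zero_le_one⟩, hu]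
        simp
      simp only [h7]
      exact extChartAt_to_inv (1 : G)
  · exact contMDiffAt_chart_symm_comp hev hev0
  · intro u
    have h1 := DFunLike.congr_fun (mfderiv_chart_symm_comp hev hev0) u
    refine Eq.trans h1 ?_
    have h2 : HasFDerivAt (fun u => extendUnit (γ u) 1)
        ((ContinuousMap.evalCLM ℝ (projIcc (0 : ℝ) 1 zero_le_one 1) :
          C(Icc (0 : ℝ) 1, F) →L[ℝ] F).comp (fderiv ℝ γ 0)) 0 :=
      (ContinuousMap.evalCLM ℝ (projIcc (0 : ℝ) 1 zero_le_one 1) :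
        C(Icc (0 : ℝ) 1, F) →L[ℝ] F).hasFDerivAt.comp 0
        (hγ.differentiableAt (by simp)).hasFDerivAt
    rw [h2.fderiv]
    have h3 : X x₀ = (innerEquiv c : WithInner c →L[ℝ] F) := by
      rw [hXeq (Metric.mem_ball_self hr₁)]
      simp only [toW, x₀, hφdef, chartField_one]
      rfl
    have h4 := hγd u ⟨1, zero_le_one, le_rfl⟩
    rw [h3, h01] at h4
    refine Eq.trans h4 ?_
    rw [projIcc_of_mem zero_le_one ⟨zero_le_one, le_rfl⟩, meanOp_apply]
    exact ContinuousLinearMap.intervalIntegral_comp_comm _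
      (L2Path.intervalIntegrable u ⟨le_rfl, zero_le_one⟩ ⟨zero_le_one, le_rfl⟩)
  · exact (contDiff_continuousMap_comp ha).contDiffAt.comp 0 hγ
  · exact (contDiff_continuousMap_comp hb).contDiffAt.comp 0 hγ
  · filter_upwards [hnear] with u hu t
    have h8 : γ u t ∈ Metric.ball x₀ r₂ :=
      Metric.ball_subset_ball ((min_le_right _ _).trans (min_le_left _ _)) (hu t)
    have h9 : extendUnit (γ u) t = γ u t := by
      rw [extendUnit, projIcc_of_mem zero_le_one t.2]
    simp only [h9]
    exact ⟨haeq h8, hbeq h8⟩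

end LocalTransport

/-! ### Global transport, the shift formula and gauge equivariance -/

section Transport

variable {F : Type*} [NormedAddCommGroup F] [NormedSpace ℝ F] [FiniteDimensional ℝ F]
  {G : Type*} [TopologicalSpace G] [ChartedSpace F G] [Group G] [LieGroup 𝓘(ℝ, F) ∞ G]
  {c : InnerProductSpace.Core ℝ (GroupLieAlgebra 𝓘(ℝ, F) G)}

variable (c) in
/-- The path of operators `Ad(g(t)⁻¹)`. -/
noncomputable def adInvPath {g : ℝ → G} (hg : ContinuousOn g (Icc 0 1)) :
    C(Icc (0 : ℝ) 1, WithInner c →L[ℝ] WithInner c) :=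
  adPath c (g := fun t => (g t)⁻¹)
    ((contMDiff_inv_group (F := F)).continuous.comp_continuousOn hg)

theorem coeFn_mulOp_adInvPath {g : ℝ → G} (hg : ContinuousOn g (Icc 0 1)) (u : PathSpace c) :
    ∀ᵐ t ∂(volume.restrict (Icc (0 : ℝ) 1)),
      mulOp _ _ (adInvPath c hg) u t = adInner c (g t)⁻¹ (u t) :=
  coeFn_mulOp_adPath (g := fun t => (g t)⁻¹) _ u

theorem mulOp_adInvPath_adPath {g : ℝ → G} (hg : ContinuousOn g (Icc 0 1)) (u : PathSpace c) :
    mulOp _ _ (adInvPath c hg) (mulOp _ _ (adPath c hg) u) = u := by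
  refine L2Path.ext_ae ?_
  filter_upwards [coeFn_mulOp_adInvPath hg (mulOp _ _ (adPath c hg) u), coeFn_mulOp_adPath hg u]
    with t h1 h2
  rw [h1, h2, adInner_inv_apply]

theorem mulOp_adPath_adInvPath {g : ℝ → G} (hg : ContinuousOn g (Icc 0 1)) (u : PathSpace c) :
    mulOp _ _ (adPath c hg) (mulOp _ _ (adInvPath c hg) u) = u := by
  refine L2Path.ext_ae ?_
  filter_upwards [coeFn_mulOp_adPath hg (mulOp _ _ (adInvPath c hg) u), coeFn_mulOp_adInvPath hg u]
    with t h1 h2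
  rw [h1, h2, adInner_apply_inv]

theorem norm_mulOp_adPath (hc : IsAdInvariant c) {g : ℝ → G} (hg : ContinuousOn g (Icc 0 1))
    (u : PathSpace c) : ‖mulOp _ _ (adPath c hg) u‖ = ‖u‖ := by
  have h : ∀ᵐ t ∂(volume.restrict (Icc (0 : ℝ) 1)), ‖mulOp _ _ (adPath c hg) u t‖ = ‖u t‖ := by
    filter_upwards [coeFn_mulOp_adPath hg u] with t h1
    rw [h1, norm_adInner hc]
  exact le_antisymm (Lp.norm_le_norm_of_ae_le (h.mono fun t ht => ht.le))
    (Lp.norm_le_norm_of_ae_le (h.mono fun t ht => ht.ge))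

/-- Pointwise action of `Ad(g(t))` on square integrable paths, for a continuous path `g`. -/
noncomputable def adIsometry (hc : IsAdInvariant c) {g : ℝ → G} (hg : ContinuousOn g (Icc 0 1)) :
    PathSpace c ≃ₗᵢ[ℝ] PathSpace c where
  toLinearEquiv := LinearEquiv.ofLinearMap (mulOp _ _ (adPath c hg)).toLinearMap
    (mulOp _ _ (adInvPath c hg)).toLinearMap
    (LinearMap.ext (mulOp_adPath_adInvPath hg)) (LinearMap.ext (mulOp_adInvPath_adPath hg))
  norm_map' := norm_mulOp_adPath hc hg

theorem coeFn_adIsometry (hc : IsAdInvariant c) {g : ℝ → G} (hg : ContinuousOn g (Icc 0 1))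
    (u : PathSpace c) : ∀ᵐ t ∂(volume.restrict (Icc (0 : ℝ) 1)),
      adIsometry hc hg u t = adInner c (g t) (u t) := coeFn_mulOp_adPath hg u

theorem coeFn_adIsometry_symm (hc : IsAdInvariant c) {g : ℝ → G} (hg : ContinuousOn g (Icc 0 1))
    (u : PathSpace c) : ∀ᵐ t ∂(volume.restrict (Icc (0 : ℝ) 1)),
      (adIsometry hc hg).symm u t = adInner c (g t)⁻¹ (u t) := coeFn_mulOp_adInvPath hg u

/-- The product rule gives `Ad(g⁻¹) Ad(g)(v - u) + u = v`. This reduces transport near an arbitrary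
control `u` to transport near `0`. -/
theorem ParallelTransport.HasLogDeriv.mul_of_gauge (hc : IsAdInvariant c) {g h : ℝ → G}
    {u v : PathSpace c} (hg : HasLogDeriv g u)
    (hh : HasLogDeriv h (adIsometry hc hg.1 (v - u))) : HasLogDeriv (fun t => h t * g t) v := by
  refine hh.mul hg ?_
  filter_upwards [coeFn_adIsometry hc hg.1 (v - u), Lp.coeFn_sub v u] with t h1 h2
  rw [h1, adInner_inv_apply, h2, Pi.sub_apply, sub_add_cancel]

/-- Local existence is continued along the ray through `u`. As `Ad(g)` is isometric on `L²`, each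
step may have the same length `δ`, so finitely many steps reach `u`. -/
theorem exists_transport (hc : IsAdInvariant c) (u : PathSpace c) :
    ∃ g : ℝ → G, HasLogDeriv g u ∧ g 0 = 1 := by
  obtain ⟨e, -, -, he, -⟩ := exists_local_transport c
  obtain ⟨δ, hδ, H⟩ := Metric.eventually_nhds_iff.mp he
  have step : ∀ v v' : PathSpace c, (∃ g : ℝ → G, HasLogDeriv g v ∧ g 0 = 1) → ‖v' - v‖ < δ →
      ∃ g : ℝ → G, HasLogDeriv g v' ∧ g 0 = 1 := by
    rintro v v' ⟨g, hg, hg0⟩ hd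
    obtain ⟨h1, h2⟩ := H (y := adIsometry hc hg.1 (v' - v)) (by
      rw [dist_zero_right, LinearIsometryEquiv.norm_map]; exact hd)
    exact ⟨_, hg.mul_of_gauge hc h1, by simp only [h2, hg0, mul_one]⟩
  obtain ⟨n, hn⟩ := exists_nat_gt (‖u‖ / δ)
  have hn0 : (0 : ℝ) < n := lt_of_le_of_lt (by positivity) hn
  have key : ∀ k : ℕ, ∃ g : ℝ → G, HasLogDeriv g (((k : ℝ) / n) • u) ∧ g 0 = 1 := by
    intro k
    induction k with
    | zero => exact ⟨fun _ => 1, by simpa using hasLogDeriv_const (1 : G), rfl⟩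
    | succ k ih =>
      refine step _ _ ih ?_
      rw [← sub_smul, Nat.cast_succ, ← sub_div, add_sub_cancel_left, norm_smul,
        Real.norm_of_nonneg (by positivity), one_div_mul_eq_div, div_lt_comm₀ hn0 hδ]
      exact hn
  simpa [div_self hn0.ne'] using key n

theorem hasLogDeriv_transportPath (hc : IsAdInvariant c) (u : PathSpace c) :
    HasLogDeriv (transportPath u) u := (Classical.epsilon_spec (exists_transport hc u)).1

theorem transportPath_zero (hc : IsAdInvariant c) (u : PathSpace c) : transportPath u 0 = 1 :=
  (Classical.epsilon_spec (exists_transport hc u)).2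

theorem continuousOn_transportPath (hc : IsAdInvariant c) (u : PathSpace c) :
    ContinuousOn (transportPath u) (Icc 0 1) := (hasLogDeriv_transportPath hc u).1

/-- Pointwise action of `Ad(E_u(t))`. -/
noncomputable def transportIsometry (hc : IsAdInvariant c) (u : PathSpace c) :
    PathSpace c ≃ₗᵢ[ℝ] PathSpace c := adIsometry hc (continuousOn_transportPath hc u)

section Operators

variable (hc : IsAdInvariant c)

/-- The path of operators `Ad(E_u(t))`. -/
noncomputable def transportAd (u : PathSpace c) :
    C(Icc (0 : ℝ) 1, WithInner c →L[ℝ] WithInner c) := adPath c (continuousOn_transportPath hc u)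

/-- The path of operators `Ad(E_u(t)⁻¹)`. -/
noncomputable def transportAdInv (u : PathSpace c) :
    C(Icc (0 : ℝ) 1, WithInner c →L[ℝ] WithInner c) :=
  adInvPath c (continuousOn_transportPath hc u)

theorem contDiff_transportShift (u : PathSpace c) :
    ContDiff ℝ ∞ fun v => transportIsometry hc u (v - u) :=
  (transportIsometry hc u).contDiff.comp (contDiff_id.sub contDiff_const)

end Operators

variable [T2Space G] [CompactSpace G]

theorem eqOn_transportPath (hc : IsAdInvariant c) {g : ℝ → G} {u : PathSpace c}
    (hg : HasLogDeriv g u) (h0 : g 0 = 1) : EqOn (transportPath u) g (Icc 0 1) :=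
  (hasLogDeriv_transportPath hc u).eqOn hg ((transportPath_zero hc u).trans h0.symm)

theorem transportPath_mul (hc : IsAdInvariant c) (u v : PathSpace c) :
    EqOn (transportPath v)
      (fun t => transportPath (transportIsometry hc u (v - u)) t * transportPath u t) (Icc 0 1) :=
  eqOn_transportPath hc ((hasLogDeriv_transportPath hc u).mul_of_gauge hc
    (hasLogDeriv_transportPath hc _)) (by simp only [transportPath_zero hc, mul_one])

theorem parallelTransport_mul (hc : IsAdInvariant c) (u v : PathSpace c) :
    parallelTransport v =
      parallelTransport (transportIsometry hc u (v - u)) * parallelTransport u :=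
  transportPath_mul hc u v ⟨zero_le_one, le_rfl⟩

theorem transportPath_zero_control (hc : IsAdInvariant c) {t : ℝ} (ht : t ∈ Icc (0 : ℝ) 1) :
    transportPath (0 : PathSpace c) t = 1 :=
  eqOn_transportPath hc (hasLogDeriv_const (1 : G)) rfl ht

/-- Equivariance of the transport paths under gauge transformations. -/
theorem transportPath_gauge (hc : IsAdInvariant c) {g : ℝ → G} {u v w : PathSpace c}
    (hg : HasLogDeriv g w)
    (hv : ∀ᵐ t ∂(volume.restrict (Icc (0 : ℝ) 1)),
      v t = adInner c (g t) (u t) - adInner c (g t) (w t)) :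
    EqOn (transportPath v) (fun t => g 0 * (transportPath u t * (g t)⁻¹)) (Icc 0 1) := by
  let w' : PathSpace c := -adIsometry hc hg.1 w
  have hw' : ∀ᵐ t ∂(volume.restrict (Icc (0 : ℝ) 1)), w' t = -adInner c (g t) (w t) := by
    filter_upwards [Lp.coeFn_neg (adIsometry hc hg.1 w), coeFn_adIsometry hc hg.1 w] with t h1 h2
    rw [h1, Pi.neg_apply, h2]
  refine eqOn_transportPath hc (HasLogDeriv.left_mul
    ((hasLogDeriv_transportPath hc u).mul (hg.inv hw') ?_) (g 0)) ?_
  · filter_upwards [hv, hw'] with t h1 h2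
    rw [h1, h2, inv_inv, sub_eq_add_neg]
  · simp [transportPath_zero hc]

section Smooth

variable (hc : IsAdInvariant c)

include hc in
theorem contMDiffAt_parallelTransport_zero :
    ContMDiffAt 𝓘(ℝ, PathSpace c) 𝓘(ℝ, F) ∞ (parallelTransport (c := c)) 0 ∧
    ∀ u, tder (PathSpace c) F (parallelTransport (c := c)) 0 u = innerEquiv c (meanOp _ u) := by
  obtain ⟨e, -, -, he, h1, h2, -⟩ := exists_local_transport c
  have heq : parallelTransport (c := c) =ᶠ[𝓝 0] fun u => e u 1 := by
    filter_upwards [he] with u hu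
    exact eqOn_transportPath hc hu.1 hu.2 ⟨zero_le_one, le_rfl⟩
  exact ⟨h1.congr_of_eventuallyEq heq, fun u => by rw [tder_congr heq, h2]⟩

include hc in
theorem contMDiff_parallelTransport :
    ContMDiff 𝓘(ℝ, PathSpace c) 𝓘(ℝ, F) ∞ (parallelTransport (c := c)) := by
  intro u
  have h : parallelTransport (c := c) =
      fun v => parallelTransport (transportIsometry hc u (v - u)) * parallelTransport u :=
    funext (parallelTransport_mul hc u)
  rw [h]
  refine (contMDiff_right_mul (F := F) (parallelTransport u) _).comp u ?_
  refine ContMDiffAt.comp_of_eq (y := (0 : PathSpace c))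
    (contMDiffAt_parallelTransport_zero hc).1 (contDiff_transportShift hc u).contMDiff.contMDiffAt
    (by simp)

/-- The shift formula at `u` writes `Φ` as an affine isometry taking `u` to `0`, then `Φ` near `0`,
then right translation by `Φ(u)`. Only the middle differential, the mean, carries analytic content.
-/
theorem tder_parallelTransport (u v : PathSpace c) :
    tder (PathSpace c) F (parallelTransport (c := c)) u v =
      tder F F (fun x : G => x * parallelTransport u) 1
        (innerEquiv c (meanOp _ (transportIsometry hc u v))) := by
  have h : parallelTransport (c := c) =
      fun v => parallelTransport (transportIsometry hc u (v - u)) * parallelTransport u :=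
    funext (parallelTransport_mul hc u)
  have hs0 : transportIsometry hc u (u - u) = 0 := by simp
  have h0 : parallelTransport (0 : PathSpace c) = 1 :=
    transportPath_zero_control hc ⟨zero_le_one, le_rfl⟩
  have hd := (contDiff_transportShift hc u).contMDiff.mdifferentiable (by simp) u
  have hp := (contMDiff_parallelTransport hc).mdifferentiable (by simp) 0
  have h1 := tder_comp (g := parallelTransport (c := c))
    (f := fun v => transportIsometry hc u (v - u)) hs0 hp hd
  have h2 := tder_comp (g := fun x : G => x * parallelTransport u)
    (f := fun v => parallelTransport (transportIsometry hc u (v - u))) (x := u) (y := 1)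
    (E := PathSpace c) (by rw [hs0, h0])
    ((contMDiff_right_mul (F := F) (parallelTransport u)).mdifferentiable (by simp) _)
    (by rw [← hs0] at hp; exact hp.comp u hd)
  rw [← h, h1] at h2
  rw [h2]
  simp only [ContinuousLinearMap.comp_apply]
  rw [(contMDiffAt_parallelTransport_zero hc).2, tder_eq_fderiv]
  have h3 : HasFDerivAt (fun v => transportIsometry hc u (v - u))
      (transportIsometry hc u : PathSpace c →L[ℝ] PathSpace c) u := by
    have := (transportIsometry hc u : PathSpace c →L[ℝ] PathSpace c).hasFDerivAt.comp u
      ((hasFDerivAt_id u).sub_const u)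
    rwa [ContinuousLinearMap.comp_id] at this
  rw [h3.fderiv]
  rfl

/-- Smoothness near `0` comes from the local solutions. At `u` the shift formula expresses `Ad(E_v)`
as the local family composed pointwise on the right with the fixed path `Ad(E_u)`; for inverses the
fixed path composes on the left. -/
theorem contDiff_transportAd : ContDiff ℝ ∞ (transportAd hc) ∧ ContDiff ℝ ∞ (transportAdInv hc) := by
  obtain ⟨e, A, B, he, -, -, hA, hB, hAB⟩ := exists_local_transport c
  have hshift : ∀ u, Tendsto (fun v => transportIsometry hc u (v - u)) (𝓝 u) (𝓝 0) := fun u => by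
    simpa using (contDiff_transportShift hc u).continuous.tendsto u
  have hmul : ∀ u, ∀ᶠ v in 𝓝 u, ∀ t : Icc (0 : ℝ) 1,
      A (transportIsometry hc u (v - u)) t = adInner c (transportPath v t * (transportPath u t)⁻¹) ∧
      B (transportIsometry hc u (v - u)) t =
        adInner c (transportPath v t * (transportPath u t)⁻¹)⁻¹ := fun u => by
    filter_upwards [(hshift u).eventually he, (hshift u).eventually hAB] with v h1 h2 t
    have h3 := eqOn_transportPath hc h1.1 h1.2 t.2
    have h4 := transportPath_mul hc u v t.2
    have h5 : transportPath v t * (transportPath u t)⁻¹ =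
        e (transportIsometry hc u (v - u)) t := by
      rw [h4, ← h3, mul_inv_cancel_right]
    rw [h5]
    exact h2 t
  constructor <;> refine contDiff_iff_contDiffAt.mpr fun u => ?_
  · let R : C(Icc (0 : ℝ) 1, (WithInner c →L[ℝ] WithInner c) →L[ℝ] WithInner c →L[ℝ] WithInner c) :=
      ⟨fun t => (ContinuousLinearMap.compL ℝ _ _ _).flip (transportAd hc u t), by fun_prop⟩
    have h1 : ContDiffAt ℝ ∞ (fun v => pointwiseApply _ _ _ R (A (transportIsometry hc u (v - u)))) u := by
      have hA' : ContDiffAt ℝ ∞ A (transportIsometry hc u (u - u)) := by simpa using hA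
      have h2 : ContDiffAt ℝ ∞ (fun v => A (transportIsometry hc u (v - u))) u :=
        hA'.comp u (contDiff_transportShift hc u).contDiffAt
      exact (pointwiseApply _ _ _ R).contDiff.contDiffAt.comp u h2
    refine h1.congr_of_eventuallyEq ?_
    filter_upwards [hmul u] with v hv
    ext t : 1
    rw [pointwiseApply_apply, (hv t).1]
    refine Eq.trans ?_ (adInner_mul _ _)
    rw [inv_mul_cancel_right]
    rfl
  · let R : C(Icc (0 : ℝ) 1, (WithInner c →L[ℝ] WithInner c) →L[ℝ] WithInner c →L[ℝ] WithInner c) :=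
      ⟨fun t => ContinuousLinearMap.compL ℝ _ _ _ (transportAdInv hc u t), by fun_prop⟩
    have h1 : ContDiffAt ℝ ∞ (fun v => pointwiseApply _ _ _ R (B (transportIsometry hc u (v - u)))) u := by
      have hB' : ContDiffAt ℝ ∞ B (transportIsometry hc u (u - u)) := by simpa using hB
      have h2 : ContDiffAt ℝ ∞ (fun v => B (transportIsometry hc u (v - u))) u :=
        hB'.comp u (contDiff_transportShift hc u).contDiffAt
      exact (pointwiseApply _ _ _ R).contDiff.contDiffAt.comp u h2
    refine h1.congr_of_eventuallyEq ?_
    filter_upwards [hmul u] with v hv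
    ext t : 1
    rw [pointwiseApply_apply, (hv t).2]
    refine Eq.trans ?_ (adInner_mul _ _)
    rw [mul_inv_rev, inv_inv, inv_mul_cancel_left]
    rfl

end Smooth

end Transport

/-! ### Surjectivity of the parallel transport map onto the identity component -/

section Image

variable {F : Type*} [NormedAddCommGroup F] [NormedSpace ℝ F] [FiniteDimensional ℝ F]
  {G : Type*} [TopologicalSpace G] [ChartedSpace F G] [Group G] [LieGroup 𝓘(ℝ, F) ∞ G]
  {c : InnerProductSpace.Core ℝ (GroupLieAlgebra 𝓘(ℝ, F) G)} (hc : IsAdInvariant c)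

include hc in
theorem transportPath_mem (u : PathSpace c) {t : ℝ} (ht : t ∈ Icc (0 : ℝ) 1) :
    transportPath u t ∈ identityComponent F G := by
  have h := isPreconnected_Icc.image (transportPath u) (continuousOn_transportPath hc u)
  exact h.subset_connectedComponent ⟨0, ⟨le_rfl, zero_le_one⟩, transportPath_zero hc u⟩
    ⟨t, ht, rfl⟩

variable [T2Space G] [CompactSpace G]

include hc in
theorem parallelTransport_zero : parallelTransport (0 : PathSpace c) = 1 :=
  transportPath_zero_control hc ⟨zero_le_one, le_rfl⟩

/-- The image of the parallel transport map, as a subgroup. -/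
noncomputable def transportRange : Subgroup G where
  carrier := range (parallelTransport (c := c))
  mul_mem' := by
    rintro _ _ ⟨v, rfl⟩ ⟨u, rfl⟩
    -- Chosen so that the shift formula at `u` returns exactly `Φ(v) Φ(u)`.
    refine ⟨(transportIsometry hc u).symm v + u, ?_⟩
    rw [parallelTransport_mul hc u]
    simp
  one_mem' := ⟨0, parallelTransport_zero hc⟩
  inv_mem' := by
    rintro _ ⟨u, rfl⟩
    refine ⟨transportIsometry hc u (0 - u), ?_⟩
    have := parallelTransport_mul hc u 0
    rw [parallelTransport_zero hc] at this
    exact eq_inv_of_mul_eq_one_left this.symm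

/-- At `0` the differential of `Φ` is the mean, which constant paths show to be onto. Hence `Φ` is
open at `0`. -/
theorem transportRange_mem_nhds : (transportRange hc : Set G) ∈ 𝓝 (1 : G) := by
  set φ := extChartAt 𝓘(ℝ, F) (1 : G)
  have hΦ := contMDiff_parallelTransport hc
  have h0 := parallelTransport_zero hc
  have hφ : ContMDiffAt 𝓘(ℝ, F) 𝓘(ℝ, F) ∞ φ (1 : G) := contMDiffAt_extChartAt
  have hf : ContDiffAt ℝ ∞ (fun u => φ (parallelTransport (c := c) u)) 0 :=
    contMDiffAt_iff_contDiffAt.mp (ContMDiffAt.comp_of_eq (y := (1 : G)) hφ (hΦ 0) h0)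
  have hd : ∀ u, fderiv ℝ (fun u => φ (parallelTransport (c := c) u)) 0 u =
      innerEquiv c (meanOp _ u) := by
    intro u
    rw [← tder_eq_fderiv, tder_comp (g := φ) (f := parallelTransport (c := c)) h0
      (hφ.mdifferentiableAt (by simp)) (hΦ.mdifferentiable (by simp) 0), tder_extChartAt,
      ContinuousLinearMap.id_comp, (contMDiffAt_parallelTransport_zero hc).2]
  have hmap := HasStrictFDerivAt.map_nhds_eq_of_surj (hf.hasStrictFDerivAt (by simp)) (by
    refine LinearMap.range_eq_top.mpr fun y => ⟨constOp _ ((innerEquiv c).symm y), ?_⟩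
    refine (hd _).trans ?_
    rw [meanOp_constOp]
    simp)
  have hsrc : ∀ᶠ u in 𝓝 (0 : PathSpace c), parallelTransport u ∈ φ.source :=
    hΦ.continuous.continuousAt.eventually_mem
      (by rw [h0]; exact extChartAt_source_mem_nhds (1 : G))
  have himg : (fun u => φ (parallelTransport (c := c) u)) '' {u | parallelTransport u ∈ φ.source} ∈
      𝓝 (φ 1) := by
    have := image_mem_map (m := fun u => φ (parallelTransport (c := c) u)) hsrc
    rw [hmap, h0] at this
    exact this
  filter_upwards [hφ.continuousAt.eventually_mem himg, extChartAt_source_mem_nhds (I := 𝓘(ℝ, F)) (1 : G)]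
    with x hx hxs
  obtain ⟨u, hu, hux⟩ := hx
  exact ⟨u, φ.injOn hu hxs hux⟩

include hc in
/-- The parallel transport map is onto the identity component. -/
theorem range_parallelTransport :
    range (parallelTransport (c := c)) = (identityComponent F G : Set G) := by
  have hG : IsTopologicalGroup G := topologicalGroup_of_lieGroup 𝓘(ℝ, F) ∞
  refine Subset.antisymm ?_ ?_
  · rintro _ ⟨u, rfl⟩
    exact transportPath_mem hc u ⟨zero_le_one, le_rfl⟩
  · have ho : IsOpen (transportRange hc : Set G) :=
      (transportRange hc).isOpen_of_mem_nhds (g := 1) (transportRange_mem_nhds hc)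
    have hcl : IsClosed (transportRange hc : Set G) := (transportRange hc).isClosed_of_isOpen ho
    exact isPreconnected_connectedComponent.subset_isClopen ⟨hcl, ho⟩
      ⟨1, mem_connectedComponent, (transportRange hc).one_mem⟩

include hc in
theorem isOpen_identityComponent : IsOpen (identityComponent F G : Set G) := by
  have hG : IsTopologicalGroup G := topologicalGroup_of_lieGroup 𝓘(ℝ, F) ∞
  rw [← range_parallelTransport hc]
  exact (transportRange hc).isOpen_of_mem_nhds (g := 1) (transportRange_mem_nhds hc)

end Image

/-! ### The parallel transport map is a Riemannian submersion -/

section Submersions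

theorem tder_left_mul_comp {F : Type*} [NormedAddCommGroup F] [NormedSpace ℝ F]
    {G : Type*} [TopologicalSpace G] [ChartedSpace F G] [Group G] [LieGroup 𝓘(ℝ, F) ∞ G]
    (a b x : G) :
    (tder F F (fun y : G => b * y) (a * x)).comp (tder F F (fun y : G => a * y) x) =
      tder F F (fun y : G => b * a * y) x := by
  rw [← tder_comp (g := fun y : G => b * y) (f := fun y : G => a * y) rfl
    ((contMDiff_left_mul b).mdifferentiable (by simp) _)
    ((contMDiff_left_mul a).mdifferentiable (by simp) _)]
  simp only [mul_assoc]

variable {F : Type*} [NormedAddCommGroup F] [NormedSpace ℝ F] [FiniteDimensional ℝ F]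
  {G : Type*} [TopologicalSpace G] [ChartedSpace F G] [Group G]
  {c : InnerProductSpace.Core ℝ (GroupLieAlgebra 𝓘(ℝ, F) G)}

variable (c) in
/-- Left translation of tangent vectors to the Lie algebra with the norm of `c`. -/
noncomputable def leftInner (a : G) : F →L[ℝ] WithInner c :=
  ((innerEquiv c).symm : F →L[ℝ] WithInner c).comp (tder F F (fun x : G => a⁻¹ * x) a)

theorem groupMetric_eq (a : G) (v w : F) :
    groupMetric c a v w = inner ℝ (leftInner c a v) (leftInner c a w) := rfl

variable [LieGroup 𝓘(ℝ, F) ∞ G]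

variable (c) in
theorem bijective_leftInner (a : G) : Function.Bijective (leftInner c a) := by
  have h1 : (tder F F (fun y : G => a * y) 1).comp (tder F F (fun x : G => a⁻¹ * x) a) = .id ℝ F := by
    have := tder_left_mul_comp (F := F) a⁻¹ a a
    rw [inv_mul_cancel] at this
    simpa using this.trans (by simpa using tder_id a)
  have h2 : (tder F F (fun x : G => a⁻¹ * x) a).comp (tder F F (fun y : G => a * y) 1) = .id ℝ F := by
    have := tder_left_mul_comp (F := F) a a⁻¹ 1
    rw [mul_one] at this
    exact this.trans (by simpa using tder_id 1)
  have hb : Function.Bijective (tder F F (fun x : G => a⁻¹ * x) a) :=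
    Function.bijective_iff_has_inverse.mpr ⟨tder F F (fun y : G => a * y) 1,
      fun v => DFunLike.congr_fun h1 v, fun v => DFunLike.congr_fun h2 v⟩
  exact (innerEquiv c).symm.bijective.comp hb

theorem isDefiniteFamily_groupMetric : IsDefiniteFamily (groupMetric c : MetricFamily F G) := fun a =>
  ⟨(innerₗ (WithInner c)).compl₁₂ (leftInner c a).toLinearMap (leftInner c a).toLinearMap,
    fun _ _ => rfl, fun v hv => (bijective_leftInner c a).1 (by
      rw [map_zero]
      exact inner_self_eq_zero (𝕜 := ℝ).mp hv)⟩

theorem isDefiniteFamily_flatMetric (V : Type*) [NormedAddCommGroup V] [InnerProductSpace ℝ V] :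
    IsDefiniteFamily (flatMetric V) := fun _ =>
  ⟨innerₗ V, fun _ _ => rfl, fun _ hv => inner_self_eq_zero (𝕜 := ℝ).mp hv⟩

variable (hc : IsAdInvariant c)

theorem inner_symm_constOp (u : PathSpace c) (η : WithInner c) (v : PathSpace c) :
    inner ℝ ((transportIsometry hc u).symm (constOp _ η)) v =
      inner ℝ η (meanOp _ (transportIsometry hc u v)) := by
  rw [← inner_constOp, ← LinearIsometryEquiv.inner_map_map (transportIsometry hc u)]
  simp

/-- A path which is orthogonal to the kernel of the differential of the parallel transport map. -/
theorem eq_symm_constOp_of_orthogonal {u ξ : PathSpace c}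
    (h : ∀ v, meanOp _ (transportIsometry hc u v) = 0 → inner ℝ ξ v = 0) :
    ξ = (transportIsometry hc u).symm (constOp _ (meanOp _ (transportIsometry hc u ξ))) := by
  rw [LinearIsometryEquiv.eq_symm_apply]
  refine eq_constOp_of_orthogonal fun v hv => ?_
  have := h ((transportIsometry hc u).symm v) (by simpa using hv)
  rw [← LinearIsometryEquiv.inner_map_map (transportIsometry hc u)] at this
  simpa using this

variable [T2Space G] [CompactSpace G]

/-- The differential of `Φ` is naturally right-translated while the metric is defined by left
translation. The two trivializations differ by `Ad(Φ(u)⁻¹)`, an isometry. -/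
theorem leftInner_tder_parallelTransport (u v : PathSpace c) :
    leftInner c (parallelTransport u) (tder (PathSpace c) F (parallelTransport (c := c)) u v) =
      adInner c (parallelTransport u)⁻¹ (meanOp _ (transportIsometry hc u v)) := by
  rw [tder_parallelTransport hc, leftInner, adInner]
  have h := tder_comp (g := fun x : G => (parallelTransport u)⁻¹ * x)
    (f := fun x : G => x * parallelTransport u) (x := 1) (E := F) (E'' := F) (one_mul _)
    ((contMDiff_left_mul (F := F) _).mdifferentiable (by simp) _)
    ((contMDiff_right_mul (F := F) (parallelTransport u)).mdifferentiable (by simp) _)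
  simp only [ContinuousLinearMap.comp_apply]
  congr 1
  refine (DFunLike.congr_fun h.symm _).trans ?_
  simp [adModel, mul_assoc]

theorem tder_parallelTransport_eq_zero_iff (u v : PathSpace c) :
    tder (PathSpace c) F (parallelTransport (c := c)) u v = 0 ↔
      meanOp _ (transportIsometry hc u v) = 0 := by
  have h := leftInner_tder_parallelTransport hc u v
  constructor
  · intro h0
    rw [h0, map_zero] at h
    rw [← adInner_apply_inv (c := c) (parallelTransport u) (meanOp _ (transportIsometry hc u v)),
      ← h, map_zero]
  · intro h0
    rw [h0, map_zero] at h
    exact (bijective_leftInner c _).1 (h.trans (map_zero _).symm)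

include hc in
/-- The parallel transport map is a Riemannian submersion. -/
theorem isRiemannianSubmersionAt_parallelTransport (u : PathSpace c) :
    IsRiemannianSubmersionAt (flatMetric (PathSpace c)) (groupMetric c : MetricFamily F G)
      (parallelTransport (c := c)) u := by
  constructor
  · intro η
    refine ⟨(transportIsometry hc u).symm (constOp _ (adInner c (parallelTransport u)
      (leftInner c (parallelTransport u) η))), ?_, fun z hz => ?_⟩
    · refine (bijective_leftInner c (parallelTransport u)).1 ?_
      rw [leftInner_tder_parallelTransport hc, LinearIsometryEquiv.apply_symm_apply, meanOp_constOp,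
        adInner_inv_apply]
    · refine (inner_symm_constOp hc _ _ _).trans ?_
      rw [(tder_parallelTransport_eq_zero_iff hc u z).mp hz, inner_zero_right]
  · intro v w hv hw
    rw [groupMetric_eq, leftInner_tder_parallelTransport hc, leftInner_tder_parallelTransport hc,
      inner_adInner hc]
    have h1 := eq_symm_constOp_of_orthogonal hc (u := u) (ξ := v) fun z hz =>
      hv z ((tder_parallelTransport_eq_zero_iff hc u z).mpr hz)
    refine Eq.trans ?_ (congrArg (fun y : PathSpace c => inner ℝ y w) h1).symm
    rw [inner_symm_constOp]

end Submersions

/-! ### The orbit map is a Riemannian submersion -/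

section Projection

theorem metricFamily_congr {E : Type*} [NormedAddCommGroup E] [NormedSpace ℝ E]
    {M : Type*} [TopologicalSpace M] [ChartedSpace E M] (m : MetricFamily E M) {x y : M}
    (h : x = y) (v w : E) : m x v w = m y v w := by
  subst h; rfl

variable {E : Type*} [NormedAddCommGroup E] [NormedSpace ℝ E]
  {M : Type*} [TopologicalSpace M] [ChartedSpace E M]
  {F : Type*} [NormedAddCommGroup F] [NormedSpace ℝ F]
  {G : Type*} [TopologicalSpace G] [ChartedSpace F G] [Group G]
  [MulAction G M] [ContMDiffSMul 𝓘(ℝ, F) 𝓘(ℝ, E) ∞ G M]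

variable (F E) in
theorem contMDiff_smul_point (p : M) : ContMDiff 𝓘(ℝ, F) 𝓘(ℝ, E) ∞ fun a : G => a • p :=
  contMDiff_id.smul contMDiff_const

variable [FiniteDimensional ℝ F] [LieGroup 𝓘(ℝ, F) ∞ G]
  {c : InnerProductSpace.Core ℝ (GroupLieAlgebra 𝓘(ℝ, F) G)} {m : MetricFamily E M}

variable (c E) in
/-- The differential at `1` of `a ↦ a • p`. -/
noncomputable def infinitesimalAction (p : M) : WithInner c →L[ℝ] E :=
  (tder F E (fun a : G => a • p) 1).comp (innerEquiv c : WithInner c →L[ℝ] F)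

/-- By `b • p = a • (a⁻¹ b) • p`, everything at `a` is reduced to the identity, where the normal
homogeneous condition is given. -/
theorem tder_smul_point (hm : ∀ a : G, IsRiemannianIsometry m fun x : M => a • x) (p : M) (a : G)
    (v : F) : tder F E (fun a : G => a • p) a v =
      tder E E (fun x : M => a • x) p (infinitesimalAction E c p (leftInner c a v)) := by
  have h1 := tder_comp (g := fun x : M => a • x) (f := fun b : G => (a⁻¹ * b) • p) (x := a) (y := p)
    (E := F) (E' := E) (E'' := E) (by simp) ((hm a).mdifferentiable p)
    (((contMDiff_smul_point E F p).comp (contMDiff_left_mul (F := F) a⁻¹)).mdifferentiable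
      (by simp) a)
  have h2 := tder_comp (g := fun b : G => b • p) (f := fun b : G => a⁻¹ * b) (x := a) (y := 1)
    (E := F) (E' := F) (E'' := E) (by simp) ((contMDiff_smul_point E F p).mdifferentiable (by simp) 1)
    ((contMDiff_left_mul (F := F) a⁻¹).mdifferentiable (by simp) a)
  have h3 : (fun b : G => a • (a⁻¹ * b) • p) = fun b => b • p := by
    funext b; rw [smul_smul, mul_inv_cancel_left]
  rw [h3, h2] at h1
  refine (DFunLike.congr_fun h1 v).trans ?_
  simp [infinitesimalAction, leftInner]

/-- The projection `a ↦ a • p` is a Riemannian submersion for a normal homogeneous metric. -/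
theorem isRiemannianSubmersionAt_smul_point
    (hm : ∀ a : G, IsRiemannianIsometry m fun x : M => a • x) {p : M}
    (hn : IsNormalHomogeneousMetric m c p) (a : G) :
    IsRiemannianSubmersionAt (groupMetric c : MetricFamily F G) m (fun a : G => a • p) a := by
  obtain ⟨hs, hn⟩ := hn
  have hsurj : Function.Surjective (infinitesimalAction E c p) := by
    intro η
    obtain ⟨v, hv⟩ := hs η
    exact ⟨v, hv⟩
  have hiso : ∀ v w : WithInner c, (∀ z, infinitesimalAction E c p z = 0 → inner ℝ v z = 0) →
      (∀ z, infinitesimalAction E c p z = 0 → inner ℝ w z = 0) →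
      m p (infinitesimalAction E c p v) (infinitesimalAction E c p w) = inner ℝ v w := by
    intro v w hv hw
    exact (metricFamily_congr m (one_smul G p).symm _ _).trans (hn v w hv hw)
  have hbij := (hm a).bijective_tder p
  have hzero : ∀ v, tder F E (fun a : G => a • p) a v = 0 ↔
      infinitesimalAction E c p (leftInner c a v) = 0 := by
    intro v
    rw [tder_smul_point (c := c) hm]
    exact ⟨fun h => hbij.1 (h.trans (map_zero _).symm), fun h => by rw [h, map_zero]⟩
  have hhor : ∀ v, IsHorizontal (groupMetric c) E (fun a : G => a • p) a v ↔
      ∀ z, infinitesimalAction E c p z = 0 → inner ℝ (leftInner c a v) z = 0 := by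
    intro v
    constructor
    · intro h z hz
      obtain ⟨z, rfl⟩ := (bijective_leftInner c a).2 z
      exact h z ((hzero z).mpr hz)
    · exact fun h z hz => h _ ((hzero z).mp hz)
  constructor
  · intro η
    obtain ⟨η', rfl⟩ := hbij.2 η
    obtain ⟨w, rfl⟩ := hsurj η'
    -- Removing the component in the kernel leaves the image unchanged and makes the lift
    -- horizontal.
    let k := LinearMap.ker (infinitesimalAction E c p).toLinearMap
    obtain ⟨v, hv⟩ := (bijective_leftInner c a).2 (w - k.starProjection w)
    refine ⟨v, ?_, (hhor v).mpr fun z hz => ?_⟩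
    · have h0 : infinitesimalAction E c p (k.starProjection w) = 0 :=
        k.starProjection_apply_mem w
      rw [tder_smul_point (c := c) hm, hv, map_sub, h0, sub_zero]
    · rw [hv]
      exact Submodule.starProjection_inner_eq_zero w z hz
  · intro v w hv hw
    rw [tder_smul_point (c := c) hm, tder_smul_point (c := c) hm]
    exact ((hm a).2 p _ _).trans (hiso _ _ ((hhor v).mp hv) ((hhor w).mp hw))

end Projection

/-! ### Closedness of the right-trivialized normal bundle -/

section NormalBundle

variable {F : Type*} [NormedAddCommGroup F] [NormedSpace ℝ F] [FiniteDimensional ℝ F]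
  {G : Type*} [TopologicalSpace G] [ChartedSpace F G] [Group G] [LieGroup 𝓘(ℝ, F) ∞ G]
  {c : InnerProductSpace.Core ℝ (GroupLieAlgebra 𝓘(ℝ, F) G)}

variable (c) in
/-- The differential at the identity of the right translation by `a`. -/
noncomputable def rightInner (a : G) : WithInner c →L[ℝ] F :=
  (tder F F (fun x : G => x * a) 1).comp (innerEquiv c : WithInner c →L[ℝ] F)

variable (c) in
/-- The tangent space of `P` at `a`, translated to the identity from the right. -/
noncomputable def rightTangent (P : Set G) (a : G) : Submodule ℝ (WithInner c) :=
  Submodule.comap (rightInner c a).toLinearMap (tangentTo (E := F) P a : Submodule ℝ F)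

variable (c) in
/-- The normal bundle of `P`, trivialized by right translations. -/
def rightNormalBundle (P : Set G) : Set (G × WithInner c) :=
  {z | z.1 ∈ P ∧ ∀ w ∈ rightTangent c P z.1, inner ℝ z.2 w = 0}

theorem surjective_rightInner (a : G) : Function.Surjective (rightInner c a) := by
  have h := tder_comp (g := fun x : G => x * a) (f := fun x : G => x * a⁻¹) (x := a) (y := 1)
    (E := F) (E' := F) (E'' := F) (mul_inv_cancel a)
    ((contMDiff_right_mul a).mdifferentiable (by simp) _)
    ((contMDiff_right_mul a⁻¹).mdifferentiable (by simp) _)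
  simp only [inv_mul_cancel_right] at h
  rw [tder_id] at h
  refine Function.Surjective.comp (g := tder F F (fun x : G => x * a) 1) ?_ (innerEquiv c).surjective
  exact fun v => ⟨_, (DFunLike.congr_fun h v).symm⟩

/-- The normal bundle of a closed submanifold is closed. -/
theorem isClosed_rightNormalBundle {P : Set G} (hP : IsClosed P) {k : ℕ}
    (hk : IsEmbeddedSubmanifold F k P) : IsClosed (rightNormalBundle c P) := by
  refine isClosed_of_closure_subset ?_
  rintro ⟨a, η⟩ hcl
  have hfr := mem_closure_iff_frequently.mp hcl
  have haP : a ∈ P := by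
    rw [← hP.closure_eq, mem_closure_iff_frequently]
    have : Tendsto Prod.fst (𝓝 (a, η)) (𝓝 a) := continuous_fst.continuousAt
    exact this.frequently (hfr.mono fun z hz => hz.1)
  obtain ⟨W, hW, haW, f, hf, hfP, hsurj⟩ := hk a haP
  let A : G → WithInner c →L[ℝ] EuclideanSpace ℝ (Fin k) := fun b =>
    (tder F (EuclideanSpace ℝ (Fin k)) (fun x => f (x * b)) 1).comp
      (innerEquiv c : WithInner c →L[ℝ] F)
  have hfb : ∀ b ∈ W, MDifferentiableAt 𝓘(ℝ, F) 𝓘(ℝ, EuclideanSpace ℝ (Fin k)) f b := fun b hb =>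
    (hf.contMDiffAt (hW.mem_nhds hb)).mdifferentiableAt (by simp)
  have hAb : ∀ b ∈ W, ∀ w, A b w = tder F (EuclideanSpace ℝ (Fin k)) f b (rightInner c b w) :=
    fun b hb w => DFunLike.congr_fun (tder_comp (g := f) (f := fun x => x * b) (one_mul b) (hfb b hb)
      ((contMDiff_right_mul (F := F) b).mdifferentiable (by simp) 1)) (innerEquiv c w)
  have hA : ContinuousAt A a := by
    have h1 := contMDiffAt_tder_param (x₀ := a) (y₀ := (1 : G)) (E := F) (P := F)
      (h := fun b x => f (x * b)) (by
        refine ContMDiffAt.comp_of_eq (y := a) (hf.contMDiffAt (hW.mem_nhds haW))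
          ((contMDiff_snd.mul contMDiff_fst) _) (one_mul a))
    exact ((ContinuousLinearMap.compL ℝ (WithInner c) F (EuclideanSpace ℝ (Fin k))).flip
      (innerEquiv c : WithInner c →L[ℝ] F)).continuous.continuousAt.comp h1.continuousAt
  have hAa : Function.Surjective (A a) := by
    intro θ
    obtain ⟨v, hv⟩ := hsurj θ
    obtain ⟨w, rfl⟩ := surjective_rightInner (c := c) a v
    exact ⟨w, (hAb a haW w).trans hv⟩
  obtain ⟨R, hR⟩ := (A a).toLinearMap.exists_rightInverse_of_surjective
    (LinearMap.range_eq_top.mpr hAa)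
  let R' : EuclideanSpace ℝ (Fin k) →L[ℝ] WithInner c := LinearMap.toContinuousLinearMap R
  -- `R'` is a right inverse of `A a` only. Near `a` the composite `S b` is close to the identity,
  -- so `R' ∘ (S b)⁻¹` is a right inverse of `A b` and is continuous at `b = a`.
  let S : G → EuclideanSpace ℝ (Fin k) →L[ℝ] EuclideanSpace ℝ (Fin k) := fun b => (A b).comp R'
  have hS : ContinuousAt S a := hA.clm_comp continuousAt_const
  have hSa : S a = 1 := by
    ext1 θ
    exact LinearMap.congr_fun hR θ
  have hSu : ∀ᶠ b in 𝓝 a, IsUnit (S b) :=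
    hS.eventually_mem (Units.isOpen.mem_nhds (by rw [hSa]; exact isUnit_one))
  have hSi : ContinuousAt (fun b => Ring.inverse (S b)) a := by
    have h1 := NormedRing.inverse_continuousAt (1 : (EuclideanSpace ℝ (Fin k) →L[ℝ] EuclideanSpace ℝ (Fin k))ˣ)
    rw [Units.val_one, ← hSa] at h1
    exact h1.comp hS
  have htan : ∀ b ∈ W, b ∈ P → Function.Surjective (A b) → ∀ w, w ∈ rightTangent c P b ↔ A b w = 0 := by
    intro b hb hbP hs w
    have h1 := mem_tangentTo_iff_mfderiv_eq_zero hW hf hfP hb hbP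
      (fun θ => (hs θ).imp' (rightInner c b) fun w hw => (hAb b hb w).symm.trans hw)
      (rightInner c b w)
    exact h1.trans (by rw [hAb b hb w]; rfl)
  refine ⟨haP, fun w hw => ?_⟩
  have hw0 : A a w = 0 := (htan a haW haP hAa w).mp hw
  -- This extends the tangent vector `w` at `a` to a field, tangent to `P` at its points near `a`
  -- and continuous at `a`, so that orthogonality passes to the limit.
  let proj : G → WithInner c := fun b => w - R' (Ring.inverse (S b) (A b w))
  have hproj : ContinuousAt proj a := continuousAt_const.sub
    (R'.continuous.continuousAt.comp (hSi.clm_apply (hA.clm_apply continuousAt_const)))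
  have hproja : proj a = w := by simp [proj, hw0]
  have hin : ContinuousAt (fun z : G × WithInner c => inner ℝ z.2 (proj z.1)) (a, η) := by
    refine ContinuousAt.inner (𝕜 := ℝ) continuousAt_snd ?_
    exact ContinuousAt.comp (f := Prod.fst) (x := (a, η)) hproj continuousAt_fst
  have hfst : Tendsto Prod.fst (𝓝 (a, η)) (𝓝 a) := continuousAt_fst
  by_contra hne
  have hne' : inner ℝ η (proj a) ≠ 0 := by rwa [hproja]
  have hev := hin.eventually_ne hne'
  obtain ⟨⟨b, θ⟩, ⟨⟨hb, hbn⟩, hbW, hbu⟩, hb0⟩ := ((hfr.and_eventually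
    ((hfst.eventually (hW.mem_nhds haW)).and (hfst.eventually hSu))).and_eventually hev).exists
  have hSinv : ∀ θ, A b (R' (Ring.inverse (S b) θ)) = θ := fun θ =>
    DFunLike.congr_fun (Ring.mul_inverse_cancel (S b) hbu) θ
  refine hb0 (hbn _ ((htan b hbW hb (fun θ => ⟨_, hSinv θ⟩) _).mpr ?_))
  rw [map_sub, hSinv, sub_self]

end NormalBundle

/-! ### An abstract properness criterion -/

section Proper

variable {V W : Type*} [NormedAddCommGroup V] [NormedAddCommGroup W] [ProperSpace W]

/-- A properness criterion for the sum map on a subset of `V × V` which is parametrised by the sum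
and by a bounded parameter in a proper space. -/
theorem isProperMap_add_of_parametrization {B : Set (V × V)} {σ : V × W → V × V}
    (hσ : Continuous σ) {C : Set (V × W)} (hC : IsClosed C)
    (hadd : ∀ z, (σ z).1 + (σ z).2 = z.1) (hσB : ∀ z, σ z ∈ B ↔ z ∈ C)
    {κ : V × V → V × W} (hκ : ∀ z ∈ B, σ (κ z) = z) (hκ1 : ∀ z, (κ z).1 = z.1 + z.2)
    (hκ2 : ∀ z ∈ B, ‖(κ z).2‖ = ‖z.2‖) (r : ℝ) :
    IsProperMap (fun z : {z : V × V // z ∈ B ∧ ‖z.2‖ ≤ r} => z.1.1 + z.1.2) := by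
  refine isProperMap_iff_ultrafilter.mpr ⟨by fun_prop, fun 𝒰 y hy => ?_⟩
  -- The end points converge by assumption, and the bounded parameters converge because closed balls
  -- of `W` are compact. Continuity of `σ` then gives the limit in `V × V`.
  obtain ⟨η, -, hη⟩ := (isCompact_closedBall (0 : W) r).ultrafilter_le_nhds
    (𝒰.map fun z => (κ z.1).2) (by
      rw [le_principal_iff, Ultrafilter.mem_coe, Ultrafilter.mem_map]
      filter_upwards with z
      rw [mem_preimage, mem_closedBall_zero_iff, hκ2 z.1 z.2.1]
      exact z.2.2)
  have hcoord : Tendsto (fun z : {z : V × V // z ∈ B ∧ ‖z.2‖ ≤ r} => κ z.1) 𝒰 (𝓝 (y, η)) := by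
    rw [nhds_prod_eq]
    exact tendsto_prod_iff'.mpr ⟨hy.congr fun z => (hκ1 z.1).symm, hη⟩
  have hval : Tendsto (fun z : {z : V × V // z ∈ B ∧ ‖z.2‖ ≤ r} => z.1) 𝒰 (𝓝 (σ (y, η))) :=
    ((hσ.tendsto _).comp hcoord).congr fun z => hκ z.1 z.2.1
  have hmem : σ (y, η) ∈ B := by
    rw [hσB]
    refine hC.mem_of_tendsto hcoord (Eventually.of_forall fun z => ?_)
    rw [← hσB, hκ z.1 z.2.1]
    exact z.2.1
  have hnorm : ‖(σ (y, η)).2‖ ≤ r :=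
    le_of_tendsto ((continuous_snd.norm.tendsto _).comp hval) (Eventually.of_forall fun z => z.2.2)
  refine ⟨⟨σ (y, η), hmem, hnorm⟩, hadd _, ?_⟩
  rw [nhds_subtype_eq_comap]
  exact map_le_iff_le_comap.mp hval

end Proper

/-! ### Preimages under parallel transport are proper Fredholm -/

section ProperFredholm

theorem norm_constOp {W : Type*} [NormedAddCommGroup W] [InnerProductSpace ℝ W] [CompleteSpace W]
    (η : W) : ‖constOp W η‖ = ‖η‖ := by
  rw [norm_eq_sqrt_real_inner, norm_eq_sqrt_real_inner, inner_constOp, meanOp_constOp]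

variable {F : Type*} [NormedAddCommGroup F] [NormedSpace ℝ F] [FiniteDimensional ℝ F]
  {G : Type*} [TopologicalSpace G] [ChartedSpace F G] [Group G] [LieGroup 𝓘(ℝ, F) ∞ G]
  {c : InnerProductSpace.Core ℝ (GroupLieAlgebra 𝓘(ℝ, F) G)} (hc : IsAdInvariant c)

theorem transportIsometry_eq_of_eqOn {u v : PathSpace c} {w : PathSpace c}
    (h : EqOn (transportPath w) (fun t => transportPath v t * transportPath u t) (Icc 0 1))
    (x : PathSpace c) :
    transportIsometry hc w x = transportIsometry hc v (transportIsometry hc u x) := by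
  refine L2Path.ext_ae ?_
  filter_upwards [coeFn_adIsometry hc (continuousOn_transportPath hc w) x,
    coeFn_adIsometry hc (continuousOn_transportPath hc u) x,
    coeFn_adIsometry hc (continuousOn_transportPath hc v) (transportIsometry hc u x),
    ae_restrict_mem measurableSet_Icc] with t h1 h2 h3 ht
  refine h1.trans (Eq.trans ?_ h3.symm)
  rw [h ht, adInner_mul]
  exact congrArg _ h2.symm

variable [T2Space G] [CompactSpace G]

/-- The difference between the end point `y` and the foot point of a normal vector whose constant
value, after transport, is `η`. -/
noncomputable def normalShift (z : PathSpace c × WithInner c) : PathSpace c :=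
  (transportIsometry hc z.1).symm (transportIsometry hc (constOp _ z.2) (constOp _ z.2))

/-- The normal vector with end point `y` and constant value `η` after transport. -/
noncomputable def normalParam (z : PathSpace c × WithInner c) : PathSpace c × PathSpace c :=
  (z.1 - normalShift hc z, normalShift hc z)

/-- The end point and the constant value after transport of a normal vector. -/
noncomputable def normalCoord (z : PathSpace c × PathSpace c) : PathSpace c × WithInner c :=
  (z.1 + z.2, meanOp _ (transportIsometry hc z.1 z.2))

theorem contDiff_mulOp (W W' : Type*) [NormedAddCommGroup W] [NormedSpace ℝ W]
    [NormedAddCommGroup W'] [NormedSpace ℝ W'] :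
    ContDiff ℝ ∞ fun A : C(Icc (0 : ℝ) 1, W →L[ℝ] W') => mulOp W W' A := by
  fun_prop

theorem contDiff_normalParam : ContDiff ℝ ∞ (normalParam hc) := by
  have h : ContDiff ℝ ∞ (normalShift hc) := by
    have hκ : ContDiff ℝ ∞ fun z : PathSpace c × WithInner c => constOp (WithInner c) z.2 :=
      (constOp (WithInner c)).contDiff.comp contDiff_snd
    have h1 : ContDiff ℝ ∞ fun z : PathSpace c × WithInner c =>
        mulOp (WithInner c) (WithInner c) (transportAd hc (constOp _ z.2)) :=
      (contDiff_mulOp _ _).comp ((contDiff_transportAd hc).1.comp hκ)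
    have h2 : ContDiff ℝ ∞ fun z : PathSpace c × WithInner c =>
        mulOp (WithInner c) (WithInner c) (transportAdInv hc z.1) :=
      (contDiff_mulOp _ _).comp ((contDiff_transportAd hc).2.comp contDiff_fst)
    exact h2.clm_apply (h1.clm_apply hκ)
  exact (contDiff_fst.sub h).prodMk h

theorem contDiff_normalCoord : ContDiff ℝ ∞ (normalCoord hc) := by
  have h2 : ContDiff ℝ ∞ fun z : PathSpace c × PathSpace c =>
      mulOp (WithInner c) (WithInner c) (transportAd hc z.1) :=
    (contDiff_mulOp _ _).comp ((contDiff_transportAd hc).1.comp contDiff_fst)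
  exact (contDiff_fst.add contDiff_snd).prodMk
    ((meanOp (WithInner c)).contDiff.comp (h2.clm_apply contDiff_snd))

/-- Both claims express `E_y = E_κ E_x`, with `x` the reconstructed foot point and `κ` the constant
path of value `η`. The shift formula from `y` to `x` and that from `κ` to `0` involve the same
control, which can be eliminated. -/
theorem normalParam_spec (y : PathSpace c) (η : WithInner c) :
    normalShift hc (y, η) =
      (transportIsometry hc (normalParam hc (y, η)).1).symm (constOp _ η) ∧
    parallelTransport (normalParam hc (y, η)).1 =
      (parallelTransport (constOp (WithInner c) η))⁻¹ * parallelTransport y := by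
  set κ := constOp (WithInner c) η
  set x := (normalParam hc (y, η)).1
  have hx : transportIsometry hc y (x - y) = transportIsometry hc κ (0 - κ) := by
    have : x - y = -(transportIsometry hc y).symm (transportIsometry hc κ κ) := by
      simp only [x, normalParam, normalShift, κ]
      abel
    rw [this, map_neg, LinearIsometryEquiv.apply_symm_apply, zero_sub, map_neg]
  have h1 := transportPath_mul hc y x
  rw [hx] at h1
  have h2 := transportPath_mul hc κ 0
  have h3 : EqOn (transportPath y) (fun t => transportPath κ t * transportPath x t) (Icc 0 1) := by
    intro t ht
    have h4 := h2 ht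
    rw [transportPath_zero_control hc ht] at h4
    have h5 := h1 ht
    simp only at h4 h5 ⊢
    rw [h5, eq_inv_of_mul_eq_one_left h4.symm, mul_inv_cancel_left]
  constructor
  · rw [LinearIsometryEquiv.eq_symm_apply]
    refine (transportIsometry hc κ).injective ?_
    rw [← transportIsometry_eq_of_eqOn hc h3]
    exact LinearIsometryEquiv.apply_symm_apply _ _
  · exact eq_inv_mul_of_mul_eq (h3 ⟨zero_le_one, le_rfl⟩).symm

/-- For horizontal `ξ` the shift from `x` to `x + ξ` is the constant path `κ`, so `T_{x+ξ} ξ = T_κ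
T_x ξ = T_κ κ`. Solving for `ξ` gives the formula defining `normalShift`. -/
theorem normalParam_normalCoord {x ξ : PathSpace c} {η : WithInner c}
    (hξ : ξ = (transportIsometry hc x).symm (constOp _ η)) :
    normalParam hc (normalCoord hc (x, ξ)) = (x, ξ) ∧ (normalCoord hc (x, ξ)).2 = η := by
  have hT : transportIsometry hc x ξ = constOp _ η := by
    rw [hξ, LinearIsometryEquiv.apply_symm_apply]
  have hη : (normalCoord hc (x, ξ)).2 = η := by
    simp only [normalCoord, hT, meanOp_constOp]
  refine ⟨?_, hη⟩
  have h1 := transportPath_mul hc x (x + ξ)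
  rw [add_sub_cancel_left, hT] at h1
  have h2 : normalShift hc (normalCoord hc (x, ξ)) = ξ := by
    rw [normalShift, hη, LinearIsometryEquiv.symm_apply_eq, ← hT]
    have := transportIsometry_eq_of_eqOn hc h1 ξ
    rw [hT] at this ⊢
    exact this.symm
  rw [normalParam, h2]
  simp [normalCoord]

variable {P : Set G} {k : ℕ} (hk : IsEmbeddedSubmanifold F k P)

include hk hc in
theorem mem_tangentTo_preimage_parallelTransport_iff {x : PathSpace c}
    (hx : parallelTransport x ∈ P) (v : PathSpace c) :
    v ∈ tangentTo (E := PathSpace c) (parallelTransport ⁻¹' P) x ↔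
      meanOp _ (transportIsometry hc x v) ∈ rightTangent c P (parallelTransport x) := by
  have h := mem_tangentTo_preimage_iff isOpen_univ (contMDiff_parallelTransport hc).contMDiffOn hk
    (mem_univ x) hx (isRiemannianSubmersionAt_parallelTransport hc x).surjective v
  rw [univ_inter] at h
  refine h.trans ?_
  rw [tder_parallelTransport hc]
  rfl

include hk in
theorem mem_normalBundle_iff {x ξ : PathSpace c} :
    (x, ξ) ∈ normalBundle (parallelTransport (c := c) ⁻¹' P) ↔
      ∃ η, (parallelTransport x, η) ∈ rightNormalBundle c P ∧
        ξ = (transportIsometry hc x).symm (constOp _ η) := by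
  constructor
  · rintro ⟨hx, hξ⟩
    have hT := mem_tangentTo_preimage_parallelTransport_iff hc hk hx
    have h1 := eq_symm_constOp_of_orthogonal hc (u := x) (ξ := ξ) fun v hv =>
      hξ v ((hT v).mpr (by rw [hv]; exact zero_mem _))
    refine ⟨_, ⟨hx, fun w hw => ?_⟩, h1⟩
    have h2 : meanOp _ (transportIsometry hc x ((transportIsometry hc x).symm (constOp _ w))) = w := by
      rw [LinearIsometryEquiv.apply_symm_apply, meanOp_constOp]
    have h3 : inner ℝ ξ ((transportIsometry hc x).symm (constOp _ w)) = 0 :=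
      hξ _ ((hT _).mpr (by rw [h2]; exact hw))
    rw [h1, inner_symm_constOp, h2] at h3
    exact h3
  · rintro ⟨η, ⟨hx, hη⟩, rfl⟩
    refine ⟨hx, fun v hv => ?_⟩
    have hv' := (mem_tangentTo_preimage_parallelTransport_iff hc hk hx v).mp hv
    exact (inner_symm_constOp hc x η v).trans (hη _ hv')

include hk in
theorem normalParam_normalCoord_of_mem {z : PathSpace c × PathSpace c}
    (hz : z ∈ normalBundle (parallelTransport (c := c) ⁻¹' P)) :
    normalParam hc (normalCoord hc z) = z ∧ ‖(normalCoord hc z).2‖ = ‖z.2‖ := by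
  obtain ⟨η, -, hη⟩ := (mem_normalBundle_iff hc hk).mp hz
  obtain ⟨h1, h2⟩ := normalParam_normalCoord hc hη
  refine ⟨h1, ?_⟩
  rw [h2, hη, LinearIsometryEquiv.norm_map, norm_constOp]

include hk in
theorem normalParam_mem_iff (y : PathSpace c) (η : WithInner c) :
    normalParam hc (y, η) ∈ normalBundle (parallelTransport (c := c) ⁻¹' P) ↔
      ((parallelTransport (constOp (WithInner c) η))⁻¹ * parallelTransport y, η) ∈
        rightNormalBundle c P := by
  obtain ⟨h1, h2⟩ := normalParam_spec hc y η
  rw [← h2]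
  refine (mem_normalBundle_iff hc hk).trans ⟨?_, fun h => ⟨η, h, h1⟩⟩
  rintro ⟨η', h3, h4⟩
  have h5 := (transportIsometry hc _).symm.injective (h1.symm.trans h4)
  have h6 := congrArg (meanOp (WithInner c)) h5
  rw [meanOp_constOp, meanOp_constOp] at h6
  subst h6
  exact h3

include hc hk in
theorem isProperMap_endPoint (hP : IsClosed P) (r : ℝ) : IsProperMap
    (fun z : {z : PathSpace c × PathSpace c //
      z ∈ normalBundle (parallelTransport (c := c) ⁻¹' P) ∧ ‖z.2‖ ≤ r} => z.1.1 + z.1.2) := by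
  have hG : IsTopologicalGroup G := topologicalGroup_of_lieGroup 𝓘(ℝ, F) ∞
  have hcont : Continuous fun z : PathSpace c × WithInner c =>
      ((parallelTransport (constOp (WithInner c) z.2))⁻¹ * parallelTransport z.1, z.2) := by
    have hΦ := (contMDiff_parallelTransport hc).continuous
    exact (((hΦ.comp ((constOp (WithInner c)).continuous.comp continuous_snd)).inv).mul
      (hΦ.comp continuous_fst)).prodMk continuous_snd
  exact isProperMap_add_of_parametrization (contDiff_normalParam hc).continuous
    ((isClosed_rightNormalBundle hP hk).preimage hcont)
    (fun z => by simp [normalParam]) (fun z => normalParam_mem_iff hc hk z.1 z.2)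
    (fun z hz => (normalParam_normalCoord_of_mem hc hk hz).1) (fun _ => rfl)
    (fun z hz => (normalParam_normalCoord_of_mem hc hk hz).2) r

/-- Needed to describe the tangent spaces of the fibres of `Φ`. -/
theorem isEmbeddedSubmanifold_singleton {E : Type*} [NormedAddCommGroup E] [NormedSpace ℝ E]
    [FiniteDimensional ℝ E] {X : Type*} [TopologicalSpace X] [ChartedSpace E X]
    [IsManifold 𝓘(ℝ, E) ∞ X] (a : X) :
    IsEmbeddedSubmanifold E (Module.finrank ℝ E) ({a} : Set X) := by
  rintro _ rfl
  rename_i a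
  set φ := extChartAt 𝓘(ℝ, E) a
  refine ⟨φ.source, isOpen_extChartAt_source a, mem_extChartAt_source a,
    fun x => toEuclidean (φ x - φ a), ?_, fun x hx => ?_, ?_⟩
  · have h1 : ContDiff ℝ ∞ fun v : E => toEuclidean (v - φ a) :=
      toEuclidean.contDiff.comp (contDiff_id.sub contDiff_const)
    have h2 : ContMDiffOn 𝓘(ℝ, E) 𝓘(ℝ, E) ∞ φ φ.source := by
      rw [extChartAt_source]; exact contMDiffOn_extChartAt
    exact h1.contMDiff.comp_contMDiffOn h2
  · rw [EmbeddingLike.map_eq_zero_iff, sub_eq_zero]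
    exact ⟨fun h => by rw [h], fun h => φ.injOn hx (mem_extChartAt_source a) h⟩
  · have h3 : HasFDerivAt (fun v : E => toEuclidean (v - φ a))
        (toEuclidean : E ≃L[ℝ] EuclideanSpace ℝ (Fin (Module.finrank ℝ E))).toContinuousLinearMap
        (φ a) :=
      (toEuclidean : E ≃L[ℝ] EuclideanSpace ℝ (Fin (Module.finrank ℝ E))).hasFDerivAt.comp (φ a)
        ((hasFDerivAt_id (φ a)).sub_const (φ a))
    have h4 := tder_comp (g := fun v : E => toEuclidean (v - φ a)) (f := φ) (x := a) (E := E) (E' := E)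
      rfl h3.differentiableAt.mdifferentiableAt (mdifferentiableAt_extChartAt (mem_chart_source E a))
    rw [tder_extChartAt, ContinuousLinearMap.comp_id, tder_eq_fderiv, h3.fderiv] at h4
    have h5 : Function.Surjective
        (tder E (EuclideanSpace ℝ (Fin (Module.finrank ℝ E))) (fun z => toEuclidean (φ z - φ a)) a) := by
      rw [h4]
      exact toEuclidean.surjective
    exact h5

include hc hk in
theorem isFredholm_endPoint {z : PathSpace c × PathSpace c}
    (hz : z ∈ normalBundle (parallelTransport (c := c) ⁻¹' P)) :
    (endPointDeriv (parallelTransport (c := c) ⁻¹' P) z).IsFredholm := by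
  obtain ⟨y, η, hzy⟩ : ∃ y η, normalCoord hc z = (y, η) := ⟨_, _, rfl⟩
  have hσz : normalParam hc (y, η) = z := by rw [← hzy, (normalParam_normalCoord_of_mem hc hk hz).1]
  set D := fderiv ℝ (normalParam hc) (y, η)
  have hD : HasFDerivAt (normalParam hc) D (y, η) :=
    ((contDiff_normalParam hc).differentiable (by simp) _).hasFDerivAt
  let D' := fderiv ℝ (normalCoord hc) z
  have hD' : HasFDerivAt (normalCoord hc) D' z :=
    ((contDiff_normalCoord hc).differentiable (by simp) _).hasFDerivAt
  let T : PathSpace c →L[ℝ] PathSpace c := (transportIsometry hc y : PathSpace c →L[ℝ] PathSpace c)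
  -- The orthogonal projection onto the horizontal space of `Φ` at the end point `y`; it has finite
  -- rank, and `v - Q v` is tangent to the fibre of `Φ` through `y`.
  let Q : PathSpace c →L[ℝ] PathSpace c :=
    (((transportIsometry hc y).symm : PathSpace c →L[ℝ] PathSpace c).comp (constOp (WithInner c))).comp
      ((meanOp (WithInner c)).comp T)
  have hQ : FiniteDimensional ℝ Q.range :=
    Submodule.finiteDimensional_of_le (S₂ := (((transportIsometry hc y).symm :
      PathSpace c →L[ℝ] PathSpace c).comp (constOp (WithInner c))).range)
      (by rintro _ ⟨v, rfl⟩; exact ⟨meanOp _ (T v), rfl⟩)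
  have hfst : ∀ v, (D' v).1 = v.1 + v.2 := by
    intro v
    have h1 := (ContinuousLinearMap.fst ℝ (PathSpace c) (WithInner c)).hasFDerivAt.comp z hD'
    have h2 := (ContinuousLinearMap.fst ℝ (PathSpace c) (PathSpace c) +
      ContinuousLinearMap.snd ℝ (PathSpace c) (PathSpace c)).hasFDerivAt (x := z)
    exact DFunLike.congr_fun (h1.unique h2) v
  refine isFredholm_add_of_parametrization _ D Q hQ (fun v hv => ⟨(D' v).2, ?_⟩) (fun v => ?_)
    fun v => ?_
  -- `normalParam ∘ normalCoord` is the identity along curves in the normal bundle, so its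
  -- differential fixes their velocities.
  · have hle : normalBundleTangent (parallelTransport (c := c) ⁻¹' P) z ≤
        LinearMap.eqLocus (LinearMap.id : PathSpace c × PathSpace c →ₗ[ℝ] _) (D.comp D').toLinearMap := by
      refine Submodule.span_le.mpr ?_
      rintro _ ⟨γ, hγ, hγ0, hγB, rfl⟩
      have hγd : HasFDerivAt γ (fderiv ℝ γ 0) 0 :=
        ((contMDiffAt_iff_contDiffAt.mp hγ).differentiableAt (by simp)).hasFDerivAt
      have h1 : HasFDerivAt (normalCoord hc) D' (γ 0) := by rw [hγ0]; exact hD'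
      have h2 : HasFDerivAt (normalParam hc) D (normalCoord hc (γ 0)) := by rw [hγ0, hzy]; exact hD
      have h3 := h2.comp 0 (h1.comp 0 hγd)
      have h4 : γ =ᶠ[𝓝 0] normalParam hc ∘ normalCoord hc ∘ γ :=
        hγB.mono fun t ht => (normalParam_normalCoord_of_mem hc hk ht).1.symm
      have h5 := (h3.congr_of_eventuallyEq h4).unique hγd
      have h6 : (mfderiv 𝓘(ℝ, ℝ) 𝓘(ℝ, PathSpace c × PathSpace c) γ 0 : ℝ →L[ℝ] _) = fderiv ℝ γ 0 :=
        mfderiv_eq_fderiv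
      exact ((DFunLike.congr_fun h6 1).trans (DFunLike.congr_fun h5 1).symm).trans
        (congrArg (fun v => D (D' v)) (DFunLike.congr_fun h6 1).symm)
    rw [← hfst]
    exact LinearMap.mem_eqLocus.mp (hle hv)
  -- Whether `(y, η)` parametrizes a normal vector depends only on `Φ(y)` and `η`. Moving `y` in its
  -- fibre with `η` fixed therefore stays in the normal bundle.
  · have hle : (tangentTo (E := PathSpace c) (parallelTransport (c := c) ⁻¹' {parallelTransport y}) y :
        Submodule ℝ (PathSpace c)) ≤ (normalBundleTangent (parallelTransport (c := c) ⁻¹' P) z).comap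
          (D.comp (ContinuousLinearMap.inl ℝ (PathSpace c) (WithInner c))).toLinearMap := by
      refine Submodule.span_le.mpr ?_
      rintro _ ⟨γ, hγ, hγ0, hγB, rfl⟩
      have hγs := contMDiffAt_iff_contDiffAt.mp hγ
      have hγd : HasFDerivAt γ (fderiv ℝ γ 0) 0 := (hγs.differentiableAt (by simp)).hasFDerivAt
      have hβ0 : normalParam hc (γ 0, η) = z := by rw [hγ0, hσz]
      have hβ : ContDiffAt ℝ ∞ (fun t => normalParam hc (γ t, η)) 0 :=
        (contDiff_normalParam hc).contDiffAt.comp 0 (hγs.prodMk contDiffAt_const)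
      have hmem := velocity_mem_tangentTo (N := normalBundle (parallelTransport (c := c) ⁻¹' P))
        hβ.contMDiffAt hβ0 (hγB.mono fun t ht => by
          have ht' : parallelTransport (γ t) = parallelTransport y := ht
          rw [normalParam_mem_iff hc hk, ht', ← normalParam_mem_iff hc hk, hσz]
          exact hz)
      have h2 : HasFDerivAt (normalParam hc) D (γ 0, η) := by rw [hγ0]; exact hD
      have h3 := HasFDerivAt.comp (f := fun t => (γ t, η)) (0 : ℝ) h2
        (hγd.prodMk (hasFDerivAt_const η (0 : ℝ)))
      have h6 : (mfderiv 𝓘(ℝ, ℝ) 𝓘(ℝ, PathSpace c) γ 0 : ℝ →L[ℝ] _) = fderiv ℝ γ 0 :=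
        mfderiv_eq_fderiv
      have h7 := (mfderiv_eq_fderiv (𝕜 := ℝ) (f := fun t => normalParam hc (γ t, η)) (x := (0 : ℝ)))
      have h8 := DFunLike.congr_fun (h7.trans h3.fderiv) (1 : ℝ)
      have h9 : D (fderiv ℝ γ 0 1, 0) ∈ normalBundleTangent (parallelTransport (c := c) ⁻¹' P) z := by
        refine (congrArg (· ∈ normalBundleTangent (parallelTransport (c := c) ⁻¹' P) z) h8).mp hmem
      exact (congrArg (fun w => D (w, 0) ∈ normalBundleTangent (parallelTransport (c := c) ⁻¹' P) z)
        (DFunLike.congr_fun h6 1)).mpr h9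
    refine hle ?_
    refine (mem_tangentTo_preimage_parallelTransport_iff hc
      (isEmbeddedSubmanifold_singleton (parallelTransport y)) rfl _).mpr ?_
    have h0 : meanOp _ (transportIsometry hc y (v - Q v)) = 0 := by
      rw [map_sub, map_sub, sub_eq_zero]
      have : transportIsometry hc y (Q v) = constOp _ (meanOp _ (T v)) :=
        LinearIsometryEquiv.apply_symm_apply _ _
      rw [this, meanOp_constOp]
      rfl
    exact (congrArg (· ∈ rightTangent c {parallelTransport y} (parallelTransport y)) h0).mpr
      (zero_mem _)
  · have h1 := (ContinuousLinearMap.fst ℝ (PathSpace c) (PathSpace c) +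
      ContinuousLinearMap.snd ℝ (PathSpace c) (PathSpace c)).hasFDerivAt.comp (y, η) hD
    have h2 : (ContinuousLinearMap.fst ℝ (PathSpace c) (PathSpace c) +
      ContinuousLinearMap.snd ℝ (PathSpace c) (PathSpace c)) ∘ normalParam hc = Prod.fst := by
      funext z
      simp [normalParam]
    rw [h2] at h1
    exact DFunLike.congr_fun (h1.unique hasFDerivAt_fst) (v, 0)

include hc hk in
/-- The preimage of a closed submanifold under the parallel transport map is proper Fredholm. -/
theorem isPFSubmanifold_preimage_parallelTransport (hP : IsClosed P) :
    IsPFSubmanifold (parallelTransport (c := c) ⁻¹' P) where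
  submanifold := by
    have h := hk.preimage isOpen_univ (contMDiff_parallelTransport hc).contMDiffOn
      fun x _ => (isRiemannianSubmersionAt_parallelTransport hc x).surjective
    rw [univ_inter] at h
    exact ⟨k, h⟩
  proper := isProperMap_endPoint hc hk hP
  fredholm _ hz := isFredholm_endPoint hc hk hz

end ProperFredholm

/-! ### Isometries, gauge transformations and orbits -/

section Symmetries

theorem image_eq_of_bijective {X : Type*} {ν : X → X} (hν : Function.Bijective ν) {A : Set X}
    (h : ∀ x, ν x ∈ A ↔ x ∈ A) : ν '' A = A := by
  refine Subset.antisymm ?_ fun x hx => ?_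
  · rintro _ ⟨x, hx, rfl⟩
    exact (h x).mpr hx
  · obtain ⟨y, rfl⟩ := hν.2 x
    exact ⟨y, (h y).mp hx, rfl⟩

theorem ParallelTransport.IsRiemannianIsometry.bijective {E : Type*} [NormedAddCommGroup E]
    [NormedSpace ℝ E] {X : Type*} [TopologicalSpace X] [ChartedSpace E X] {m : MetricFamily E X}
    {ν : X → X} (h : IsRiemannianIsometry m ν) : Function.Bijective ν := by
  obtain ⟨⟨φ, rfl⟩, -⟩ := h
  exact φ.bijective

/-- Affine isometries of a Hilbert space. -/
theorem isRiemannianIsometry_sub_const {V : Type*} [NormedAddCommGroup V] [InnerProductSpace ℝ V]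
    (L : V ≃ₗᵢ[ℝ] V) (w : V) : IsRiemannianIsometry (flatMetric V) fun v => L v - w := by
  refine ⟨⟨⟨⟨fun v => L v - w, fun v => L.symm (v + w), fun v => by simp, fun v => by simp⟩,
    (L.contDiff.sub contDiff_const).contMDiff,
    (L.symm.contDiff.comp (contDiff_id.add contDiff_const)).contMDiff⟩, rfl⟩, fun x v v' => ?_⟩
  have h1 : HasFDerivAt (fun v => L v - w) (L : V →L[ℝ] V) x :=
    (L : V →L[ℝ] V).hasFDerivAt.sub_const w
  have h2 : tder V V (fun v => L v - w) x = (L : V →L[ℝ] V) := by rw [tder_eq_fderiv, h1.fderiv]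
  have h3 : ∀ v, tder V V (fun v => L v - w) x v = L v := fun v => by rw [h2]; rfl
  exact (congrArg₂ (fun a b : V => inner ℝ a b) (h3 v) (h3 v')).trans (L.inner_map_map v v')

variable {F : Type*} [NormedAddCommGroup F] [NormedSpace ℝ F] [FiniteDimensional ℝ F]
  {G : Type*} [TopologicalSpace G] [ChartedSpace F G] [Group G]
  {c : InnerProductSpace.Core ℝ (GroupLieAlgebra 𝓘(ℝ, F) G)} (hc : IsAdInvariant c)

theorem isGaugeTransform_iff {g : ℝ → G} {u v : PathSpace c} :
    IsGaugeTransform g u v ↔ ∃ w : PathSpace c, HasLogDeriv g w ∧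
      ∀ᵐ t ∂(volume.restrict (Icc (0 : ℝ) 1)),
        v t = adInner c (g t) (u t) - adInner c (g t) (w t) := by
  refine exists_congr fun w => and_congr_right fun _ => eventually_congr ?_
  filter_upwards with t
  have h : ∀ x : WithInner c, (Ad (g t) (innerEquiv c x : GroupLieAlgebra 𝓘(ℝ, F) G) : F) =
    innerEquiv c (adInner c (g t) x) := fun x => rfl
  constructor
  · intro h1
    refine (innerEquiv c).injective (Eq.trans h1 ?_)
    rw [map_sub]
    rfl
  · intro h1
    refine Eq.trans (congrArg (innerEquiv c) h1) ?_
    rw [map_sub]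
    rfl

variable [LieGroup 𝓘(ℝ, F) ∞ G]

include hc in
-- In left trivializations the differential is `Ad(b₂)`: the left factor cancels, and invariance of
-- `c` does the rest.
theorem isRiemannianIsometry_twoSided (b₁ b₂ : G) :
    IsRiemannianIsometry (groupMetric c : MetricFamily F G) fun a => b₁ * a * b₂⁻¹ := by
  have hs : ∀ b₁ b₂ : G, ContMDiff 𝓘(ℝ, F) 𝓘(ℝ, F) ∞ fun a : G => b₁ * a * b₂ := fun b₁ b₂ =>
    (contMDiff_right_mul b₂).comp (contMDiff_left_mul b₁)
  refine ⟨⟨⟨⟨fun a => b₁ * a * b₂⁻¹, fun a => b₁⁻¹ * a * b₂, fun a => by group, fun a => by group⟩,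
    hs b₁ b₂⁻¹, hs b₁⁻¹ b₂⟩, rfl⟩, fun a v w => ?_⟩
  have key : ∀ v, leftInner c (b₁ * a * b₂⁻¹) (tder F F (fun a => b₁ * a * b₂⁻¹) a v) =
      adInner c b₂ (leftInner c a v) := by
    intro v
    have h1 := tder_comp (g := fun x : G => (b₁ * a * b₂⁻¹)⁻¹ * x) (f := fun x : G => b₁ * x * b₂⁻¹)
      (x := a) (E := F) (E' := F) (E'' := F) rfl
      ((contMDiff_left_mul (F := F) _).mdifferentiable (by simp) _)
      ((hs b₁ b₂⁻¹).mdifferentiable (by simp) _)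
    have h2 := tder_comp (g := fun x : G => b₂ * x * b₂⁻¹) (f := fun x : G => a⁻¹ * x)
      (x := a) (y := 1) (E := F) (E' := F) (E'' := F) (inv_mul_cancel a)
      ((hs b₂ b₂⁻¹).mdifferentiable (by simp) _)
      ((contMDiff_left_mul (F := F) _).mdifferentiable (by simp) _)
    have h3 : (fun x : G => (b₁ * a * b₂⁻¹)⁻¹ * (b₁ * x * b₂⁻¹)) =
        fun x => b₂ * (a⁻¹ * x) * b₂⁻¹ := by
      funext x
      group
    rw [h3, h2] at h1
    have h4 := congrArg (innerEquiv c).symm (DFunLike.congr_fun h1 v)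
    refine Eq.trans h4.symm ?_
    simp [adInner, leftInner, adModel]
  refine (groupMetric_eq _ _ _).trans ?_
  refine (congrArg₂ (fun a b : WithInner c => inner ℝ a b) (key v) (key w)).trans ?_
  rw [inner_adInner hc]
  rfl

include hc in
/-- The gauge transformation with initial value `a` which carries `u` to `v`. -/
theorem exists_gauge (u v : PathSpace c) (a : G) : ∃ w : PathSpace c,
    HasLogDeriv (fun t => (transportPath v t)⁻¹ * (a * transportPath u t)) w ∧
    ∀ᵐ t ∂(volume.restrict (Icc (0 : ℝ) 1)),
      v t = adInner c ((transportPath v t)⁻¹ * (a * transportPath u t)) (u t) -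
        adInner c ((transportPath v t)⁻¹ * (a * transportPath u t)) (w t) := by
  have hu : HasLogDeriv (fun t => a * transportPath u t) u :=
    (hasLogDeriv_transportPath hc u).left_mul a
  let w₀ : PathSpace c := -transportIsometry hc v v
  have hw₀ : ∀ᵐ t ∂(volume.restrict (Icc (0 : ℝ) 1)),
      w₀ t = -adInner c (transportPath v t) (v t) := by
    filter_upwards [Lp.coeFn_neg (transportIsometry hc v v),
      coeFn_adIsometry hc (continuousOn_transportPath hc v) v] with t h1 h2
    exact h1.trans (congrArg Neg.neg h2)
  -- This is the logarithmic derivative of `E_v⁻¹ (a E_u)` by the product rule, `w₀` being that of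
  -- `E_v⁻¹`.
  let w : PathSpace c := (adIsometry hc hu.1).symm w₀ + u
  have hw : ∀ᵐ t ∂(volume.restrict (Icc (0 : ℝ) 1)),
      w t = adInner c (a * transportPath u t)⁻¹ (w₀ t) + u t := by
    filter_upwards [Lp.coeFn_add ((adIsometry hc hu.1).symm w₀) u,
      coeFn_adIsometry_symm hc hu.1 w₀] with t h1 h2
    exact h1.trans (congrArg (· + u t) h2)
  refine ⟨w, HasLogDeriv.mul ((hasLogDeriv_transportPath hc v).inv hw₀) hu hw, ?_⟩
  filter_upwards [hw₀, hw] with t h1 h2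
  rw [h2, h1, map_add, sub_add_cancel_right, map_neg, map_neg, neg_neg, adInner_mul]
  simp only [ContinuousLinearMap.comp_apply, adInner_apply_inv, adInner_inv_apply]

include hc in
-- The path starts at `a` and ends at `Φ(v)⁻¹ a Φ(u)`; the hypothesis on `p` says precisely that
-- this end value fixes `p`.
theorem gauge_mem_pathGroup {X : Type*} [MulAction G X] {p : X} {H : Subgroup G} {u v : PathSpace c} {a : G}
    (ha : a ∈ H) (haG : a ∈ identityComponent F G)
    (hp : (a * parallelTransport u) • p = parallelTransport v • p) :
    (fun t => (transportPath v t)⁻¹ * (a * transportPath u t)) ∈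
      pathGroup c (identityComponent F G)
        (H.prod (isotropy (identityComponent F G) p)) := by
  obtain ⟨w, hw, -⟩ := exists_gauge hc u v a
  have hmem : ∀ t ∈ Icc (0 : ℝ) 1, (transportPath v t)⁻¹ * (a * transportPath u t) ∈
      identityComponent F G := fun t ht =>
    mul_mem (inv_mem (transportPath_mem hc v ht)) (mul_mem haG (transportPath_mem hc u ht))
  refine ⟨⟨w, hw⟩, hmem, ?_, hmem 1 ⟨zero_le_one, le_rfl⟩, ?_⟩
  · simpa [transportPath_zero hc] using ha
  · refine MulAction.mem_stabilizer_iff.mpr ?_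
    rw [mul_smul, inv_smul_eq_iff]
    exact hp

variable [T2Space G] [CompactSpace G]

include hc in
theorem parallelTransport_gauge {g : ℝ → G} {u v : PathSpace c} (h : IsGaugeTransform g u v) :
    parallelTransport v = g 0 * parallelTransport u * (g 1)⁻¹ := by
  obtain ⟨w, hw, hv⟩ := isGaugeTransform_iff.mp h
  rw [mul_assoc]
  exact transportPath_gauge hc hw hv ⟨zero_le_one, le_rfl⟩

include hc in
/-- The preimage of an orbit under the parallel transport map is an orbit. -/
theorem preimage_orbit_eq_gaugeOrbit {X : Type*} [MulAction G X] {p q : X} {U : Subgroup G} (hU : U ≤ identityComponent F G)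
    {N : Set X} (hN : N = {x | ∃ a ∈ U, x = a • q}) {u : PathSpace c}
    (hu : parallelTransportTo p u ∈ N) :
    parallelTransportTo (c := c) p ⁻¹' N =
      gaugeOrbit (pathGroup c (identityComponent F G)
        (U.prod (isotropy (identityComponent F G) p))) u := by
  subst hN
  obtain ⟨a₁, ha₁, hua⟩ := hu
  have hua' : parallelTransport u • p = a₁ • q := hua
  refine Subset.antisymm ?_ ?_
  · rintro v ⟨a₂, ha₂, hva⟩
    have hva' : parallelTransport v • p = a₂ • q := hva
    have ha : a₂ * a₁⁻¹ ∈ U := mul_mem ha₂ (inv_mem ha₁)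
    obtain ⟨w, hw, hv⟩ := exists_gauge hc u v (a₂ * a₁⁻¹)
    refine ⟨_, gauge_mem_pathGroup (u := u) (v := v) hc ha (hU ha) ?_,
      isGaugeTransform_iff.mpr ⟨w, hw, hv⟩⟩
    rw [mul_smul, hua', hva', mul_smul, inv_smul_smul]
  · rintro v ⟨g, ⟨-, -, hg0, hg1⟩, hgv⟩
    have hg1' : g 1 • p = p := MulAction.mem_stabilizer_iff.mp hg1.2
    refine ⟨g 0 * a₁, U.mul_mem hg0 ha₁, ?_⟩
    change parallelTransport v • p = _
    rw [parallelTransport_gauge hc hgv, mul_smul, inv_smul_eq_iff.mpr hg1'.symm, mul_smul, hua',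
      mul_smul]

end Symmetries

/-! ### Transfer of weak reflectivity to the group and to the path space -/

section Transfer

variable {E : Type*} [NormedAddCommGroup E] [NormedSpace ℝ E]
  {M : Type*} [TopologicalSpace M] [ChartedSpace E M] [IsManifold 𝓘(ℝ, E) ∞ M]
  {F : Type*} [NormedAddCommGroup F] [NormedSpace ℝ F] [FiniteDimensional ℝ F]
  {G : Type*} [TopologicalSpace G] [T2Space G] [CompactSpace G] [ChartedSpace F G] [Group G]
  [LieGroup 𝓘(ℝ, F) ∞ G] [MulAction G M]
  {c : InnerProductSpace.Core ℝ (GroupLieAlgebra 𝓘(ℝ, F) G)} (hc : IsAdInvariant c)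

variable [ContMDiffSMul 𝓘(ℝ, F) 𝓘(ℝ, E) ∞ G M] {m : MetricFamily E M}

include hc in
/-- Weak reflectivity of `N` and of its preimage in the group. -/
theorem isWeaklyReflectiveSubmanifold_projPreimage_iff
    (hm : ∀ a : G, IsRiemannianIsometry m fun x : M => a • x)
    (htrans : ∀ x y : M, ∃ a ∈ identityComponent F G, a • x = y) {p : M}
    (hn : IsNormalHomogeneousMetric m c p) {N : Set M} (hN : ∃ k, IsEmbeddedSubmanifold E k N)
    {S : Subgroup G} (hS : S ≤ identityComponent F G) :
    IsWeaklyReflectiveSubmanifold (groupMetric c)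
      (twoSidedTranslations (S.prod (isotropy (identityComponent F G) p)))
      (projPreimage (identityComponent F G) p N) ↔
    IsWeaklyReflectiveSubmanifold m (actionOf M S) N := by
  refine isWeaklyReflectiveSubmanifold_preimage_iff isDefiniteFamily_groupMetric
    (isOpen_identityComponent hc) (contMDiff_smul_point E F p).contMDiffOn
    (fun a _ => isRiemannianSubmersionAt_smul_point hm hn a) hN ?_ ?_ ?_
  · rintro a ha _ ⟨s, hs, rfl⟩ - hsa hsN
    -- As `s` fixes `a • p`, this conjugate is an admissible right factor, and it is the one for
    -- which the two-sided translation fixes `a`.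
    have hst : a⁻¹ * s * a ∈ isotropy (identityComponent F G) p := by
      have hst₁ : a⁻¹ * s * a ∈ identityComponent F G := mul_mem (mul_mem (inv_mem ha) (hS hs)) ha
      refine ⟨hst₁, MulAction.mem_stabilizer_iff.mpr ?_⟩
      rw [mul_smul, mul_smul, inv_smul_eq_iff]
      exact hsa
    have hst' : (a⁻¹ * s * a)⁻¹ • p = p := inv_smul_eq_iff.mpr (MulAction.mem_stabilizer_iff.mp hst.2).symm
    have hiso := isRiemannianIsometry_twoSided hc s (a⁻¹ * s * a)
    have hψ : ∀ y : G, (s * y * (a⁻¹ * s * a)⁻¹) • p = s • y • p := fun y => by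
      rw [mul_smul, hst', mul_smul]
    refine ⟨fun y => s * y * (a⁻¹ * s * a)⁻¹, ⟨(s, a⁻¹ * s * a), ⟨hs, hst⟩, rfl⟩, hiso, by group, hψ,
      image_eq_of_bijective hiso.bijective fun y => and_congr ?_ ?_⟩
    · change s * y * (a⁻¹ * s * a)⁻¹ ∈ identityComponent F G ↔ y ∈ identityComponent F G
      rw [Subgroup.mul_mem_cancel_right _ (inv_mem hst.1), Subgroup.mul_mem_cancel_left _ (hS hs)]
    · change (s * y * (a⁻¹ * s * a)⁻¹) • p ∈ N ↔ y • p ∈ N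
      rw [hψ]
      conv_lhs => rw [← hsN]
      exact (MulAction.injective s).mem_set_image
  · rintro a - _ ⟨b, hb, rfl⟩ -
    refine ⟨_, ⟨b.1, hb.1, rfl⟩, hm b.1, fun y => ?_⟩
    have hb2 : b.2⁻¹ • p = p := inv_smul_eq_iff.mpr (MulAction.mem_stabilizer_iff.mp hb.2.2).symm
    simp only [mul_smul, hb2]
  · exact fun q _ => htrans p q

include hc in
/-- Weak reflectivity of `N` and of its preimage in the path space. -/
theorem isWeaklyReflectiveSubmanifold_preimage_parallelTransportTo_iff
    (hm : ∀ a : G, IsRiemannianIsometry m fun x : M => a • x)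
    (htrans : ∀ x y : M, ∃ a ∈ identityComponent F G, a • x = y) {p : M}
    (hn : IsNormalHomogeneousMetric m c p) {N : Set M} (hN : ∃ k, IsEmbeddedSubmanifold E k N)
    {S : Subgroup G} (hS : S ≤ identityComponent F G) :
    IsWeaklyReflectiveSubmanifold (flatMetric (PathSpace c))
      (gaugeTransformations (pathGroup c (identityComponent F G)
        (S.prod (isotropy (identityComponent F G) p))))
      (parallelTransportTo (c := c) p ⁻¹' N) ↔
    IsWeaklyReflectiveSubmanifold m (actionOf M S) N := by
  have hΦ := contMDiff_parallelTransport hc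
  have hπ := contMDiff_smul_point (M := M) (G := G) E F p
  rw [← univ_inter (parallelTransportTo (c := c) p ⁻¹' N)]
  refine isWeaklyReflectiveSubmanifold_preimage_iff (isDefiniteFamily_flatMetric _) isOpen_univ
    (hπ.comp hΦ).contMDiffOn
    (fun u _ => (isRiemannianSubmersionAt_smul_point hm hn (parallelTransport u)).comp
      (isDefiniteFamily_flatMetric _) (isRiemannianSubmersionAt_parallelTransport hc u)
      (hπ.mdifferentiable (by simp) _) (hΦ.mdifferentiable (by simp) _)) hN ?_ ?_ ?_
  · rintro x - _ ⟨s, hs, rfl⟩ - hsx hsN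
    have hsx' : (s * parallelTransport x) • p = parallelTransport x • p := by
      rw [mul_smul]; exact hsx
    have hg := gauge_mem_pathGroup (u := x) (v := x) hc hs (hS hs) hsx'
    obtain ⟨w, hw, hv⟩ := exists_gauge hc x x s
    -- The gauge transformation by `g` fixes `x`, being the one that carries `x` to `x` with initial
    -- value `s`.
    set g : ℝ → G := fun t => (transportPath x t)⁻¹ * (s * transportPath x t)
    have hiso := isRiemannianIsometry_sub_const (adIsometry hc hw.1) (adIsometry hc hw.1 w)
    have hae : ∀ u, ∀ᵐ t ∂(volume.restrict (Icc (0 : ℝ) 1)),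
        (adIsometry hc hw.1 u - adIsometry hc hw.1 w) t =
          adInner c (g t) (u t) - adInner c (g t) (w t) := fun u => by
      filter_upwards [Lp.coeFn_sub (adIsometry hc hw.1 u) (adIsometry hc hw.1 w),
        coeFn_adIsometry hc hw.1 u, coeFn_adIsometry hc hw.1 w] with t h1 h2 h3
      rw [h1, Pi.sub_apply, h2, h3]
    have hgauge : ∀ u, IsGaugeTransform g u (adIsometry hc hw.1 u - adIsometry hc hw.1 w) :=
      fun u => isGaugeTransform_iff.mpr ⟨w, hw, hae u⟩
    have hg0 : g 0 = s := by simp [g, transportPath_zero hc]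
    have hg1 : (g 1)⁻¹ • p = p :=
      inv_smul_eq_iff.mpr (MulAction.mem_stabilizer_iff.mp hg.2.2.2.2).symm
    have hψ : ∀ u, parallelTransportTo p (adIsometry hc hw.1 u - adIsometry hc hw.1 w) =
        s • parallelTransportTo p u := fun u => by
      change parallelTransport _ • p = s • parallelTransport u • p
      rw [parallelTransport_gauge hc (hgauge u), mul_smul, hg1, hg0, mul_smul]
    refine ⟨_, ⟨g, hg, hgauge⟩, hiso, ?_, hψ, image_eq_of_bijective hiso.bijective fun u => ?_⟩
    · refine L2Path.ext_ae ?_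
      filter_upwards [hae x, hv] with t h1 h2
      rw [h1, ← h2]
    · refine and_congr Iff.rfl ?_
      change parallelTransportTo p (adIsometry hc hw.1 u - adIsometry hc hw.1 w) ∈ N ↔
        parallelTransportTo p u ∈ N
      rw [hψ]
      conv_lhs => rw [← hsN]
      exact (MulAction.injective s).mem_set_image
  · rintro x - ν ⟨g, hg, hν⟩ -
    refine ⟨_, ⟨g 0, hg.2.2.1, rfl⟩, hm (g 0), fun u => ?_⟩
    have hg1 : (g 1)⁻¹ • p = p :=
      inv_smul_eq_iff.mpr (MulAction.mem_stabilizer_iff.mp hg.2.2.2.2).symm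
    change parallelTransport (ν u) • p = g 0 • parallelTransport u • p
    rw [parallelTransport_gauge hc (hν u), mul_smul, hg1, mul_smul]
  · intro q _
    obtain ⟨a, ha, rfl⟩ := htrans p q
    -- Transitivity of the identity component suffices because it is the whole range of `Φ`.
    have ha' : a ∈ range (parallelTransport (c := c)) := by
      rw [range_parallelTransport hc]; exact ha
    obtain ⟨u, rfl⟩ := ha'
    exact ⟨u, mem_univ u, rfl⟩

end Transfer

/-! ### The main theorem -/

theorem theorem2
    -- a Riemannian manifold `M`
    {E : Type*} [NormedAddCommGroup E] [NormedSpace ℝ E] [FiniteDimensional ℝ E]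
    {M : Type*} [TopologicalSpace M] [T2Space M] [ChartedSpace E M] [IsManifold 𝓘(ℝ, E) ∞ M]
    (h : Bundle.ContMDiffRiemannianMetric 𝓘(ℝ, E) ∞ E (fun x : M => TangentSpace 𝓘(ℝ, E) x))
    -- the compact Lie group `G` of its isometries
    {F : Type*} [NormedAddCommGroup F] [NormedSpace ℝ F] [FiniteDimensional ℝ F]
    {G : Type*} [TopologicalSpace G] [T2Space G] [CompactSpace G] [ChartedSpace F G] [Group G]
    [LieGroup 𝓘(ℝ, F) ∞ G] [MulAction G M] [ContMDiffSMul 𝓘(ℝ, F) 𝓘(ℝ, E) ∞ G M]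
    (hG : IsIsometryGroup G (metricOf h))
    -- its identity component `G₀` acts transitively
    (G₀ : Subgroup G) (hG₀ : G₀ = identityComponent F G)
    (htrans : ∀ x y : M, ∃ a ∈ G₀, a • x = y)
    -- the isotropy subgroup `K` of `G₀` at `p` acts irreducibly on the tangent space
    (p : M) (K : Subgroup G) (hK : K = isotropy G₀ p)
    (hirr : IsIsotropyIrreducible E K p)
    -- an `Ad(G)`-invariant inner product on the Lie algebra which induces the metric of `M`
    (c : InnerProductSpace.Core ℝ (GroupLieAlgebra 𝓘(ℝ, F) G)) (hc : IsAdInvariant c)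
    (hnormal : IsNormalHomogeneousMetric (metricOf h) c p)
    -- a closed submanifold `N` which is an orbit of the closed subgroup `U` of `G₀`
    (N : Set M) (hNclosed : IsClosed N) (hNsub : ∃ k : ℕ, IsEmbeddedSubmanifold E k N)
    (U : Subgroup G) (hUG₀ : U ≤ G₀) (hUclosed : IsClosed (U : Set G))
    (hNU : ∃ q : M, N = {x | ∃ a ∈ U, x = a • q})
    -- a closed subgroup `S` of `G₀` which is normalized by `U`
    (S : Subgroup G) (hSG₀ : S ≤ G₀) (hSclosed : IsClosed (S : Set G))
    (hSU : ∀ a ∈ U, S.map (MulAut.conj a).toMonoidHom = S) :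
    (∀ u : PathSpace c, parallelTransportTo p u ∈ N →
      parallelTransportTo (c := c) p ⁻¹' N = gaugeOrbit (pathGroup c G₀ (U.prod K)) u) ∧
    List.TFAE [
      IsWeaklyReflectiveSubmanifold (metricOf h) (actionOf M S) N,
      IsWeaklyReflectiveSubmanifold (groupMetric c) (twoSidedTranslations (S.prod K))
        (projPreimage G₀ p N),
      IsPFSubmanifold (parallelTransportTo (c := c) p ⁻¹' N) ∧
        IsWeaklyReflectiveSubmanifold (flatMetric (PathSpace c))
          (gaugeTransformations (pathGroup c G₀ (S.prod K)))
          (parallelTransportTo (c := c) p ⁻¹' N)] := by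
  subst hG₀ hK
  obtain ⟨q, hq⟩ := hNU
  obtain ⟨k, hk⟩ := hNsub
  refine ⟨fun u hu => preimage_orbit_eq_gaugeOrbit hc hUG₀ hq hu, ?_⟩
  have hm : ∀ a : G, IsRiemannianIsometry (metricOf h) fun x : M => a • x := hG.2.1
  have hπ := contMDiff_smul_point (M := M) (G := G) E F p
  -- The preimage is taken in all of `G`, where `π` is still a submersion; its preimage under `Φ` is
  -- that of `N` under `π ∘ Φ`.
  have hpre : IsEmbeddedSubmanifold F k ((fun a : G => a • p) ⁻¹' N) := by
    have := hk.preimage isOpen_univ hπ.contMDiffOn fun a _ =>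
      (isRiemannianSubmersionAt_smul_point hm hnormal a).surjective
    rwa [univ_inter] at this
  -- The PF property is independent of reflectivity, so only the reflective half of the third
  -- statement has to be transferred.
  have hPF : IsPFSubmanifold (parallelTransportTo (c := c) p ⁻¹' N) :=
    isPFSubmanifold_preimage_parallelTransport hc hpre (hNclosed.preimage hπ.continuous)
  have h12 := isWeaklyReflectiveSubmanifold_projPreimage_iff hc hm htrans hnormal ⟨k, hk⟩ hSG₀
  have h13 := isWeaklyReflectiveSubmanifold_preimage_parallelTransportTo_iff hc hm htrans hnormal
    ⟨k, hk⟩ hSG₀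
  tfae_have 1 ↔ 2 := h12.symm
  tfae_have 1 ↔ 3 := ⟨fun h1 => ⟨hPF, h13.mpr h1⟩, fun h3 => h13.mp h3.2⟩
  tfae_finish
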